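/- Let $\lambda,\mu\ge 0$ with $2\lambda+\mu>0$, let $E,T>0$, and put $A=\mu\frac{E-T}{2E}$, $\gamma(v)=(2\pi T)^{-1/2}e^{-v^2/(2T)}$. For finite Borel measures on $\mathbb R$ let $B_2[\nu,\tilde\nu]$ be the measure with $\int\phi\,dB_2[\nu,\tilde\nu]=\iint\int_0^{2\pi}\phi(v\cos\theta+v_*\sin\theta)\frac{d\theta}{2\pi}\nu(dv)\tilde\nu(dv_*)$; for densities, $B_2[f,g](v)=\int_{\mathbb R}\int_0^{2\pi}f(v\cos\theta-v_*\sin\theta)\,g(v\sin\theta+v_*\cos\theta)\frac{d\theta}{2\pi}dv_*$. A family $(f_t)_{t\ge0}$ of Borel probability measures on $\mathbb R$ is a weak solution of the thermostated Kac equation with rescaling $$\partial_t f_t=2\lambda(B_2[f_t,f_t]-f_t)+\mu(\gamma-f_t)-A\,\partial_v(vf_t)$$ if the images $g_t$ of $f_t$ under $v\mapsto e^{-At}v$ depend continuously on $t$ in total variation and satisfy, for all $t\ge 0$, $g_t=f_0+\int_0^t\{2\lambda(B_2[g_s,g_s]-g_s)+\mu(B_1[s]-g_s)\}ds$, where $B_1[s](dv)=e^{As}\gamma(e^{As}v)dv$.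 Call $\int v^2\nu(dv)$ the energy of $\nu$, and call a probability measure admissible if its energy is finite and, in the energy-conserving case $\mu=0$, equal to $E$. Let $W_2$ be the 2-Wasserstein distance, $C_r=1-2\int_0^{2\pi}|\cos\theta|^r\frac{d\theta}{2\pi}$, and for real $p\ge0$ consider the condition $$(\ast)_p\qquad \frac TE<1+\frac{2}{p+1}\Big(\frac{\mu}{2\lambda+\mu}\Big)^{-1},$$ whose right-hand side is $+\infty$ if $\mu=0$. Then there is a probability measure $f_\infty$ on $\mathbb R$ with energy $E$ such that every weak solution $(f_t)$ with admissible $f_0$ converges weakly to $f_\infty$ as $t\to\infty$, with $$W_2(f_t,f_\infty)\le W_2(f_0,f_\infty)\,e^{-\frac{\mu T}{2E}t}\qquad(t\ge0),$$ and $f_\infty$ is the unique admissible stationary weak solution. Moreover $f_\infty$ has a density, again denoted $f_\infty$, such that: (i) $f_\infty$ is even and non-increasing on $(0,\infty)$. (ii) For every real $r>2$: $\int f_\infty(v)|v|^r\,dv<\infty$ if and only if $rA<2\lambda C_r+\mu$. (iii) $f_\infty\in C^\infty(\mathbb R\setminus\{0\})$, and for every $v\ne0$ the integral defining $B_2[f_\infty,f_\infty](v)$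 converges absolutely and $A\,\partial_v(vf_\infty(v))=2\lambda(B_2[f_\infty,f_\infty](v)-f_\infty(v))+\mu(\gamma(v)-f_\infty(v))$. (iv) For every integer $p\ge0$, $f_\infty\in C^p(\mathbb R)$ if and only if $(\ast)_p$ holds; for every real $p>0$, $\int_{\mathbb R}|\hat f_\infty(\xi)||\xi|^p\,d\xi<\infty$ if and only if $(\ast)_p$ holds, where $\hat f_\infty$ is the Fourier transform. If $(\ast)_0$ fails, i.e. $\frac TE\ge1+2\big(\frac{\mu}{2\lambda+\mu}\big)^{-1}$, then $\lim_{v\to0}f_\infty(v)=\infty$. If $E\ge T$, then $f_\infty$ is real analytic on $\mathbb R$. -/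

import Mathlib

open MeasureTheory ProbabilityTheory Filter Topology
open scoped ENNReal ContDiff FourierTransform

noncomputable section

namespace ThermostatedKac

/-- The second moment `∫ v² ν(dv)` of a measure on the line, with values in `[0, ∞]`. -/
def energy (ν : Measure ℝ) : ℝ≥0∞ := ∫⁻ v, ENNReal.ofReal (v ^ 2) ∂ν

/-- `π` is a coupling of `ν` and `ν'`: a measure on the plane with these marginals. -/
def IsCoupling (π : Measure (ℝ × ℝ)) (ν ν' : Measure ℝ) : Prop :=
  π.map Prod.fst = ν ∧ π.map Prod.snd = ν'

/-- The 2-Wasserstein distance of two probability measures on the line, with values in `[0, ∞]`. -/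
def W2 (ν ν' : ProbabilityMeasure ℝ) : ℝ≥0∞ :=
  (⨅ (π : Measure (ℝ × ℝ)) (_ : IsCoupling π ν ν'),
    ∫⁻ z, ENNReal.ofReal (|z.1 - z.2| ^ 2) ∂π) ^ (1 / 2 : ℝ)

/-- The distance `sup_S |ν(S) - ν'(S)|` over Borel sets, which for probability measures is half of
the total variation norm of `ν - ν'`. -/
def tvDist (ν ν' : Measure ℝ) : ℝ≥0∞ :=
  ⨆ (S : Set ℝ) (_ : MeasurableSet S), ENNReal.ofReal |ν.real S - ν'.real S|

/-- The uniform probability measure `dθ / 2π` on `[0, 2π)`. -/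
def uniformAngle : Measure ℝ := ProbabilityTheory.cond volume (Set.Ico 0 (2 * Real.pi))

/-- The collision operator `B₂[ν, ν']`: the law of `v cos θ + v⁎ sin θ` under
`dθ/2π ν(dv) ν'(dv⁎)`. -/
def B2 (ν ν' : Measure ℝ) : Measure ℝ :=
  (uniformAngle.prod (ν.prod ν')).map
    (fun x => x.2.1 * Real.cos x.1 + x.2.2 * Real.sin x.1)

/-- The integrand of the collision operator on densities:
`f(v') g(v⁎')` with `v' = v cos θ - w sin θ`, `v⁎' = v sin θ + w cos θ`. -/
def collisionIntegrand (f g : ℝ → ℝ) (v w θ : ℝ) : ℝ :=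
  f (v * Real.cos θ - w * Real.sin θ) * g (v * Real.sin θ + w * Real.cos θ)

/-- The collision operator on densities,
`B₂[f, g](v) = ∫ ∫₀^{2π} f(v') g(v⁎') dθ/2π dv⁎`. -/
def B2density (f g : ℝ → ℝ) (v : ℝ) : ℝ :=
  ∫ w : ℝ, (∫ θ in (0 : ℝ)..(2 * Real.pi), collisionIntegrand f g v w θ) / (2 * Real.pi)

/-- The thermostat law: the centred Gaussian of variance `T`. -/
def thermostat (T : ℝ) : Measure ℝ := gaussianReal 0 T.toNNReal

/-- The thermostat density `γ(v) = (2πT)^{-1/2} e^{-v²/(2T)}`. -/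
def thermostatDensity (T v : ℝ) : ℝ := gaussianPDFReal 0 T.toNNReal v

/-- The drift constant `A = μ (E - T) / (2E)`. -/
def drift (mu E T : ℝ) : ℝ := mu * ((E - T) / (2 * E))

/-- The image of `ν` under `v ↦ e^{-At} v`. -/
def contractBy (A t : ℝ) (ν : Measure ℝ) : Measure ℝ := ν.map (fun v => Real.exp (-A * t) * v)

/-- `B₁[t]`, the measure with density `e^{At} γ(e^{At} v)`; equivalently the image of the
thermostat law under `v ↦ e^{-At} v`. -/
def B1 (A T t : ℝ) : Measure ℝ := contractBy A t (thermostat T)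

/-- Weak solutions `(f_t)_{t ≥ 0}` of the thermostated Kac equation with rescaling
`∂ₜ f = 2λ (B₂[f, f] - f) + μ (γ - f) - A ∂ᵥ (v f)`.
The rescaled curve `g_t`, the image of `f_t` under `v ↦ e^{-At} v`, is continuous in total variation
on `[0, ∞)`, and
`g_t = f_0 + ∫₀ᵗ {2λ (B₂[g_s, g_s] - g_s) + μ (B₁[s] - g_s)} ds` as measures, i.e. after
integration against every bounded Borel function. Only the values `f t` for `t ≥ 0` matter. -/
structure IsWeakSolution (lam mu E T : ℝ) (f : ℝ → ProbabilityMeasure ℝ) : Prop where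
  continuous_tv : ∀ t : ℝ, 0 ≤ t →
    Tendsto (fun s => tvDist (contractBy (drift mu E T) s (f s))
      (contractBy (drift mu E T) t (f t))) (𝓝[Set.Ici 0] t) (𝓝 0)
  integral_eq : ∀ t : ℝ, 0 ≤ t → ∀ φ : ℝ → ℝ, Measurable φ → (∃ C : ℝ, ∀ v, |φ v| ≤ C) →
    ∫ v, φ v ∂(contractBy (drift mu E T) t (f t)) =
      ∫ v, φ v ∂(f 0 : Measure ℝ) +
      ∫ s in (0 : ℝ)..t,
        (2 * lam *
            (∫ v, φ v ∂(B2 (contractBy (drift mu E T) s (f s))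
                (contractBy (drift mu E T) s (f s)))
              - ∫ v, φ v ∂(contractBy (drift mu E T) s (f s)))
          + mu *
            (∫ v, φ v ∂(B1 (drift mu E T) T s)
              - ∫ v, φ v ∂(contractBy (drift mu E T) s (f s))))

/-- A stationary weak solution: the constant curve is a weak solution. -/
def IsStationary (lam mu E T : ℝ) (ν : ProbabilityMeasure ℝ) : Prop :=
  IsWeakSolution lam mu E T (fun _ => ν)

/-- Admissible energies: finite, and equal to `E` in the energy-conserving case `μ = 0`. -/
def HasAdmissibleEnergy (mu E : ℝ) (ν : ProbabilityMeasure ℝ) : Prop :=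
  energy ν < ⊤ ∧ (mu = 0 → energy ν = ENNReal.ofReal E)

/-- The constant `C_r = 1 - 2 ∫₀^{2π} |cos θ|^r dθ/2π`. -/
def momentConst (r : ℝ) : ℝ :=
  1 - 2 * ((∫ θ in (0 : ℝ)..(2 * Real.pi), |Real.cos θ| ^ r) / (2 * Real.pi))

/-- The condition `T/E < 1 + (2/(p+1)) (μ/(2λ+μ))⁻¹`, whose right side is `+∞` if `μ = 0`. -/
def RegularityCondition (lam mu E T p : ℝ) : Prop :=
  mu = 0 ∨ T / E < 1 + 2 / (p + 1) * (mu / (2 * lam + mu))⁻¹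

end ThermostatedKac

end

open ThermostatedKac

/-! The equilibrium is a mixture of centred Gaussians. If two independent centred Gaussians of
variances `a` and `b` collide at angle `θ`, the outcome is centred Gaussian of variance `a cos² θ +
b sin² θ`, and the drift over time `u` multiplies a variance by `e^{2Au}`. So a mixture with
variance law `M` is stationary as soon as `M` is the law of `e^{2Au} ζ`, where `u` is exponential of
rate `2λ + μ` and `ζ` is `a cos² θ + b sin² θ` with probability `2λ/(2λ+μ)` and `T` otherwise
(`varianceStep`, `IsVarianceLaw.gaussianMixture_eq`). For `μ > 0` this is a smoothing transform with
nonnegative weights, solved by a series over an independently labelled binary tree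
(`exists_smoothing_fixedPoint`). The value of `A` is exactly the one for which the mean is `E`. For
`μ = 0` the series vanishes, and `M` is the point mass at `E`.

Stationarity is the equivalence between a law sampled at an exponential time and the integrated
equation (`integral_eq_of_fixedPoint`).

For convergence, two solutions are coupled through common collision trees, angles and thermostat
velocities. A collision preserves the mean squared distance, since the cross term averages out over
the angle, while a thermostat event sets the distance to zero. This gives the factor `e^{-μt}` for
the rescaled curves, and `e^{(2A-μ)t} = e^{-(μT/E)t}` after undoing the rescaling
(`exists_coupling`, `IsWeakSolution.W2_le`). The coupling is built as an increasing limit of partial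
couplings dominated by the solutions, so no uniqueness theorem is needed. For `μ = 0` the estimate
does not contract. There the sine transform decays like `e^{-2λt}`, and the difference of cosine
transforms, which is `o(ξ²)` at the origin because the energies agree, decays in a fourth-order
distance, as the mean of `cos⁴ + sin⁴` is `3/4 < 1` (`abs_cosMean_sub_le`). Uniqueness of the
equilibrium follows by applying convergence to constant curves.

The remaining properties are read off from `M`. Moments of order `r` of the equilibrium are moments
of order `r/2` of `M`. To leading order a collision multiplies the `q`-th moment by `1 - C_{2q}`,
the cross terms being of lower order, which yields the moment threshold. Weighted integrals of the
Fourier transform with weight `|ξ|^p` are moments of order `-(p+1)/2` of `M`. Collisions do not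
obstruct these, since `a cos² θ + b sin² θ` is small only if both variances are small or the angle
is nearly degenerate. The threshold is therefore that of the thermostat term, the finiteness of `𝔼
e^{-2Aqu}` (`IsVarianceLaw.lintegral_rpow_neg_ne_top_iff`).

Off the origin the Gaussian density is holomorphic with bounds uniform in the variance, which gives
smoothness there; if `T ≤ E` the variance is at least `T` when `μ > 0`, and equal to `E` when `μ =
0`, so the bounds hold everywhere. At the origin, integrability of the Fourier transform gives
`C^p`. The converse climbs one order at a time: from even to odd order a power lower bound on the
transform produces a corner in the even function `cosFourier`, and from odd to even order a second
difference and Fatou give the next moment (`lintegral_rpow_neg_ne_top_of_contDiff`). -/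

namespace ThermostatedKac

/-! ### Fixed points of smoothing transforms -/

section Smoothing

/-- Glue a root label and two labelled binary trees. -/
def graft {W : Type*} (x : W × ((List Bool → W) × (List Bool → W))) : List Bool → W
  | [] => x.1
  | false :: l => x.2.1 l
  | true :: l => x.2.2 l

lemma measurable_graft {W : Type*} [MeasurableSpace W] : Measurable (graft (W := W)) := by
  refine measurable_pi_lambda _ fun l => ?_
  match l with
  | [] => exact measurable_fst
  | false :: l => exact (measurable_pi_apply l).comp (measurable_fst.comp measurable_snd)
  | true :: l => exact (measurable_pi_apply l).comp (measurable_snd.comp measurable_snd)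

/-- Every word is empty or begins with one of the two letters. This splits the mass of a cylinder
set of the labelled tree into root and subtrees, as needed in `map_graft`. -/
lemma prod_list_bool_split (s : Finset (List Bool)) (f : List Bool → ℝ≥0∞) :
    ∏ l ∈ s, f l = (if [] ∈ s then f [] else 1) *
      ((∏ l ∈ s.preimage (List.cons false) (List.cons_injective.injOn), f (false :: l)) *
       ∏ l ∈ s.preimage (List.cons true) (List.cons_injective.injOn), f (true :: l)) := by
  classical
  have h1 : ∏ l ∈ s.preimage (List.cons false) (List.cons_injective.injOn), f (false :: l) =
      ∏ l ∈ s with l ∈ Set.range (List.cons false), f l :=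
    Finset.prod_preimage' _ _ _ _
  have h2 : ∏ l ∈ s.preimage (List.cons true) (List.cons_injective.injOn), f (true :: l) =
      ∏ l ∈ s with l ∈ Set.range (List.cons true), f l :=
    Finset.prod_preimage' _ _ _ _
  have h3 : (if [] ∈ s then f [] else 1) = ∏ l ∈ s with l = [], f l := by
    rw [Finset.prod_filter, Finset.prod_ite_eq']
  rw [h1, h2, h3, Finset.prod_filter, Finset.prod_filter, Finset.prod_filter,
    ← Finset.prod_mul_distrib, ← Finset.prod_mul_distrib]
  refine Finset.prod_congr rfl fun l _ => ?_
  match l with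
  | [] => simp
  | false :: l => simp
  | true :: l => simp

/-- Self-similarity of the tree with independent labels: the root label and the two subtrees are
independent, and each subtree has the law of the whole. It suffices to compare on cylinder sets. -/
lemma map_graft {W : Type*} [MeasurableSpace W] (ρ : Measure W) [IsProbabilityMeasure ρ] :
    (ρ.prod ((Measure.infinitePi fun _ : List Bool => ρ).prod
      (Measure.infinitePi fun _ : List Bool => ρ))).map graft =
      Measure.infinitePi fun _ : List Bool => ρ := by
  classical
  refine Measure.eq_infinitePi _ fun s t ht => ?_
  rw [Measure.map_apply measurable_graft
    (MeasurableSet.pi s.countable_toSet fun i _ => ht i)]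
  set s1 := s.preimage (List.cons false) (List.cons_injective.injOn)
  set s2 := s.preimage (List.cons true) (List.cons_injective.injOn)
  have : graft ⁻¹' (Set.pi s t) = (if [] ∈ s then t [] else Set.univ) ×ˢ
      ((Set.pi s1 fun l => t (false :: l)) ×ˢ (Set.pi s2 fun l => t (true :: l))) := by
    ext ⟨w, x, y⟩
    simp only [Set.mem_preimage, Set.mem_pi, Set.mem_prod, Finset.mem_coe]
    constructor
    · intro h
      refine ⟨?_, fun l hl => ?_, fun l hl => ?_⟩
      · split_ifs with h0
        · exact h [] h0
        · trivial
      · exact h (false :: l) (by simpa [s1] using hl)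
      · exact h (true :: l) (by simpa [s2] using hl)
    · rintro ⟨h0, h1, h2⟩ l hl
      match l with
      | [] => rw [if_pos hl] at h0; exact h0
      | false :: l => exact h1 l (by simpa [s1] using hl)
      | true :: l => exact h2 l (by simpa [s2] using hl)
  rw [this, Measure.prod_prod, Measure.prod_prod, Measure.infinitePi_pi _ fun i _ => ht _,
    Measure.infinitePi_pi _ fun i _ => ht _, prod_list_bool_split s]
  congr 1
  split_ifs <;> simp

/-- The partial sums, to depth `n`, of the weighted branching series `S = w₁ S_l + w₂ S_r + b`. -/
noncomputable def treeSum : ℕ → (List Bool → ℝ≥0∞ × ℝ≥0∞ × ℝ≥0∞) → ℝ≥0∞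
  | 0, _ => 0
  | n + 1, ζ => (ζ []).1 * treeSum n (fun l => ζ (false :: l)) +
      (ζ []).2.1 * treeSum n (fun l => ζ (true :: l)) + (ζ []).2.2

lemma measurable_treeSum (n : ℕ) : Measurable (treeSum n) := by
  induction n with
  | zero => exact measurable_const
  | succ n ih =>
    have h1 : Measurable fun ζ : List Bool → ℝ≥0∞ × ℝ≥0∞ × ℝ≥0∞ => fun l => ζ (false :: l) := by
      fun_prop
    have h2 : Measurable fun ζ : List Bool → ℝ≥0∞ × ℝ≥0∞ × ℝ≥0∞ => fun l => ζ (true :: l) := by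
      fun_prop
    have h3 := ih.comp h1
    have h4 := ih.comp h2
    have h5 : Measurable fun ζ : List Bool → ℝ≥0∞ × ℝ≥0∞ × ℝ≥0∞ => ζ [] := by fun_prop
    simp only [treeSum]
    exact ((h5.fst.mul h3).add (h5.snd.fst.mul h4)).add h5.snd.snd

lemma treeSum_le_succ (n : ℕ) : ∀ ζ, treeSum n ζ ≤ treeSum (n + 1) ζ := by
  induction n with
  | zero => intro ζ; simp [treeSum]
  | succ n ih =>
    intro ζ
    rw [treeSum, treeSum]
    gcongr <;> exact ih _

lemma monotone_treeSum (ζ) : Monotone fun n => treeSum n ζ :=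
  monotone_nat_of_le_succ fun n => treeSum_le_succ n ζ

/-- The weighted branching series. -/
noncomputable def treeLimit (ζ : List Bool → ℝ≥0∞ × ℝ≥0∞ × ℝ≥0∞) : ℝ≥0∞ := ⨆ n, treeSum n ζ

lemma measurable_treeLimit : Measurable treeLimit := .iSup measurable_treeSum

/-- With values in `[0, ∞]` the recursion passes to the limit by monotonicity alone. Finiteness is a
separate matter, settled later by the mean. -/
lemma treeLimit_eq (ζ) : treeLimit ζ = (ζ []).1 * treeLimit (fun l => ζ (false :: l)) +
      (ζ []).2.1 * treeLimit (fun l => ζ (true :: l)) + (ζ []).2.2 := by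
  have h0 : treeLimit ζ = ⨆ n, treeSum (n + 1) ζ :=
    ((monotone_treeSum ζ).iSup_nat_add 1).symm
  rw [h0]
  simp only [treeSum, treeLimit, ENNReal.mul_iSup]
  rw [ENNReal.iSup_add_iSup_of_monotone, ENNReal.iSup_add]
  · exact fun i j h => mul_le_mul_right (monotone_treeSum _ h) _
  · exact fun i j h => mul_le_mul_right (monotone_treeSum _ h) _

variable (ρ : Measure (ℝ≥0∞ × ℝ≥0∞ × ℝ≥0∞)) [IsProbabilityMeasure ρ]

/-- Turns a pathwise recursion on trees into an equation between laws. -/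
lemma lintegral_graft {F : (List Bool → ℝ≥0∞ × ℝ≥0∞ × ℝ≥0∞) → ℝ≥0∞} (hF : Measurable F) :
    ∫⁻ ζ, F ζ ∂(Measure.infinitePi fun _ => ρ) =
      ∫⁻ w, ∫⁻ x, ∫⁻ y, F (graft (w, x, y)) ∂(Measure.infinitePi fun _ => ρ)
        ∂(Measure.infinitePi fun _ => ρ) ∂ρ := by
  conv_lhs => rw [← map_graft ρ, lintegral_map hF measurable_graft]
  have hG : Measurable fun x => F (graft x) := hF.comp measurable_graft
  rw [lintegral_prod _ hG.aemeasurable]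
  refine lintegral_congr fun w => ?_
  have hGw : Measurable fun x => F (graft (w, x)) := hG.comp measurable_prodMk_left
  rw [lintegral_prod _ hGw.aemeasurable]

/-- A smoothing transform with nonnegative weights has a smallest fixed point, which is the
monotone limit of its iterates started from `0`. -/
theorem exists_smoothing_fixedPoint :
    ∃ (m : Measure ℝ≥0∞) (mseq : ℕ → Measure ℝ≥0∞), IsProbabilityMeasure m ∧
      (∀ n, IsProbabilityMeasure (mseq n)) ∧ mseq 0 = Measure.dirac 0 ∧
      (∀ n, ∀ F : ℝ≥0∞ → ℝ≥0∞, Measurable F → ∫⁻ s, F s ∂(mseq (n + 1)) =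
        ∫⁻ w, ∫⁻ a, ∫⁻ b, F (w.1 * a + w.2.1 * b + w.2.2) ∂(mseq n) ∂(mseq n) ∂ρ) ∧
      (∀ F : ℝ≥0∞ → ℝ≥0∞, Measurable F → ∫⁻ s, F s ∂m =
        ∫⁻ w, ∫⁻ a, ∫⁻ b, F (w.1 * a + w.2.1 * b + w.2.2) ∂m ∂m ∂ρ) ∧
      (∀ F : ℝ≥0∞ → ℝ≥0∞, Monotone F → Continuous F → ∫⁻ s, F s ∂m = ⨆ n, ∫⁻ s, F s ∂(mseq n)) := by
  set P := Measure.infinitePi fun _ : List Bool => ρ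
  refine ⟨P.map treeLimit, fun n => P.map (treeSum n),
    Measure.isProbabilityMeasure_map measurable_treeLimit.aemeasurable,
    fun n => Measure.isProbabilityMeasure_map (measurable_treeSum n).aemeasurable, ?_, ?_, ?_, ?_⟩
  · have : treeSum 0 = fun _ => 0 := by ext; rfl
    simp only [this]
    rw [Measure.map_const, measure_univ, one_smul]
  · intro n F hF
    have hG : Measurable fun x => F (treeSum (n + 1) x) := hF.comp (measurable_treeSum _)
    rw [lintegral_map hF (measurable_treeSum _), lintegral_graft ρ hG]
    refine lintegral_congr fun w => ?_
    rw [lintegral_map _ (measurable_treeSum _)]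
    · refine lintegral_congr fun x => ?_
      rw [lintegral_map _ (measurable_treeSum _)]
      · rfl
      · fun_prop
    · refine Measurable.lintegral_prod_right' (f := fun p : ℝ≥0∞ × ℝ≥0∞ =>
        F (w.1 * p.1 + w.2.1 * p.2 + w.2.2)) ?_
      fun_prop
  · intro F hF
    have hG : Measurable fun x => F (treeLimit x) := hF.comp measurable_treeLimit
    rw [lintegral_map hF measurable_treeLimit, lintegral_graft ρ hG]
    refine lintegral_congr fun w => ?_
    rw [lintegral_map _ measurable_treeLimit]
    · refine lintegral_congr fun x => ?_
      rw [lintegral_map _ measurable_treeLimit]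
      · refine lintegral_congr fun y => ?_
        rw [treeLimit_eq]
        rfl
      · fun_prop
    · refine Measurable.lintegral_prod_right' (f := fun p : ℝ≥0∞ × ℝ≥0∞ =>
        F (w.1 * p.1 + w.2.1 * p.2 + w.2.2)) ?_
      fun_prop
  · intro F hF hFc
    rw [lintegral_map hFc.measurable measurable_treeLimit]
    simp only [treeLimit]
    have : ∀ ζ, F (⨆ n, treeSum n ζ) = ⨆ n, F (treeSum n ζ) := fun ζ =>
      Monotone.map_ciSup_of_continuousAt hFc.continuousAt hF (OrderTop.bddAbove _)
    simp only [this]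
    have hG : ∀ n, Measurable fun x => F (treeSum n x) := fun n =>
      hFc.measurable.comp (measurable_treeSum n)
    rw [lintegral_iSup hG (fun i j h ζ => hF (monotone_treeSum ζ h))]
    refine iSup_congr fun n => ?_
    rw [lintegral_map hFc.measurable (measurable_treeSum n)]

end Smoothing

/-! ### The exponential clock and the uniform angle -/

/-- The exponential law with rate `k`. -/
noncomputable def expLaw (k : ℝ) : Measure ℝ :=
  (volume.restrict (Set.Ioi 0)).withDensity fun u => ENNReal.ofReal (k * Real.exp (-k * u))

lemma lintegral_expLaw (k : ℝ) (F : ℝ → ℝ≥0∞) :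
    ∫⁻ u, F u ∂(expLaw k) =
      ∫⁻ u in Set.Ioi 0, ENNReal.ofReal (k * Real.exp (-k * u)) * F u := by
  rw [expLaw, lintegral_withDensity_eq_lintegral_mul_non_measurable _ (by fun_prop)
    (ae_of_all _ fun _ => ENNReal.ofReal_lt_top)]
  rfl

lemma lintegral_expLaw_exp {k c : ℝ} (hk : 0 < k) (hc : c < k) :
    ∫⁻ u, ENNReal.ofReal (Real.exp (c * u)) ∂(expLaw k) = ENNReal.ofReal (k / (k - c)) := by
  rw [lintegral_expLaw]
  have h1 : ∀ u : ℝ, ENNReal.ofReal (k * Real.exp (-k * u)) * ENNReal.ofReal (Real.exp (c * u)) =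
      ENNReal.ofReal (k * Real.exp (-(k - c) * u)) := by
    intro u
    rw [← ENNReal.ofReal_mul (by positivity), mul_assoc, ← Real.exp_add]
    ring_nf
  simp only [h1]
  have h2 : -(k - c) < 0 := by linarith
  rw [← ofReal_integral_eq_lintegral_ofReal
    ((integrableOn_exp_mul_Ioi h2 0).const_mul k)
    (ae_of_all _ fun u => by positivity), integral_const_mul, integral_exp_mul_Ioi h2]
  congr 1
  have h3 : k - c ≠ 0 := by linarith
  rw [mul_zero, Real.exp_zero, neg_div_neg_eq]
  field_simp

lemma isProbabilityMeasure_expLaw {k : ℝ} (hk : 0 < k) : IsProbabilityMeasure (expLaw k) := by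
  constructor
  have := lintegral_expLaw_exp hk hk
  simpa [hk.ne'] using this

/-- The integrand stays above a positive constant on a half-line. This divergence is one source of
the necessity of the moment conditions. -/
lemma lintegral_expLaw_exp_eq_top {k c : ℝ} (hk : 0 < k) (hc : k ≤ c) :
    ∫⁻ u, ENNReal.ofReal (Real.exp (c * u)) ∂(expLaw k) = ⊤ := by
  rw [lintegral_expLaw, eq_top_iff]
  calc (⊤ : ℝ≥0∞) = ∫⁻ u in Set.Ioi (0 : ℝ), ENNReal.ofReal k := by
        simp [hk]
    _ ≤ _ := by
        refine setLIntegral_mono' measurableSet_Ioi fun u hu => ?_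
        rw [← ENNReal.ofReal_mul (by positivity), mul_assoc, ← Real.exp_add]
        refine ENNReal.ofReal_le_ofReal ?_
        have : 1 ≤ Real.exp (-k * u + c * u) := by
          apply Real.one_le_exp
          have := Set.mem_Ioi.1 hu
          nlinarith
        nlinarith

instance : IsProbabilityMeasure uniformAngle := by
  unfold uniformAngle
  refine cond_isProbabilityMeasure_of_finite ?_ ?_
  · simp [Real.pi_pos]
  · rw [Real.volume_Ico]; exact ENNReal.ofReal_ne_top

/-- The half-open interval is switched to the convention of interval integrals; the endpoints are
null. -/
lemma uniformAngle_eq : uniformAngle =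
    (ENNReal.ofReal (2 * Real.pi))⁻¹ • volume.restrict (Set.Ioc 0 (2 * Real.pi)) := by
  rw [uniformAngle, ProbabilityTheory.cond, restrict_Ico_eq_restrict_Ioc]
  simp

lemma integral_uniformAngle (F : ℝ → ℝ) :
    ∫ θ, F θ ∂uniformAngle = (∫ θ in (0 : ℝ)..(2 * Real.pi), F θ) / (2 * Real.pi) := by
  rw [uniformAngle_eq, integral_smul_measure,
    intervalIntegral.integral_of_le (by positivity), ENNReal.toReal_inv,
    ENNReal.toReal_ofReal (by positivity), smul_eq_mul]
  ring

lemma integrable_uniformAngle_of_continuous {F : ℝ → ℝ} (hF : Continuous F) :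
    Integrable F uniformAngle := by
  rw [uniformAngle_eq]
  refine Integrable.smul_measure ?_ (by simp [Real.pi_pos])
  exact (hF.integrableOn_Icc (a := 0) (b := 2 * Real.pi)).mono_set Set.Ioc_subset_Icc_self

lemma lintegral_uniformAngle_ofReal {F : ℝ → ℝ} (hF : Continuous F) (h0 : ∀ θ, 0 ≤ F θ) :
    ∫⁻ θ, ENNReal.ofReal (F θ) ∂uniformAngle =
      ENNReal.ofReal ((∫ θ in (0 : ℝ)..(2 * Real.pi), F θ) / (2 * Real.pi)) := by
  rw [← integral_uniformAngle, ofReal_integral_eq_lintegral_ofReal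
    (integrable_uniformAngle_of_continuous hF) (ae_of_all _ h0)]

/-! ### The law of the random variance -/

/-- The law of `e^{2Au} ζ` tested against `F`, where `u` is exponential with rate `2λ + μ`, and `ζ`
is `a cos² θ + b sin² θ` (with `a`, `b` of law `m`, in a collision) or `T` (in a thermostat event).
This is the action of the gain part of the equation on the variance of a Gaussian mixture. -/
noncomputable def varianceStep (lam mu T A : ℝ) (m : Measure ℝ) (F : ℝ → ℝ≥0∞) : ℝ≥0∞ :=
  ENNReal.ofReal (2 * lam / (2 * lam + mu)) *
    ∫⁻ u, ∫⁻ θ, ∫⁻ a, ∫⁻ b,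
      F (Real.exp (2 * A * u) * (Real.cos θ ^ 2 * a + Real.sin θ ^ 2 * b)) ∂m ∂m
      ∂uniformAngle ∂(expLaw (2 * lam + mu)) +
  ENNReal.ofReal (mu / (2 * lam + mu)) *
    ∫⁻ u, F (Real.exp (2 * A * u) * T) ∂(expLaw (2 * lam + mu))

/-- The law of the weights of the smoothing transform whose fixed point is the variance law. -/
noncomputable def weightLaw (lam mu T A : ℝ) : Measure (ℝ≥0∞ × ℝ≥0∞ × ℝ≥0∞) :=
  ENNReal.ofReal (2 * lam / (2 * lam + mu)) •
    ((expLaw (2 * lam + mu)).prod uniformAngle).map (fun x =>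
      (ENNReal.ofReal (Real.exp (2 * A * x.1) * Real.cos x.2 ^ 2),
       ENNReal.ofReal (Real.exp (2 * A * x.1) * Real.sin x.2 ^ 2), 0)) +
  ENNReal.ofReal (mu / (2 * lam + mu)) •
    (expLaw (2 * lam + mu)).map (fun u => (0, 0, ENNReal.ofReal (Real.exp (2 * A * u) * T)))

lemma lintegral_weightLaw {lam mu T A : ℝ} (hpos : 0 < 2 * lam + mu)
    {G : ℝ≥0∞ × ℝ≥0∞ × ℝ≥0∞ → ℝ≥0∞} (hG : Measurable G) :
    ∫⁻ w, G w ∂(weightLaw lam mu T A) =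
      ENNReal.ofReal (2 * lam / (2 * lam + mu)) *
        ∫⁻ u, ∫⁻ θ, G (ENNReal.ofReal (Real.exp (2 * A * u) * Real.cos θ ^ 2),
          ENNReal.ofReal (Real.exp (2 * A * u) * Real.sin θ ^ 2), 0)
          ∂uniformAngle ∂(expLaw (2 * lam + mu)) +
      ENNReal.ofReal (mu / (2 * lam + mu)) *
        ∫⁻ u, G (0, 0, ENNReal.ofReal (Real.exp (2 * A * u) * T)) ∂(expLaw (2 * lam + mu)) := by
  have := isProbabilityMeasure_expLaw hpos
  rw [weightLaw, lintegral_add_measure, lintegral_smul_measure, lintegral_smul_measure,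
    lintegral_map hG (by fun_prop), lintegral_map hG (by fun_prop),
    lintegral_prod _ (by fun_prop)]
  rfl

lemma isProbabilityMeasure_weightLaw {lam mu T A : ℝ} (hlam : 0 ≤ lam) (hmu : 0 ≤ mu)
    (hpos : 0 < 2 * lam + mu) : IsProbabilityMeasure (weightLaw lam mu T A) := by
  have := isProbabilityMeasure_expLaw hpos
  constructor
  have := lintegral_weightLaw (T := T) (A := A) hpos (G := fun _ => 1) measurable_const
  simp only [lintegral_one, measure_univ, mul_one] at this
  rw [this, ← ENNReal.ofReal_add (by positivity) (by positivity), ← add_div, div_self hpos.ne',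
    ENNReal.ofReal_one]

/-- Since `cos² + sin² = 1`, the angle drops out of the mean, which evolves by an affine map. The
condition `2A < 2λ + μ` makes the exponential moment of the clock finite. -/
lemma lintegral_weightLaw_linear {lam mu T A : ℝ} (hlam : 0 ≤ lam) (hmu : 0 ≤ mu) (hT : 0 ≤ T)
    (hpos : 0 < 2 * lam + mu) (hA : 2 * A < 2 * lam + mu) (m : Measure ℝ≥0∞)
    [IsProbabilityMeasure m] :
    ∫⁻ w, ∫⁻ a, ∫⁻ b, (w.1 * a + w.2.1 * b + w.2.2) ∂m ∂m ∂(weightLaw lam mu T A) =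
      ENNReal.ofReal (2 * lam / (2 * lam + mu - 2 * A)) * ∫⁻ a, a ∂m +
        ENNReal.ofReal (mu * T / (2 * lam + mu - 2 * A)) := by
  have := isProbabilityMeasure_expLaw hpos
  have h0 : ∀ w : ℝ≥0∞ × ℝ≥0∞ × ℝ≥0∞, ∫⁻ a, ∫⁻ b, (w.1 * a + w.2.1 * b + w.2.2) ∂m ∂m =
      w.1 * ∫⁻ a, a ∂m + w.2.1 * ∫⁻ a, a ∂m + w.2.2 := by
    intro w
    have : ∀ a : ℝ≥0∞, ∫⁻ b, (w.1 * a + w.2.1 * b + w.2.2) ∂m =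
        w.1 * a + (w.2.1 * ∫⁻ b, b ∂m + w.2.2) := by
      intro a
      simp only [add_assoc]
      rw [lintegral_add_left (by fun_prop), lintegral_add_left (by fun_prop),
        lintegral_const_mul _ measurable_id']
      simp
    simp only [this]
    rw [lintegral_add_left (by fun_prop), lintegral_const_mul _ measurable_id']
    simp [add_assoc]
  simp only [h0]
  rw [lintegral_weightLaw hpos (by fun_prop)]
  set x := ∫⁻ a, a ∂m
  have h1 : ∀ u θ : ℝ, ENNReal.ofReal (Real.exp (2 * A * u) * Real.cos θ ^ 2) * x +
      ENNReal.ofReal (Real.exp (2 * A * u) * Real.sin θ ^ 2) * x + 0 =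
      ENNReal.ofReal (Real.exp (2 * A * u)) * x := by
    intro u θ
    rw [add_zero, ← add_mul, ← ENNReal.ofReal_add (by positivity) (by positivity), ← mul_add,
      Real.cos_sq_add_sin_sq, mul_one]
  simp only [h1, lintegral_const, measure_univ, mul_one, zero_mul, zero_add]
  rw [lintegral_mul_const _ (by fun_prop), lintegral_expLaw_exp hpos hA]
  simp only [ENNReal.ofReal_mul (Real.exp_pos _).le]
  rw [lintegral_mul_const _ (by fun_prop), lintegral_expLaw_exp hpos hA, ← mul_assoc,
    ← ENNReal.ofReal_mul (by positivity), ← ENNReal.ofReal_mul (by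
      have : 0 < 2 * lam + mu - 2 * A := by linarith
      positivity), ← ENNReal.ofReal_mul (by positivity)]
  have : 2 * lam + mu - 2 * A ≠ 0 := by linarith
  have h2 : 2 * lam / (2 * lam + mu) * ((2 * lam + mu) / (2 * lam + mu - 2 * A)) =
      2 * lam / (2 * lam + mu - 2 * A) := by field_simp
  have h3 : mu / (2 * lam + mu) * ((2 * lam + mu) / (2 * lam + mu - 2 * A) * T) =
      mu * T / (2 * lam + mu - 2 * A) := by field_simp
  rw [h2, h3]

/-- The branching series lives in `[0, ∞]`. Once it is finite almost surely, its equation becomes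
the one for real variances. -/
lemma lintegral_weightLaw_toReal {lam mu T A : ℝ} (hT : 0 ≤ T)
    (hpos : 0 < 2 * lam + mu) (m : Measure ℝ≥0∞) [IsProbabilityMeasure m]
    (hm : ∀ᵐ a ∂m, a ≠ ⊤) {F : ℝ → ℝ≥0∞} (hF : Measurable F) :
    ∫⁻ w, ∫⁻ a, ∫⁻ b, F (w.1 * a + w.2.1 * b + w.2.2).toReal ∂m ∂m ∂(weightLaw lam mu T A) =
      varianceStep lam mu T A (m.map ENNReal.toReal) F := by
  rw [lintegral_weightLaw hpos, varianceStep]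
  · congr 2
    · refine lintegral_congr fun u => lintegral_congr fun θ => ?_
      rw [lintegral_map _ ENNReal.measurable_toReal]
      · refine lintegral_congr_ae (hm.mono fun a ha => ?_)
        dsimp only
        rw [lintegral_map (by fun_prop) ENNReal.measurable_toReal]
        refine lintegral_congr_ae (hm.mono fun b hb => ?_)
        dsimp only
        rw [add_zero, ENNReal.toReal_add (by finiteness) (by finiteness), ENNReal.toReal_mul,
          ENNReal.toReal_mul, ENNReal.toReal_ofReal (by positivity),
          ENNReal.toReal_ofReal (by positivity)]
        congr 1
        ring
      · refine Measurable.lintegral_prod_right' (f := fun p : ℝ × ℝ =>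
          F (Real.exp (2 * A * u) * (Real.cos θ ^ 2 * p.1 + Real.sin θ ^ 2 * p.2))) ?_
        fun_prop
    · refine lintegral_congr fun u => ?_
      simp [ENNReal.toReal_ofReal (mul_nonneg (Real.exp_pos (2 * A * u)).le hT)]
  · refine Measurable.lintegral_prod_right' (f := fun p : (ℝ≥0∞ × ℝ≥0∞ × ℝ≥0∞) × ℝ≥0∞ =>
      ∫⁻ b, F (p.1.1 * p.2 + p.1.2.1 * b + p.1.2.2).toReal ∂m) ?_
    refine Measurable.lintegral_prod_right' (f := fun p : ((ℝ≥0∞ × ℝ≥0∞ × ℝ≥0∞) × ℝ≥0∞) × ℝ≥0∞ =>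
      F (p.1.1.1 * p.1.2 + p.1.1.2.1 * p.2 + p.1.1.2.2).toReal) ?_
    fun_prop

/-- `M` is a law of the random variance: a law on `[0, ∞)` of mean `E` which is invariant
under `varianceStep`. -/
structure IsVarianceLaw (lam mu E T : ℝ) (M : Measure ℝ) : Prop where
  prob : IsProbabilityMeasure M
  nonneg : ∀ᵐ s ∂M, 0 ≤ s
  mean : ∫⁻ s, ENNReal.ofReal s ∂M = ENNReal.ofReal E
  fixed : ∀ F : ℝ → ℝ≥0∞, Measurable F → ∫⁻ s, F s ∂M = varianceStep lam mu T (drift mu E T) M F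

/-- The variance law together with the iterates of `varianceStep` from `0` which increase to it. -/
structure IsVarianceApprox (lam mu E T : ℝ) (M : Measure ℝ) (m : ℕ → Measure ℝ) : Prop where
  prob : ∀ n, IsProbabilityMeasure (m n)
  nonneg : ∀ n, ∀ᵐ s ∂(m n), 0 ≤ s
  zero : m 0 = Measure.dirac 0
  succ : ∀ n, ∀ F : ℝ → ℝ≥0∞, Measurable F →
    ∫⁻ s, F s ∂(m (n + 1)) = varianceStep lam mu T (drift mu E T) (m n) F
  mean_le : ∀ n, ∫⁻ s, ENNReal.ofReal s ∂(m n) ≤ ENNReal.ofReal E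
  rpow : ∀ q : ℝ, 0 < q → ∫⁻ s, ENNReal.ofReal s ^ q ∂M = ⨆ n, ∫⁻ s, ENNReal.ofReal s ^ q ∂(m n)

lemma drift_identity (mu T : ℝ) {E : ℝ} (hE : 0 < E) : 2 * drift mu E T * E = mu * (E - T) := by
  rw [drift]; field_simp

lemma two_drift_lt {lam mu E T : ℝ} (hlam : 0 ≤ lam) (hmu : 0 < mu) (hE : 0 < E) (hT : 0 < T) :
    2 * drift mu E T < 2 * lam + mu := by
  have h1 := drift_identity mu T hE
  have h2 : mu * (E - T) < mu * E := mul_lt_mul_of_pos_left (by linarith) hmu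
  have h3 : 2 * drift mu E T < mu := lt_of_mul_lt_mul_right (by linarith) hE.le
  linarith

/-- The affine map acting on the mean is monotone and fixes `E`, so all iterates from `0` have mean
at most `E`. The limit thus has finite mean, which solves the same affine equation and hence equals
`E`. Here `μ > 0` matters: without the inhomogeneous term the series would be zero. -/
theorem exists_isVarianceLaw {lam mu E T : ℝ} (hlam : 0 ≤ lam) (hmu : 0 < mu) (hE : 0 < E)
    (hT : 0 < T) : ∃ M m, IsVarianceLaw lam mu E T M ∧ IsVarianceApprox lam mu E T M m := by
  set A := drift mu E T with hA
  have hpos : 0 < 2 * lam + mu := by linarith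
  have hA2 : 2 * A < 2 * lam + mu := two_drift_lt hlam hmu hE hT
  have hAE : 2 * A * E = mu * (E - T) := drift_identity mu T hE
  have := isProbabilityMeasure_weightLaw (T := T) (A := A) hlam hmu.le hpos
  obtain ⟨m, mseq, hm, hms, h0, hsucc, hfix, hsup⟩ :=
    exists_smoothing_fixedPoint (weightLaw lam mu T A)
  have hD : 0 < 2 * lam + mu - 2 * A := by linarith
  -- `E` is a fixed point of the affine map; this is the identity `2AE = μ(E - T)` that defines the
  -- drift.
  have hstep : ENNReal.ofReal (2 * lam / (2 * lam + mu - 2 * A)) * ENNReal.ofReal E +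
      ENNReal.ofReal (mu * T / (2 * lam + mu - 2 * A)) = ENNReal.ofReal E := by
    rw [← ENNReal.ofReal_mul (by positivity), ← ENNReal.ofReal_add (by positivity) (by positivity)]
    congr 1
    field_simp
    linarith
  have hmean : ∀ n, ∫⁻ s, s ∂(mseq n) ≤ ENNReal.ofReal E := by
    intro n
    induction n with
    | zero => simp [h0]
    | succ n ih =>
      rw [hsucc n _ measurable_id', lintegral_weightLaw_linear hlam hmu.le hT.le hpos hA2]
      calc _ ≤ ENNReal.ofReal (2 * lam / (2 * lam + mu - 2 * A)) * ENNReal.ofReal E +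
          ENNReal.ofReal (mu * T / (2 * lam + mu - 2 * A)) := by gcongr
        _ = _ := hstep
  have hmeanm : ∫⁻ s, s ∂m ≤ ENNReal.ofReal E := by
    rw [hsup (fun s => s) monotone_id continuous_id']
    exact iSup_le hmean
  have hmeaneq : ∫⁻ s, s ∂m = ENNReal.ofReal E := by
    have h1 := hfix _ measurable_id'
    rw [lintegral_weightLaw_linear hlam hmu.le hT.le hpos hA2] at h1
    obtain ⟨x, hx⟩ : ∃ x : NNReal, ∫⁻ s, s ∂m = x :=
      ⟨_, (ENNReal.coe_toNNReal (hmeanm.trans_lt ENNReal.ofReal_lt_top).ne).symm⟩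
    rw [hx, ← ENNReal.ofReal_coe_nnreal] at h1 ⊢
    rw [← ENNReal.ofReal_mul (by positivity), ← ENNReal.ofReal_add (by positivity) (by positivity),
      ENNReal.ofReal_eq_ofReal_iff (by positivity) (by positivity)] at h1
    congr 1
    field_simp at h1
    have h2 : (mu - 2 * A) * x = mu * T := by linarith
    have h3 : (mu - 2 * A) * E = mu * T := by linarith
    -- Uniqueness of the fixed mean: `(μ - 2A) E = μT > 0`.
    have h4 : mu - 2 * A ≠ 0 := by
      intro h; rw [h] at h3; have := mul_pos hmu hT; linarith
    exact mul_left_cancel₀ h4 (h2.trans h3.symm)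
  have hfin : ∀ᵐ s ∂m, s ≠ ⊤ :=
    (ae_lt_top measurable_id' (hmeanm.trans_lt ENNReal.ofReal_lt_top).ne).mono fun _ h => h.ne
  have hfins : ∀ n, ∀ᵐ s ∂(mseq n), s ≠ ⊤ := fun n =>
    (ae_lt_top measurable_id' ((hmean n).trans_lt ENNReal.ofReal_lt_top).ne).mono fun _ h => h.ne
  have hmap : ∀ (ν : Measure ℝ≥0∞), (∀ᵐ s ∂ν, s ≠ ⊤) → ∀ G : ℝ≥0∞ → ℝ≥0∞, Measurable G →
      ∫⁻ s, G (ENNReal.ofReal s) ∂(ν.map ENNReal.toReal) = ∫⁻ s, G s ∂ν := by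
    intro ν hν G hG
    rw [lintegral_map (by fun_prop) ENNReal.measurable_toReal]
    refine lintegral_congr_ae (hν.mono fun a ha => ?_)
    dsimp only
    rw [ENNReal.ofReal_toReal ha]
  have hnn : ∀ ν : Measure ℝ≥0∞, ∀ᵐ s ∂(ν.map ENNReal.toReal), 0 ≤ s := by
    intro ν
    rw [ae_map_iff ENNReal.measurable_toReal.aemeasurable measurableSet_Ici]
    exact ae_of_all _ fun _ => ENNReal.toReal_nonneg
  refine ⟨m.map ENNReal.toReal, fun n => (mseq n).map ENNReal.toReal,
    ⟨Measure.isProbabilityMeasure_map ENNReal.measurable_toReal.aemeasurable, hnn _, ?_, ?_⟩,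
    ⟨fun n => Measure.isProbabilityMeasure_map ENNReal.measurable_toReal.aemeasurable,
      fun n => hnn _, ?_, ?_, ?_, ?_⟩⟩
  · rw [hmap m hfin _ measurable_id', hmeaneq]
  · intro F hF
    rw [← lintegral_weightLaw_toReal hT.le hpos m hfin hF,
      lintegral_map hF ENNReal.measurable_toReal]
    exact hfix _ (hF.comp ENNReal.measurable_toReal)
  · rw [h0, Measure.map_dirac' ENNReal.measurable_toReal, ENNReal.toReal_zero]
  · intro n F hF
    rw [← lintegral_weightLaw_toReal hT.le hpos _ (hfins n) hF,
      lintegral_map hF ENNReal.measurable_toReal]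
    exact hsucc n _ (hF.comp ENNReal.measurable_toReal)
  · intro n
    rw [hmap _ (hfins n) _ measurable_id']
    exact hmean n
  · intro q hq
    rw [hmap m hfin (fun s => s ^ q) (by fun_prop),
      hsup _ (ENNReal.monotone_rpow_of_nonneg hq.le) (ENNReal.continuous_rpow_const)]
    exact iSup_congr fun n => (hmap _ (hfins n) (fun s => s ^ q) (by fun_prop)).symm

/-- Without thermostat the variance is deterministic. -/
lemma isVarianceLaw_dirac {lam E T : ℝ} (hlam : 0 < lam) (hE : 0 < E) :
    IsVarianceLaw lam 0 E T (Measure.dirac E) := by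
  have := isProbabilityMeasure_expLaw (show 0 < 2 * lam by linarith)
  refine ⟨inferInstance, ?_, by simp, fun F hF => ?_⟩
  · rw [ae_dirac_iff measurableSet_Ici]; exact hE.le
  · have : ∀ θ : ℝ, Real.cos θ ^ 2 * E + Real.sin θ ^ 2 * E = E := fun θ => by
      rw [← add_mul, Real.cos_sq_add_sin_sq, one_mul]
    simp [varianceStep, drift, this, hlam.ne', div_self]

/-! ### Elementary inequalities for powers -/

/-- The two regimes are separated by `t = η^{-1/d}`: above it `t^{q-d} ≤ η t^q`, below it the lower
power is bounded. The lemma absorbs lower-order moments into a small multiple of the leading one. -/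
lemma rpow_sub_le_mul_rpow_add {q d : ℝ} (hd : 0 < d) (hq : d ≤ q) {η : ℝ} (hη : 0 < η) :
    ∃ K : ℝ, 0 ≤ K ∧ ∀ t : ℝ, 0 ≤ t → t ^ (q - d) ≤ η * t ^ q + K := by
  refine ⟨(η⁻¹ ^ d⁻¹) ^ (q - d), by positivity, fun t ht => ?_⟩
  rcases le_total t (η⁻¹ ^ d⁻¹) with h | h
  · have h1 : t ^ (q - d) ≤ (η⁻¹ ^ d⁻¹) ^ (q - d) := Real.rpow_le_rpow ht h (by linarith)
    have h2 : 0 ≤ η * t ^ q := by positivity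
    linarith
  · have ht0 : 0 < t := lt_of_lt_of_le (by positivity) h
    have h1 : η⁻¹ ≤ t ^ d := by
      have := Real.rpow_le_rpow (by positivity) h hd.le
      rwa [← Real.rpow_mul (by positivity), inv_mul_cancel₀ hd.ne', Real.rpow_one] at this
    have h2 : t ^ q = t ^ (q - d) * t ^ d := by rw [← Real.rpow_add ht0]; ring_nf
    have h3 : t ^ (q - d) ≤ η * t ^ q := by
      rw [h2]
      have : 1 ≤ η * t ^ d := by
        have := mul_le_mul_of_nonneg_left h1 hη.le
        rwa [mul_inv_cancel₀ hη.ne'] at this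
      nlinarith [Real.rpow_nonneg ht (q - d)]
    have h4 : 0 ≤ (η⁻¹ ^ d⁻¹) ^ (q - d) := by positivity
    linarith

/-- Weighted AM-GM, once under the decreasing power `-q` and once for the values `a^{-q}`, `b^{-q}`.
-/
lemma rpow_neg_convex {w w' a b q : ℝ} (hw : 0 ≤ w) (hw' : 0 ≤ w') (hww : w + w' = 1)
    (ha : 0 < a) (hb : 0 < b) (hq : 0 ≤ q) :
    (w * a + w' * b) ^ (-q) ≤ w * a ^ (-q) + w' * b ^ (-q) := by
  have h1 := Real.geom_mean_le_arith_mean2_weighted hw hw' ha.le hb.le hww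
  have h2 := Real.geom_mean_le_arith_mean2_weighted hw hw'
    (Real.rpow_nonneg ha.le (-q)) (Real.rpow_nonneg hb.le (-q)) hww
  refine le_trans ?_ h2
  have h3 := Real.rpow_le_rpow_of_nonpos (by positivity) h1 (show -q ≤ 0 by linarith)
  refine h3.trans_eq ?_
  rw [Real.mul_rpow (by positivity) (by positivity), ← Real.rpow_mul ha.le, ← Real.rpow_mul hb.le,
    ← Real.rpow_mul ha.le, ← Real.rpow_mul hb.le, mul_comm w, mul_comm w']

/-- Bernoulli's inequality for `(1 - b/(a+b))^q` gives `(a+b)^q - a^q ≤ q b (a+b)^{q-1}`, and `a + b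
≤ 2a`. -/
lemma add_rpow_le_of_le {a b q : ℝ} (ha : 0 < a) (hb : 0 ≤ b) (hba : b ≤ a) (hq : 1 ≤ q) :
    (a + b) ^ q ≤ a ^ q + q * 2 ^ (q - 1) * (a ^ (q - 1) * b) := by
  have hab : 0 < a + b := by linarith
  have h1 := one_add_mul_self_le_rpow_one_add (s := -(b / (a + b)))
    (by rw [neg_le_neg_iff, div_le_one hab]; linarith) hq
  have h2 : 1 + -(b / (a + b)) = a / (a + b) := by field_simp; ring
  rw [h2, Real.div_rpow ha.le hab.le, le_div_iff₀ (by positivity)] at h1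
  have h3 : (a + b) ^ q = (a + b) ^ (q - 1) * (a + b) := by
    rw [← Real.rpow_add_one hab.ne']; ring_nf
  have h4 : (1 + q * -(b / (a + b))) * (a + b) ^ q = (a + b) ^ q - q * b * (a + b) ^ (q - 1) := by
    rw [h3]; field_simp; ring
  have h5 : (a + b) ^ (q - 1) ≤ 2 ^ (q - 1) * a ^ (q - 1) := by
    rw [← Real.mul_rpow (by norm_num) ha.le]
    exact Real.rpow_le_rpow hab.le (by linarith) (by linarith)
  have h6 := mul_le_mul_of_nonneg_left h5 (show 0 ≤ q * b by positivity)
  nlinarith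

/-- The point is that the error carries only the power `q - 1` of one variable times the first power
of the other: after integration over independent copies it is a lower moment times the mean. -/
lemma add_rpow_le_add_cross {a b q : ℝ} (ha : 0 ≤ a) (hb : 0 ≤ b) (hq : 1 < q) :
    (a + b) ^ q ≤ a ^ q + b ^ q + q * 2 ^ (q - 1) * (a ^ (q - 1) * b + b ^ (q - 1) * a) := by
  rcases ha.eq_or_lt with rfl | ha
  · simp [Real.zero_rpow (show q ≠ 0 by linarith), Real.zero_rpow (show q - 1 ≠ 0 by linarith)]
  rcases hb.eq_or_lt with rfl | hb
  · simp [Real.zero_rpow (show q ≠ 0 by linarith), Real.zero_rpow (show q - 1 ≠ 0 by linarith)]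
  have h1 : 0 ≤ q * 2 ^ (q - 1) * (a ^ (q - 1) * b) := by positivity
  have h2 : 0 ≤ q * 2 ^ (q - 1) * (b ^ (q - 1) * a) := by positivity
  have h3 := Real.rpow_nonneg ha.le q
  have h4 := Real.rpow_nonneg hb.le q
  rcases le_total b a with h | h
  · have := add_rpow_le_of_le ha hb.le h hq.le
    linarith
  · have := add_rpow_le_of_le hb ha.le h hq.le
    rw [add_comm b a] at this
    linarith

/-! ### Averages over the angle -/

lemma integral_uniformAngle_add {F : ℝ → ℝ} (hF : Function.Periodic F (2 * Real.pi)) (c : ℝ) :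
    ∫ θ, F (θ + c) ∂uniformAngle = ∫ θ, F θ ∂uniformAngle := by
  rw [integral_uniformAngle, integral_uniformAngle, intervalIntegral.integral_comp_add_right,
    zero_add, add_comm, hF.intervalIntegral_add_eq c 0, zero_add]

lemma integral_uniformAngle_neg {F : ℝ → ℝ} (hF : Function.Periodic F (2 * Real.pi)) :
    ∫ θ, F (-θ) ∂uniformAngle = ∫ θ, F θ ∂uniformAngle := by
  rw [integral_uniformAngle, integral_uniformAngle, intervalIntegral.integral_comp_neg, neg_zero]
  have := hF.intervalIntegral_add_eq (-(2 * Real.pi)) 0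
  rw [neg_add_cancel, zero_add] at this
  rw [this]

lemma momentConst_eq (r : ℝ) :
    momentConst r = 1 - 2 * ∫ θ, |Real.cos θ| ^ r ∂uniformAngle := by
  rw [integral_uniformAngle, momentConst]

lemma integral_abs_sin_rpow (r : ℝ) :
    ∫ θ, |Real.sin θ| ^ r ∂uniformAngle = ∫ θ, |Real.cos θ| ^ r ∂uniformAngle := by
  have hF : Function.Periodic (fun θ => |Real.sin θ| ^ r) (2 * Real.pi) := fun θ => by
    simp [Real.sin_add_two_pi]
  rw [← integral_uniformAngle_add hF (Real.pi / 2)]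
  simp [Real.sin_add_pi_div_two]

lemma lintegral_abs_cos_rpow {r : ℝ} (hr : 0 ≤ r) :
    ∫⁻ θ, ENNReal.ofReal (|Real.cos θ| ^ r) ∂uniformAngle =
      ENNReal.ofReal ((1 - momentConst r) / 2) := by
  rw [← ofReal_integral_eq_lintegral_ofReal (integrable_uniformAngle_of_continuous
    (Real.continuous_cos.abs.rpow_const fun _ => Or.inr hr)) (ae_of_all _ fun θ => by positivity),
    momentConst_eq]
  congr 1
  ring

lemma lintegral_abs_sin_rpow {r : ℝ} (hr : 0 ≤ r) :
    ∫⁻ θ, ENNReal.ofReal (|Real.sin θ| ^ r) ∂uniformAngle =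
      ENNReal.ofReal ((1 - momentConst r) / 2) := by
  rw [← ofReal_integral_eq_lintegral_ofReal (integrable_uniformAngle_of_continuous
    (Real.continuous_sin.abs.rpow_const fun _ => Or.inr hr)) (ae_of_all _ fun θ => by positivity),
    integral_abs_sin_rpow, momentConst_eq]
  congr 1
  ring

lemma momentConst_le_one (r : ℝ) : momentConst r ≤ 1 := by
  have : 0 ≤ ∫ θ, |Real.cos θ| ^ r ∂uniformAngle := integral_nonneg fun θ => by positivity
  rw [momentConst_eq]; linarith

lemma uniformAngle_absolutelyContinuous : uniformAngle ≪ volume :=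
  ProbabilityTheory.cond_absolutelyContinuous

lemma volume_sin_mul_cos_eq_zero : volume {θ : ℝ | Real.sin θ * Real.cos θ = 0} = 0 := by
  have : {θ : ℝ | Real.sin θ * Real.cos θ = 0} ⊆ Set.range fun n : ℤ => n * Real.pi / 2 := by
    intro θ hθ
    have h : Real.sin (2 * θ) = 0 := by
      have hθ' : Real.sin θ * Real.cos θ = 0 := hθ
      rw [Real.sin_two_mul, mul_assoc, hθ', mul_zero]
    obtain ⟨n, hn⟩ := Real.sin_eq_zero_iff.1 h
    exact ⟨n, by simp only [hn]; ring⟩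
  exact measure_mono_null this ((Set.countable_range _).measure_zero _)

/-- Continuity from above of the angle law. Near-degenerate angles are the only ones at which the
outcome can be small while one of the two incoming variances is not. -/
lemma exists_uniformAngle_sin_mul_cos_le {η : ℝ≥0∞} (hη : 0 < η) :
    ∃ ε : ℝ, 0 < ε ∧ uniformAngle {θ | |Real.sin θ * Real.cos θ| ≤ ε} ≤ η := by
  have hlim : Tendsto (fun n : ℕ => uniformAngle {θ | |Real.sin θ * Real.cos θ| ≤ 1 / ((n : ℝ) + 1)})
      atTop (𝓝 (uniformAngle (⋂ n : ℕ, {θ | |Real.sin θ * Real.cos θ| ≤ 1 / ((n : ℝ) + 1)}))) := by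
    refine tendsto_measure_iInter_atTop (fun n => ?_) ?_ ⟨0, measure_ne_top _ _⟩
    · exact (measurableSet_le (by fun_prop) measurable_const).nullMeasurableSet
    · intro i j h θ hθ
      have hθ' : |Real.sin θ * Real.cos θ| ≤ 1 / ((j : ℝ) + 1) := hθ
      have hij : (i : ℝ) ≤ j := by exact_mod_cast h
      exact hθ'.trans (one_div_le_one_div_of_le (by positivity) (by linarith))
  have h0 : uniformAngle (⋂ n : ℕ, {θ | |Real.sin θ * Real.cos θ| ≤ 1 / ((n : ℝ) + 1)}) = 0 := by
    refine measure_mono_null (fun θ hθ => ?_)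
      (uniformAngle_absolutelyContinuous volume_sin_mul_cos_eq_zero)
    simp only [Set.mem_iInter, Set.mem_ofPred_eq] at hθ ⊢
    by_contra hne
    obtain ⟨n, hn⟩ := exists_nat_one_div_lt (abs_pos.2 hne)
    exact absurd (hθ n) (not_le.2 hn)
  rw [h0] at hlim
  obtain ⟨n, hn⟩ := (hlim.eventually (ge_mem_nhds hη)).exists
  exact ⟨1 / ((n : ℝ) + 1), by positivity, hn⟩

/-! ### The action of the variance step on powers -/

/-- The law of `a cos² θ + b sin² θ` tested against `F`. -/
noncomputable def collisionAverage (m : Measure ℝ) (F : ℝ → ℝ≥0∞) : ℝ≥0∞ :=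
  ∫⁻ θ, ∫⁻ a, ∫⁻ b, F (Real.cos θ ^ 2 * a + Real.sin θ ^ 2 * b) ∂m ∂m ∂uniformAngle

lemma ae_expLaw_nonneg (k : ℝ) : ∀ᵐ u ∂(expLaw k), 0 ≤ u := by
  refine (withDensity_absolutelyContinuous _ _) ?_
  exact (ae_restrict_mem measurableSet_Ioi).mono fun u hu => (Set.mem_Ioi.1 hu).le

/-- Decouples the clock from the variance whenever the test function is dominated by a product. -/
lemma varianceStep_le {lam mu T A : ℝ} {m : Measure ℝ} (hT : 0 ≤ T) (hm : ∀ᵐ s ∂m, 0 ≤ s)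
    {F H : ℝ → ℝ≥0∞} {G : ℝ → ℝ≥0∞} (hG : Measurable G)
    (h : ∀ u, 0 ≤ u → ∀ z, 0 ≤ z → F (Real.exp (2 * A * u) * z) ≤ G u * H z)
    (hGtop : ∀ u, G u ≠ ⊤) :
    varianceStep lam mu T A m F ≤ (∫⁻ u, G u ∂(expLaw (2 * lam + mu))) *
      (ENNReal.ofReal (2 * lam / (2 * lam + mu)) * collisionAverage m H +
        ENNReal.ofReal (mu / (2 * lam + mu)) * H T) := by
  rw [varianceStep, mul_add, mul_left_comm, mul_left_comm (∫⁻ u, G u ∂(expLaw (2 * lam + mu)))]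
  gcongr
  · rw [← lintegral_mul_const _ hG]
    refine lintegral_mono_ae ((ae_expLaw_nonneg _).mono fun u hu => ?_)
    rw [collisionAverage, ← lintegral_const_mul' _ _ (hGtop u)]
    refine lintegral_mono fun θ => ?_
    rw [← lintegral_const_mul' _ _ (hGtop u)]
    refine lintegral_mono_ae (hm.mono fun a ha => ?_)
    rw [← lintegral_const_mul' _ _ (hGtop u)]
    refine lintegral_mono_ae (hm.mono fun b hb => ?_)
    exact h u hu _ (by positivity)
  · rw [← lintegral_mul_const _ hG]
    exact lintegral_mono_ae ((ae_expLaw_nonneg _).mono fun u hu => h u hu T hT)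

lemma varianceStep_rpow {lam mu T A : ℝ} (m : Measure ℝ) {q : ℝ} :
    varianceStep lam mu T A m (fun s => ENNReal.ofReal s ^ q) =
      (∫⁻ u, ENNReal.ofReal (Real.exp (2 * A * q * u)) ∂(expLaw (2 * lam + mu))) *
      (ENNReal.ofReal (2 * lam / (2 * lam + mu)) * collisionAverage m (fun s => ENNReal.ofReal s ^ q)
        + ENNReal.ofReal (mu / (2 * lam + mu)) * ENNReal.ofReal T ^ q) := by
  have h : ∀ u z : ℝ, ENNReal.ofReal (Real.exp (2 * A * u) * z) ^ q =
      ENNReal.ofReal (Real.exp (2 * A * q * u)) * ENNReal.ofReal z ^ q := by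
    intro u z
    rw [ENNReal.ofReal_mul (Real.exp_pos _).le, ENNReal.mul_rpow_of_ne_top (by simp) (by simp),
      ENNReal.ofReal_rpow_of_pos (Real.exp_pos _), ← Real.exp_mul]
    ring_nf
  rw [varianceStep, mul_add, mul_left_comm, mul_left_comm (∫⁻ u, _ ∂(expLaw (2 * lam + mu)))]
  simp only [h, collisionAverage]
  congr 2
  · rw [← lintegral_mul_const _ (by fun_prop)]
    refine lintegral_congr fun u => ?_
    rw [← lintegral_const_mul' _ _ (by simp)]
    refine lintegral_congr fun θ => ?_
    rw [← lintegral_const_mul' _ _ (by simp)]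
    refine lintegral_congr fun a => ?_
    rw [← lintegral_const_mul' _ _ (by simp)]
  · rw [← lintegral_mul_const _ (by fun_prop)]

/-- Bounds for the collision average by separated functions. -/
lemma collisionAverage_le_of_convex {m : Measure ℝ} [IsProbabilityMeasure m]
    (hm : ∀ᵐ s ∂m, 0 ≤ s) {F : ℝ → ℝ≥0∞} (hF : Measurable F) (S : Set ℝ)
    (h : ∀ θ ∈ S, ∀ a, 0 ≤ a → ∀ b, 0 ≤ b → F (Real.cos θ ^ 2 * a + Real.sin θ ^ 2 * b) ≤
      ENNReal.ofReal (Real.cos θ ^ 2) * F a + ENNReal.ofReal (Real.sin θ ^ 2) * F b) :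
    ∫⁻ θ in S, ∫⁻ a, ∫⁻ b, F (Real.cos θ ^ 2 * a + Real.sin θ ^ 2 * b) ∂m ∂m ∂uniformAngle ≤
      uniformAngle S * ∫⁻ s, F s ∂m := by
  rw [mul_comm, ← setLIntegral_const]
  refine setLIntegral_mono measurable_const fun θ hθ => ?_
  calc ∫⁻ a, ∫⁻ b, F (Real.cos θ ^ 2 * a + Real.sin θ ^ 2 * b) ∂m ∂m
      ≤ ∫⁻ a, ∫⁻ b, (ENNReal.ofReal (Real.cos θ ^ 2) * F a +
          ENNReal.ofReal (Real.sin θ ^ 2) * F b) ∂m ∂m := by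
        refine lintegral_mono_ae (hm.mono fun a ha => lintegral_mono_ae (hm.mono fun b hb => ?_))
        exact h θ hθ a ha b hb
    _ = ∫⁻ s, F s ∂m := by
        simp only [lintegral_add_left measurable_const, lintegral_const, measure_univ, mul_one,
          lintegral_const_mul _ hF]
        rw [lintegral_add_right _ measurable_const, lintegral_const_mul _ hF, lintegral_const,
          measure_univ, mul_one, ← add_mul, ← ENNReal.ofReal_add (sq_nonneg _) (sq_nonneg _),
          Real.cos_sq_add_sin_sq, ENNReal.ofReal_one, one_mul]

/-! ### Negative moments of the variance law -/

/-- Absorption is legitimate only when the quantity is already finite. That is why negative moments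
are first regularised by a shift, and positive ones bounded along the iterates. -/
lemma ENNReal_le_of_le_mul_add {x : ℝ≥0∞} {a b : ℝ} (hx : x ≠ ⊤) (ha : 0 ≤ a) (ha1 : a < 1)
    (hb : 0 ≤ b) (h : x ≤ ENNReal.ofReal a * x + ENNReal.ofReal b) :
    x ≤ ENNReal.ofReal (b / (1 - a)) := by
  lift x to NNReal using hx
  rw [← ENNReal.ofReal_coe_nnreal, ← ENNReal.ofReal_mul ha, ← ENNReal.ofReal_add (by positivity) hb,
    ENNReal.ofReal_le_ofReal_iff (by positivity)] at h
  rw [← ENNReal.ofReal_coe_nnreal]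
  refine ENNReal.ofReal_le_ofReal ?_
  rw [le_div_iff₀ (by linarith)]
  linarith

lemma collisionAverage_le {m : Measure ℝ} [IsProbabilityMeasure m]
    (hm : ∀ᵐ s ∂m, 0 ≤ s) {F : ℝ → ℝ≥0∞} (hF : Measurable F)
    (h : ∀ θ a, 0 ≤ a → ∀ b, 0 ≤ b → F (Real.cos θ ^ 2 * a + Real.sin θ ^ 2 * b) ≤
      ENNReal.ofReal (Real.cos θ ^ 2) * F a + ENNReal.ofReal (Real.sin θ ^ 2) * F b) :
    collisionAverage m F ≤ ∫⁻ s, F s ∂m := by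
  have := collisionAverage_le_of_convex hm hF Set.univ (fun θ _ => h θ)
  rwa [setLIntegral_univ, measure_univ, one_mul] at this

/-- For `A ≥ 0` dilation only increases variances. Test with the convex decreasing function `(T -
s)₊`: collisions do not increase its mean, thermostat events contribute `(T - T)₊ = 0`, and the
weight `2λ/(2λ+μ) < 1` of collisions forces the mean to vanish. -/
lemma IsVarianceLaw.le_of_le {lam mu E T : ℝ} {M : Measure ℝ} (hM : IsVarianceLaw lam mu E T M)
    (hlam : 0 ≤ lam) (hmu : 0 < mu) (hE : 0 < E) (hT : 0 < T) (hET : T ≤ E) :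
    ∀ᵐ s ∂M, T ≤ s := by
  have := hM.prob
  have hA : 0 ≤ drift mu E T := by
    unfold drift; have : 0 ≤ E - T := by linarith
    positivity
  have hF : Measurable fun s : ℝ => ENNReal.ofReal (T - s) := by fun_prop
  have h1 : ∫⁻ s, ENNReal.ofReal (T - s) ∂M ≤
      ENNReal.ofReal (2 * lam / (2 * lam + mu)) * ∫⁻ s, ENNReal.ofReal (T - s) ∂M +
        ENNReal.ofReal 0 := by
    conv_lhs => rw [hM.fixed _ hF]
    refine (varianceStep_le (G := fun _ => 1) (H := fun s => ENNReal.ofReal (T - s)) hT.le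
      hM.nonneg measurable_const (fun u hu z hz => ?_) (fun _ => ENNReal.one_ne_top)).trans ?_
    · rw [one_mul]
      refine ENNReal.ofReal_le_ofReal ?_
      have : 1 ≤ Real.exp (2 * drift mu E T * u) := Real.one_le_exp (by positivity)
      nlinarith
    · have := isProbabilityMeasure_expLaw (show 0 < 2 * lam + mu by linarith)
      rw [lintegral_const, measure_univ, one_mul, one_mul, sub_self, ENNReal.ofReal_zero, mul_zero,
        add_zero, add_zero]
      gcongr
      refine collisionAverage_le hM.nonneg hF fun θ a ha b hb => ?_
      calc ENNReal.ofReal (T - (Real.cos θ ^ 2 * a + Real.sin θ ^ 2 * b))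
          = ENNReal.ofReal (Real.cos θ ^ 2 * (T - a) + Real.sin θ ^ 2 * (T - b)) := by
            congr 1; linear_combination -T * Real.cos_sq_add_sin_sq θ
        _ ≤ _ := by
            rw [← ENNReal.ofReal_mul (sq_nonneg _), ← ENNReal.ofReal_mul (sq_nonneg _)]
            exact ENNReal.ofReal_add_le
  have hfin : ∫⁻ s, ENNReal.ofReal (T - s) ∂M ≠ ⊤ := by
    refine ne_top_of_le_ne_top (b := ENNReal.ofReal T) ENNReal.ofReal_ne_top ?_
    calc _ ≤ ∫⁻ s, ENNReal.ofReal T ∂M :=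
          lintegral_mono_ae (hM.nonneg.mono fun s hs => ENNReal.ofReal_le_ofReal (by linarith))
      _ = _ := by simp
  have h2 := ENNReal_le_of_le_mul_add hfin (by positivity)
    (by rw [div_lt_one (by linarith)]; linarith) le_rfl h1
  rw [zero_div, ENNReal.ofReal_zero, nonpos_iff_eq_zero, lintegral_eq_zero_iff hF] at h2
  refine h2.mono fun s hs => ?_
  have : ENNReal.ofReal (T - s) = 0 := hs
  rw [ENNReal.ofReal_eq_zero] at this
  linarith

/-- Fatou as the shift tends to zero. -/
lemma lintegral_rpow_neg_le_of_shift {M : Measure ℝ} {q : ℝ} {C : ℝ≥0∞}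
    (h : ∀ ε : ℝ, 0 < ε → ∫⁻ s, ENNReal.ofReal (s + ε) ^ (-q) ∂M ≤ C) :
    ∫⁻ s, ENNReal.ofReal s ^ (-q) ∂M ≤ C := by
  have hlim : ∀ s : ℝ, Tendsto (fun n : ℕ => ENNReal.ofReal (s + 1 / ((n : ℝ) + 1)) ^ (-q)) atTop
      (𝓝 (ENNReal.ofReal s ^ (-q))) := by
    intro s
    have h1 : Tendsto (fun n : ℕ => s + 1 / ((n : ℝ) + 1)) atTop (𝓝 (s + 0)) :=
      tendsto_const_nhds.add tendsto_one_div_add_atTop_nhds_zero_nat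
    rw [add_zero] at h1
    exact (ENNReal.continuous_rpow_const.tendsto _).comp (ENNReal.tendsto_ofReal h1)
  calc ∫⁻ s, ENNReal.ofReal s ^ (-q) ∂M
      = ∫⁻ s, liminf (fun n : ℕ => ENNReal.ofReal (s + 1 / ((n : ℝ) + 1)) ^ (-q)) atTop ∂M :=
        lintegral_congr fun s => (hlim s).liminf_eq.symm
    _ ≤ liminf (fun n : ℕ => ∫⁻ s, ENNReal.ofReal (s + 1 / ((n : ℝ) + 1)) ^ (-q) ∂M) atTop :=
        lintegral_liminf_le fun n => by fun_prop
    _ ≤ liminf (fun _ : ℕ => C) atTop :=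
        liminf_le_liminf (Eventually.of_forall fun n => h _ (by positivity))
    _ = C := by simp

lemma ofReal_add_rpow_neg_le {s ε q : ℝ} (hs : 0 ≤ s) (hε : 0 < ε) (hq : 0 ≤ q) :
    ENNReal.ofReal (s + ε) ^ (-q) ≤ ENNReal.ofReal (ε ^ (-q)) := by
  rw [ENNReal.ofReal_rpow_of_pos (by positivity)]
  exact ENNReal.ofReal_le_ofReal
    (Real.rpow_le_rpow_of_nonpos hε (by linarith) (by linarith))

section Shifted

variable {lam mu E T : ℝ} {M : Measure ℝ}

lemma IsVarianceLaw.shift_ne_top (hM : IsVarianceLaw lam mu E T M) {ε q : ℝ} (hε : 0 < ε)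
    (hq : 0 ≤ q) : ∫⁻ s, ENNReal.ofReal (s + ε) ^ (-q) ∂M ≠ ⊤ := by
  have := hM.prob
  refine ne_top_of_le_ne_top (b := ENNReal.ofReal (ε ^ (-q))) ENNReal.ofReal_ne_top ?_
  calc _ ≤ ∫⁻ s, ENNReal.ofReal (ε ^ (-q)) ∂M :=
        lintegral_mono_ae (hM.nonneg.mono fun s hs => ofReal_add_rpow_neg_le hs hε hq)
    _ = _ := by simp

/-- For `A ≤ 0` the shift is compatible with the dilation: `e^{2Au} ≤ 1` gives `e^{2Au} z + ε ≥
e^{2Au} (z + ε)`, so the clock factors out as for a pure power. -/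
lemma IsVarianceLaw.shift_le (hM : IsVarianceLaw lam mu E T M) (hlam : 0 ≤ lam) (hmu : 0 < mu)
    (hT : 0 < T) (hA : drift mu E T ≤ 0) {q : ℝ} (hq : 0 < q)
    (hq2 : 0 < 2 * lam + mu + 2 * drift mu E T * q) {ε : ℝ} (hε : 0 < ε) :
    ∫⁻ s, ENNReal.ofReal (s + ε) ^ (-q) ∂M ≤
      ENNReal.ofReal (2 * lam / (2 * lam + mu + 2 * drift mu E T * q)) *
        collisionAverage M (fun s => ENNReal.ofReal (s + ε) ^ (-q)) +
      ENNReal.ofReal (mu / (2 * lam + mu + 2 * drift mu E T * q) * T ^ (-q)) := by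
  have hpos : 0 < 2 * lam + mu := by linarith
  set A := drift mu E T
  conv_lhs => rw [hM.fixed _ (by fun_prop)]
  refine (varianceStep_le (G := fun u => ENNReal.ofReal (Real.exp (-(2 * A * q) * u)))
    (H := fun s => ENNReal.ofReal (s + ε) ^ (-q)) hT.le hM.nonneg (by fun_prop)
    (fun u hu z hz => ?_) (fun _ => ENNReal.ofReal_ne_top)).trans ?_
  · rw [ENNReal.ofReal_rpow_of_pos (by positivity), ENNReal.ofReal_rpow_of_pos (by positivity),
      ← ENNReal.ofReal_mul (by positivity)]
    refine ENNReal.ofReal_le_ofReal ?_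
    have h1 : Real.exp (2 * A * u) ≤ 1 := by
      rw [Real.exp_le_one_iff]; nlinarith [mul_nonneg (neg_nonneg.2 hA) hu]
    have h2 : Real.exp (-(2 * A * q) * u) = Real.exp (2 * A * u) ^ (-q) := by
      rw [← Real.exp_mul]; ring_nf
    rw [h2, ← Real.mul_rpow (Real.exp_pos _).le (by positivity)]
    refine Real.rpow_le_rpow_of_nonpos (by positivity) ?_ (by linarith)
    nlinarith
  · rw [lintegral_expLaw_exp hpos (by linarith), mul_add, ← mul_assoc,
      ← ENNReal.ofReal_mul (by apply div_nonneg <;> linarith)]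
    gcongr ?_ + ?_
    · gcongr
      refine le_of_eq ?_
      have : 2 * lam + mu + 2 * A * q ≠ 0 := hq2.ne'
      rw [sub_neg_eq_add]
      field_simp
    · rw [ENNReal.ofReal_rpow_of_pos (by positivity), ← mul_assoc,
        ← ENNReal.ofReal_mul (by apply div_nonneg <;> linarith), ← ENNReal.ofReal_mul (by
          apply mul_nonneg <;> apply div_nonneg <;> linarith)]
      refine ENNReal.ofReal_le_ofReal ?_
      rw [sub_neg_eq_add]
      have h3 : (2 * lam + mu) / (2 * lam + mu + 2 * A * q) * (mu / (2 * lam + mu)) =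
          mu / (2 * lam + mu + 2 * A * q) := by
        field_simp
      rw [h3]
      exact mul_le_mul_of_nonneg_left
        (Real.rpow_le_rpow_of_nonpos hT (by linarith) (by linarith)) (by positivity)

lemma shift_convex {ε q : ℝ} (hε : 0 < ε) (hq : 0 ≤ q) (θ a : ℝ) (ha : 0 ≤ a) (b : ℝ)
    (hb : 0 ≤ b) :
    ENNReal.ofReal (Real.cos θ ^ 2 * a + Real.sin θ ^ 2 * b + ε) ^ (-q) ≤
      ENNReal.ofReal (Real.cos θ ^ 2) * ENNReal.ofReal (a + ε) ^ (-q) +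
        ENNReal.ofReal (Real.sin θ ^ 2) * ENNReal.ofReal (b + ε) ^ (-q) := by
  rw [ENNReal.ofReal_rpow_of_pos (by positivity), ENNReal.ofReal_rpow_of_pos (by positivity),
    ENNReal.ofReal_rpow_of_pos (by positivity), ← ENNReal.ofReal_mul (sq_nonneg _),
    ← ENNReal.ofReal_mul (sq_nonneg _), ← ENNReal.ofReal_add (by positivity) (by positivity)]
  refine ENNReal.ofReal_le_ofReal ?_
  have := rpow_neg_convex (sq_nonneg (Real.cos θ)) (sq_nonneg (Real.sin θ))
    (Real.cos_sq_add_sin_sq θ) (show 0 < a + ε by linarith) (show 0 < b + ε by linarith) hq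
  refine le_trans (le_of_eq ?_) this
  congr 1
  linear_combination -ε * Real.cos_sq_add_sin_sq θ

/-- Convexity alone bounds the collision term by the moment itself, and the prefactor is less than
one exactly because `μ + 2Aq > 0`. This crude range of exponents starts the sharp argument. -/
lemma IsVarianceLaw.lintegral_rpow_neg_ne_top_of_small (hM : IsVarianceLaw lam mu E T M)
    (hlam : 0 ≤ lam) (hmu : 0 < mu) (hT : 0 < T) (hA : drift mu E T ≤ 0) {q : ℝ} (hq : 0 < q)
    (hq2 : 0 < mu + 2 * drift mu E T * q) : ∫⁻ s, ENNReal.ofReal s ^ (-q) ∂M ≠ ⊤ := by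
  have := hM.prob
  have hD : 0 < 2 * lam + mu + 2 * drift mu E T * q := by linarith
  refine ne_top_of_le_ne_top ENNReal.ofReal_ne_top (lintegral_rpow_neg_le_of_shift fun ε hε =>
    ENNReal_le_of_le_mul_add (hM.shift_ne_top hε hq.le)
      (a := 2 * lam / (2 * lam + mu + 2 * drift mu E T * q))
      (b := mu / (2 * lam + mu + 2 * drift mu E T * q) * T ^ (-q))
      (by positivity) (by rw [div_lt_one hD]; linarith)
      (by positivity) ((hM.shift_le hlam hmu hT hA hq hD hε).trans ?_))
  gcongr
  exact collisionAverage_le hM.nonneg (by fun_prop) (shift_convex hε hq.le)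

/-- At a nondegenerate angle both weights are at least `η²`. Splitting the exponent as `(q - d) +
d`, one factor is bounded using only `a`, the other using only `b`. -/
lemma shift_separated {ε q d η θ : ℝ} (hε : 0 < ε) (hη : 0 < η) (hd : 0 < d) (hdq : d ≤ q)
    (hθ : η < |Real.sin θ * Real.cos θ|) {a b : ℝ} (ha : 0 ≤ a) (hb : 0 ≤ b) :
    ENNReal.ofReal (Real.cos θ ^ 2 * a + Real.sin θ ^ 2 * b + ε) ^ (-q) ≤
      ENNReal.ofReal ((η ^ 2) ^ (-q)) *
        (ENNReal.ofReal ((a + ε) ^ (-(q - d))) * ENNReal.ofReal (b + ε) ^ (-d)) := by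
  have h0 : η ^ 2 ≤ Real.sin θ ^ 2 * Real.cos θ ^ 2 := by
    rw [← mul_pow, ← sq_abs (Real.sin θ * Real.cos θ)]
    exact pow_le_pow_left₀ hη.le hθ.le 2
  have hsc := Real.cos_sq_add_sin_sq θ
  have hc0 := sq_nonneg (Real.cos θ)
  have hs0 := sq_nonneg (Real.sin θ)
  have hc : η ^ 2 ≤ Real.cos θ ^ 2 := by nlinarith
  have hs : η ^ 2 ≤ Real.sin θ ^ 2 := by nlinarith
  have hX : 0 < a + ε := by linarith
  have hY : 0 < b + ε := by linarith
  rw [ENNReal.ofReal_rpow_of_pos (by positivity), ENNReal.ofReal_rpow_of_pos hY,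
    ← ENNReal.ofReal_mul (by positivity), ← ENNReal.ofReal_mul (by positivity)]
  refine ENNReal.ofReal_le_ofReal ?_
  have hZ : Real.cos θ ^ 2 * a + Real.sin θ ^ 2 * b + ε =
      Real.cos θ ^ 2 * (a + ε) + Real.sin θ ^ 2 * (b + ε) := by
    linear_combination -ε * hsc
  rw [hZ]
  have hZpos : 0 < Real.cos θ ^ 2 * (a + ε) + Real.sin θ ^ 2 * (b + ε) := by rw [← hZ]; positivity
  have h1 : (Real.cos θ ^ 2 * (a + ε) + Real.sin θ ^ 2 * (b + ε)) ^ (-(q - d)) ≤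
      (η ^ 2 * (a + ε)) ^ (-(q - d)) :=
    Real.rpow_le_rpow_of_nonpos (by positivity) (by nlinarith) (by linarith)
  have h2 : (Real.cos θ ^ 2 * (a + ε) + Real.sin θ ^ 2 * (b + ε)) ^ (-d) ≤
      (η ^ 2 * (b + ε)) ^ (-d) :=
    Real.rpow_le_rpow_of_nonpos (by positivity) (by nlinarith) (by linarith)
  have h3 : -q = -(q - d) + -d := by ring
  calc _ = (Real.cos θ ^ 2 * (a + ε) + Real.sin θ ^ 2 * (b + ε)) ^ (-(q - d)) *
        (Real.cos θ ^ 2 * (a + ε) + Real.sin θ ^ 2 * (b + ε)) ^ (-d) := by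
        rw [← Real.rpow_add hZpos, ← h3]
    _ ≤ (η ^ 2 * (a + ε)) ^ (-(q - d)) * (η ^ 2 * (b + ε)) ^ (-d) := by gcongr
    _ = _ := by
        rw [Real.mul_rpow (by positivity) hX.le, Real.mul_rpow (by positivity) hY.le, h3,
          Real.rpow_add (by positivity)]
        ring

/-- Collisions cost arbitrarily little of a negative moment. Near-degenerate angles have small
probability and are handled by convexity. At the others the average is at most a moment of order
`-(q - d)` times the finite moment of order `-d`, and the former is absorbed. The constant does not
depend on the shift. -/
lemma IsVarianceLaw.collisionAverage_shift_le (hM : IsVarianceLaw lam mu E T M) {q d : ℝ}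
    (hd : 0 < d) (hdq : d ≤ q) (hB : ∫⁻ s, ENNReal.ofReal s ^ (-d) ∂M ≠ ⊤) {η : ℝ} (hη : 0 < η) :
    ∃ C : ℝ, 0 ≤ C ∧ ∀ ε : ℝ, 0 < ε →
      collisionAverage M (fun s => ENNReal.ofReal (s + ε) ^ (-q)) ≤
        ENNReal.ofReal η * ∫⁻ s, ENNReal.ofReal (s + ε) ^ (-q) ∂M + ENNReal.ofReal C := by
  have := hM.prob
  obtain ⟨ε0, hε0, hS⟩ := exists_uniformAngle_sin_mul_cos_le
    (η := ENNReal.ofReal (η / 2)) (by simpa using hη)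
  set B := (∫⁻ s, ENNReal.ofReal s ^ (-d) ∂M).toReal with hBdef
  have hB0 : 0 ≤ B := ENNReal.toReal_nonneg
  have hBeq : ∫⁻ s, ENNReal.ofReal s ^ (-d) ∂M = ENNReal.ofReal B := (ENNReal.ofReal_toReal hB).symm
  set K1 := (ε0 ^ 2) ^ (-q) with hK1
  have hK10 : 0 ≤ K1 := by positivity
  -- The factor is chosen so that after multiplication by `K1 * B` at most `η / 2` remains; the `+
  -- 1` avoids division by zero.
  obtain ⟨K, hK, hKle⟩ := rpow_sub_le_mul_rpow_add hd hdq (η := η / 2 / (K1 * B + 1)) (by positivity)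
  refine ⟨K1 * B * K, by positivity, fun ε hε => ?_⟩
  set S := {θ : ℝ | |Real.sin θ * Real.cos θ| ≤ ε0}
  have hSm : MeasurableSet S := measurableSet_le (by fun_prop) measurable_const
  set x := ∫⁻ s, ENNReal.ofReal (s + ε) ^ (-q) ∂M
  rw [collisionAverage, ← lintegral_add_compl _ hSm]
  have h1 : ∫⁻ θ in S, ∫⁻ a, ∫⁻ b,
      ENNReal.ofReal (Real.cos θ ^ 2 * a + Real.sin θ ^ 2 * b + ε) ^ (-q) ∂M ∂M ∂uniformAngle ≤
      ENNReal.ofReal (η / 2) * x := by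
    refine (collisionAverage_le_of_convex hM.nonneg
      (F := fun s => ENNReal.ofReal (s + ε) ^ (-q)) (by fun_prop) S
      (fun θ _ => shift_convex hε (by linarith) θ)).trans ?_
    gcongr
  have hF' : ∫⁻ s, ENNReal.ofReal ((s + ε) ^ (-(q - d))) ∂M ≤
      ENNReal.ofReal (η / 2 / (K1 * B + 1)) * x + ENNReal.ofReal K := by
    calc _ ≤ ∫⁻ s, (ENNReal.ofReal (η / 2 / (K1 * B + 1)) * ENNReal.ofReal (s + ε) ^ (-q) +
            ENNReal.ofReal K) ∂M := by
          refine lintegral_mono_ae (hM.nonneg.mono fun s hs => ?_)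
          have hX : 0 < s + ε := by linarith
          rw [ENNReal.ofReal_rpow_of_pos hX, ← ENNReal.ofReal_mul (by positivity),
            ← ENNReal.ofReal_add (by positivity) hK]
          refine ENNReal.ofReal_le_ofReal ?_
          -- Negative powers of `s + ε` are positive powers of its inverse.
          have := hKle (s + ε)⁻¹ (by positivity)
          rwa [Real.inv_rpow hX.le, Real.inv_rpow hX.le, ← Real.rpow_neg hX.le,
            ← Real.rpow_neg hX.le] at this
      _ = _ := by
          rw [lintegral_add_right _ measurable_const, lintegral_const_mul _ (by fun_prop),
            lintegral_const, measure_univ, mul_one]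
  have h2 : ∫⁻ θ in Sᶜ, ∫⁻ a, ∫⁻ b,
      ENNReal.ofReal (Real.cos θ ^ 2 * a + Real.sin θ ^ 2 * b + ε) ^ (-q) ∂M ∂M ∂uniformAngle ≤
      ENNReal.ofReal K1 * ((ENNReal.ofReal (η / 2 / (K1 * B + 1)) * x + ENNReal.ofReal K) *
        ENNReal.ofReal B) := by
    calc _ ≤ ∫⁻ θ in Sᶜ, ENNReal.ofReal K1 * ((ENNReal.ofReal (η / 2 / (K1 * B + 1)) * x +
          ENNReal.ofReal K) * ENNReal.ofReal B) ∂uniformAngle := by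
          refine setLIntegral_mono measurable_const fun θ hθ => ?_
          have hθ' : ε0 < |Real.sin θ * Real.cos θ| := not_le.1 hθ
          calc _ ≤ ∫⁻ a, ∫⁻ b, ENNReal.ofReal K1 * (ENNReal.ofReal ((a + ε) ^ (-(q - d))) *
                ENNReal.ofReal (b + ε) ^ (-d)) ∂M ∂M := by
                refine lintegral_mono_ae (hM.nonneg.mono fun a ha => lintegral_mono_ae
                  (hM.nonneg.mono fun b hb => ?_))
                exact shift_separated hε hε0 hd hdq hθ' ha hb
            _ = ENNReal.ofReal K1 * ((∫⁻ a, ENNReal.ofReal ((a + ε) ^ (-(q - d))) ∂M) *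
                ∫⁻ b, ENNReal.ofReal (b + ε) ^ (-d) ∂M) := by
                have : ∀ a : ℝ, ∫⁻ b, ENNReal.ofReal K1 * (ENNReal.ofReal ((a + ε) ^ (-(q - d))) *
                  ENNReal.ofReal (b + ε) ^ (-d)) ∂M = ENNReal.ofReal K1 *
                  (ENNReal.ofReal ((a + ε) ^ (-(q - d))) *
                    ∫⁻ b, ENNReal.ofReal (b + ε) ^ (-d) ∂M) := fun a => by
                  rw [lintegral_const_mul _ (by fun_prop), lintegral_const_mul _ (by fun_prop)]
                simp only [this]
                rw [lintegral_const_mul _ (by fun_prop), lintegral_mul_const _ (by fun_prop)]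
            _ ≤ _ := by
                gcongr
                rw [← hBeq]
                refine lintegral_mono_ae (hM.nonneg.mono fun b hb => ?_)
                rw [ENNReal.rpow_neg, ENNReal.rpow_neg]
                exact ENNReal.inv_le_inv.2 (ENNReal.rpow_le_rpow
                  (ENNReal.ofReal_le_ofReal (by linarith)) hd.le)
      _ ≤ _ := by
          rw [setLIntegral_const]
          exact (mul_le_mul_right prob_le_one _).trans_eq (mul_one _)
  refine (add_le_add h1 h2).trans ?_
  rw [add_mul, mul_add, ← add_assoc]
  refine add_le_add ?_ (le_of_eq ?_)
  · rw [mul_right_comm, ← mul_assoc, ← add_mul, ← ENNReal.ofReal_mul (by positivity),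
      ← ENNReal.ofReal_mul (by positivity), ← ENNReal.ofReal_add (by positivity) (by positivity)]
    gcongr
    have : K1 * (η / 2 / (K1 * B + 1) * B) ≤ η / 2 := by
      have h5 : K1 * (η / 2 / (K1 * B + 1) * B) = η / 2 * (K1 * B / (K1 * B + 1)) := by
        field_simp
      rw [h5]
      have : K1 * B / (K1 * B + 1) ≤ 1 := by
        rw [div_le_one (by positivity)]; linarith
      nlinarith
    linarith
  · rw [← ENNReal.ofReal_mul hK, ← ENNReal.ofReal_mul hK10]
    congr 1
    ring

lemma IsVarianceLaw.exists_lintegral_rpow_neg_ne_top (hM : IsVarianceLaw lam mu E T M)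
    (hlam : 0 ≤ lam) (hmu : 0 < mu) (hT : 0 < T) (hA : drift mu E T ≤ 0) {q : ℝ} (hq : 0 < q) :
    ∃ d : ℝ, 0 < d ∧ d ≤ q ∧ ∫⁻ s, ENNReal.ofReal s ^ (-d) ∂M ≠ ⊤ := by
  have hA1 : 0 < 1 - drift mu E T := by linarith
  -- The bound `d ≤ μ / (4(1 - A))` gives `-2Ad ≤ μ/2`, so the crude range of exponents applies.
  refine ⟨min q (mu / (4 * (1 - drift mu E T))), by positivity, min_le_left _ _,
    hM.lintegral_rpow_neg_ne_top_of_small hlam hmu hT hA (by positivity) ?_⟩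
  have h1 : min q (mu / (4 * (1 - drift mu E T))) ≤ mu / (4 * (1 - drift mu E T)) :=
    min_le_right _ _
  rw [le_div_iff₀ (by positivity)] at h1
  have h2 : 0 < min q (mu / (4 * (1 - drift mu E T))) := by positivity
  nlinarith

/-- The negative moments of the variance law. -/
theorem IsVarianceLaw.lintegral_rpow_neg_ne_top_iff (hM : IsVarianceLaw lam mu E T M)
    (hlam : 0 ≤ lam) (hmu : 0 < mu) (hE : 0 < E) (hT : 0 < T) {q : ℝ} (hq : 0 < q) :
    ∫⁻ s, ENNReal.ofReal s ^ (-q) ∂M ≠ ⊤ ↔ 0 < 2 * lam + mu + 2 * drift mu E T * q := by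
  have := hM.prob
  have hpos : 0 < 2 * lam + mu := by linarith
  constructor
  · intro h
    by_contra! hc
    apply h
    -- Necessity: the thermostat contribution `T^{-q}` is positive and is multiplied by a divergent
    -- exponential moment of the clock.
    rw [hM.fixed _ (by fun_prop), varianceStep_rpow,
      lintegral_expLaw_exp_eq_top hpos (by linarith), ENNReal.top_mul]
    have : 0 < ENNReal.ofReal (mu / (2 * lam + mu)) * ENNReal.ofReal T ^ (-q) := by
      rw [ENNReal.ofReal_rpow_of_pos hT, ← ENNReal.ofReal_mul (by positivity), ENNReal.ofReal_pos]
      positivity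
    exact (lt_of_lt_of_le this le_add_self).ne'
  · intro hD
    -- If `A ≥ 0`, the variance is bounded below by `T` and nothing else is needed; the estimate of
    -- the collision term is for `A ≤ 0`.
    rcases le_total 0 (drift mu E T) with hA | hA
    · have hET : T ≤ E := by
        by_contra! hlt
        have : drift mu E T < 0 := by
          unfold drift
          exact mul_neg_of_pos_of_neg hmu (div_neg_of_neg_of_pos (by linarith) (by linarith))
        linarith
      refine ne_top_of_le_ne_top (b := ENNReal.ofReal (T ^ (-q))) ENNReal.ofReal_ne_top ?_
      calc _ ≤ ∫⁻ s, ENNReal.ofReal (T ^ (-q)) ∂M := by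
            refine lintegral_mono_ae ((hM.le_of_le hlam hmu hE hT hET).mono fun s hs => ?_)
            rw [ENNReal.ofReal_rpow_of_pos (by linarith)]
            exact ENNReal.ofReal_le_ofReal
              (Real.rpow_le_rpow_of_nonpos hT hs (by linarith))
        _ = _ := by simp
    · obtain ⟨d, hd, hdq, hB⟩ := hM.exists_lintegral_rpow_neg_ne_top hlam hmu hT hA hq
      set D := 2 * lam + mu + 2 * drift mu E T * q
      -- With this choice the coefficient `(2λ/D) η = λ/(2λ + 1)` of the moment on the right is less
      -- than one.
      have hη : 0 < D / (2 * (2 * lam + 1)) := by positivity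
      obtain ⟨C, hC, hCle⟩ := hM.collisionAverage_shift_le hd hdq hB hη
      have ha1 : 2 * lam / D * (D / (2 * (2 * lam + 1))) < 1 := by
        have : 2 * lam / D * (D / (2 * (2 * lam + 1))) = 2 * lam / (2 * (2 * lam + 1)) := by
          field_simp
        rw [this, div_lt_one (by positivity)]
        linarith
      refine ne_top_of_le_ne_top ENNReal.ofReal_ne_top (lintegral_rpow_neg_le_of_shift fun ε hε =>
        ENNReal_le_of_le_mul_add (hM.shift_ne_top hε hq.le)
          (a := 2 * lam / D * (D / (2 * (2 * lam + 1))))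
          (b := 2 * lam / D * C + mu / D * T ^ (-q)) (by positivity) ha1 (by positivity)
          ((hM.shift_le hlam hmu hT hA hq hD hε).trans ?_))
      calc _ ≤ ENNReal.ofReal (2 * lam / D) * (ENNReal.ofReal (D / (2 * (2 * lam + 1))) *
            ∫⁻ s, ENNReal.ofReal (s + ε) ^ (-q) ∂M + ENNReal.ofReal C) +
            ENNReal.ofReal (mu / D * T ^ (-q)) := by
            gcongr
            exact hCle ε hε
        _ = _ := by
            rw [mul_add, ← mul_assoc, ← ENNReal.ofReal_mul (by positivity),
              ← ENNReal.ofReal_mul (by positivity), add_assoc,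
              ← ENNReal.ofReal_add (by positivity) (by positivity)]

/-- Some negative moment is finite, and a negative power of zero is infinite. -/
lemma IsVarianceLaw.pos (hM : IsVarianceLaw lam mu E T M)
    (hlam : 0 ≤ lam) (hmu : 0 < mu) (hE : 0 < E) (hT : 0 < T) : ∀ᵐ s ∂M, 0 < s := by
  obtain ⟨d, hd, -, hB⟩ : ∃ d : ℝ, 0 < d ∧ d ≤ 1 ∧ ∫⁻ s, ENNReal.ofReal s ^ (-d) ∂M ≠ ⊤ := by
    rcases le_total (drift mu E T) 0 with hA | hA
    · exact hM.exists_lintegral_rpow_neg_ne_top hlam hmu hT hA one_pos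
    · exact ⟨1, one_pos, le_rfl, (hM.lintegral_rpow_neg_ne_top_iff hlam hmu hE hT one_pos).2
        (by linarith)⟩
  have := ae_lt_top (by fun_prop) hB
  refine this.mono fun s hs => ?_
  by_contra! h
  rw [ENNReal.ofReal_of_nonpos h, ENNReal.zero_rpow_of_neg (by linarith)] at hs
  exact lt_irrefl _ hs

end Shifted

/-! ### Positive moments of the variance law -/

lemma cos_sq_rpow (θ q : ℝ) : (Real.cos θ ^ 2) ^ q = |Real.cos θ| ^ (2 * q) := by
  rw [← sq_abs, ← Real.rpow_natCast, ← Real.rpow_mul (abs_nonneg _)]; norm_num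

lemma sin_sq_rpow (θ q : ℝ) : (Real.sin θ ^ 2) ^ q = |Real.sin θ| ^ (2 * q) := by
  rw [← sq_abs, ← Real.rpow_natCast, ← Real.rpow_mul (abs_nonneg _)]; norm_num

/-- Superadditivity of `t ↦ t^q` for `q ≥ 1`; the mean of `|cos|^{2q} + |sin|^{2q}` is `1 - C_{2q}`.
-/
lemma le_collisionAverage_rpow {m : Measure ℝ} [IsProbabilityMeasure m]
    (hm : ∀ᵐ s ∂m, 0 ≤ s) {q : ℝ} (hq : 1 ≤ q) :
    ENNReal.ofReal (1 - momentConst (2 * q)) * ∫⁻ s, ENNReal.ofReal s ^ q ∂m ≤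
      collisionAverage m (fun s => ENNReal.ofReal s ^ q) := by
  set x := ∫⁻ s, ENNReal.ofReal s ^ q ∂m
  have h1 := momentConst_le_one (2 * q)
  have h2 : ENNReal.ofReal (1 - momentConst (2 * q)) * x =
      ∫⁻ θ, (ENNReal.ofReal (|Real.cos θ| ^ (2 * q)) * x +
        ENNReal.ofReal (|Real.sin θ| ^ (2 * q)) * x) ∂uniformAngle := by
    have hc : Measurable fun θ : ℝ => ENNReal.ofReal (|Real.cos θ| ^ (2 * q)) := by fun_prop
    have hs : Measurable fun θ : ℝ => ENNReal.ofReal (|Real.sin θ| ^ (2 * q)) := by fun_prop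
    rw [lintegral_add_left (by fun_prop), lintegral_mul_const _ hc, lintegral_mul_const _ hs,
      lintegral_abs_cos_rpow (by linarith), lintegral_abs_sin_rpow (by linarith), ← add_mul,
      ← ENNReal.ofReal_add (by linarith) (by linarith), add_halves]
  rw [h2, collisionAverage]
  refine lintegral_mono fun θ => ?_
  calc _ = ∫⁻ a, ∫⁻ b, (ENNReal.ofReal (|Real.cos θ| ^ (2 * q)) * ENNReal.ofReal a ^ q +
        ENNReal.ofReal (|Real.sin θ| ^ (2 * q)) * ENNReal.ofReal b ^ q) ∂m ∂m := by
        simp only [lintegral_add_left measurable_const, lintegral_const, measure_univ, mul_one]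
        rw [lintegral_add_right _ measurable_const, lintegral_const_mul _ (by fun_prop),
          lintegral_const, measure_univ, mul_one, lintegral_const_mul _ (by fun_prop)]
    _ ≤ _ := by
        refine lintegral_mono_ae (hm.mono fun a ha => lintegral_mono_ae (hm.mono fun b hb => ?_))
        rw [ENNReal.ofReal_add (by positivity) (by positivity), ENNReal.ofReal_mul (by positivity),
          ENNReal.ofReal_mul (by positivity)]
        refine le_trans (le_of_eq ?_) (ENNReal.add_rpow_le_rpow_add _ _ hq)
        rw [ENNReal.mul_rpow_of_nonneg _ _ (by linarith), ENNReal.mul_rpow_of_nonneg _ _ (by linarith),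
          ENNReal.ofReal_rpow_of_nonneg (sq_nonneg _) (by linarith),
          ENNReal.ofReal_rpow_of_nonneg (sq_nonneg _) (by linarith), cos_sq_rpow, sin_sq_rpow]

lemma rpow_weighted_add_le {q θ a b : ℝ} (hq : 1 < q) (ha : 0 ≤ a) (hb : 0 ≤ b) :
    ENNReal.ofReal (Real.cos θ ^ 2 * a + Real.sin θ ^ 2 * b) ^ q ≤
      ENNReal.ofReal (|Real.cos θ| ^ (2 * q)) * ENNReal.ofReal a ^ q +
      ENNReal.ofReal (|Real.sin θ| ^ (2 * q)) * ENNReal.ofReal b ^ q +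
      ENNReal.ofReal (q * 2 ^ (q - 1)) * (ENNReal.ofReal (a ^ (q - 1)) * ENNReal.ofReal b +
        ENNReal.ofReal (b ^ (q - 1)) * ENNReal.ofReal a) := by
  have hc : Real.cos θ ^ 2 * a ≤ a := mul_le_of_le_one_left ha (Real.cos_sq_le_one θ)
  have hs : Real.sin θ ^ 2 * b ≤ b := mul_le_of_le_one_left hb (Real.sin_sq_le_one θ)
  rw [ENNReal.ofReal_rpow_of_nonneg (by positivity) (by linarith),
    ENNReal.ofReal_rpow_of_nonneg ha (by linarith), ENNReal.ofReal_rpow_of_nonneg hb (by linarith),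
    ← ENNReal.ofReal_mul (by positivity), ← ENNReal.ofReal_mul (by positivity),
    ← ENNReal.ofReal_mul (by positivity), ← ENNReal.ofReal_mul (by positivity),
    ← ENNReal.ofReal_add (by positivity) (by positivity),
    ← ENNReal.ofReal_add (by positivity) (by positivity), ← ENNReal.ofReal_mul (by positivity),
    ← ENNReal.ofReal_add (by positivity) (by positivity)]
  refine ENNReal.ofReal_le_ofReal ?_
  refine (add_rpow_le_add_cross (a := Real.cos θ ^ 2 * a) (b := Real.sin θ ^ 2 * b)
    (by positivity) (by positivity) hq).trans ?_
  rw [Real.mul_rpow (sq_nonneg _) ha, Real.mul_rpow (sq_nonneg _) hb, cos_sq_rpow, sin_sq_rpow]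
  gcongr

/-- Matches the lower bound `1 - C_{2q}` up to `η`: cross terms involve the moment of order `q - 1`
times the mean, and are absorbed. The constant depends on the law only through the bound `E` on its
mean, hence serves all iterates at once. -/
lemma collisionAverage_rpow_le {q E : ℝ} (hq : 1 < q) (hE : 0 < E) {η : ℝ} (hη : 0 < η) :
    ∃ C : ℝ, 0 ≤ C ∧ ∀ m : Measure ℝ, IsProbabilityMeasure m → (∀ᵐ s ∂m, 0 ≤ s) →
      ∫⁻ s, ENNReal.ofReal s ∂m ≤ ENNReal.ofReal E →
      collisionAverage m (fun s => ENNReal.ofReal s ^ q) ≤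
        ENNReal.ofReal (1 - momentConst (2 * q) + η) * ∫⁻ s, ENNReal.ofReal s ^ q ∂m +
          ENNReal.ofReal C := by
  set K1 := q * 2 ^ (q - 1) with hK1
  have hK10 : 0 < K1 := by positivity
  -- The two cross terms have total weight at most `2 K1 E`, which this factor turns into `η`.
  obtain ⟨K, hK, hKle⟩ := rpow_sub_le_mul_rpow_add one_pos hq.le (η := η / (2 * K1 * E))
    (by positivity)
  refine ⟨2 * K1 * E * K, by positivity, fun m hm hnn hmean => ?_⟩
  set x := ∫⁻ s, ENNReal.ofReal s ^ q ∂m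
  have hC := momentConst_le_one (2 * q)
  have hy : ∫⁻ s, ENNReal.ofReal (s ^ (q - 1)) ∂m ≤
      ENNReal.ofReal (η / (2 * K1 * E)) * x + ENNReal.ofReal K := by
    calc _ ≤ ∫⁻ s, (ENNReal.ofReal (η / (2 * K1 * E)) * ENNReal.ofReal s ^ q + ENNReal.ofReal K) ∂m
        := by
          refine lintegral_mono_ae (hnn.mono fun s hs => ?_)
          rw [ENNReal.ofReal_rpow_of_nonneg hs (by linarith), ← ENNReal.ofReal_mul (by positivity),
            ← ENNReal.ofReal_add (by positivity) hK]
          exact ENNReal.ofReal_le_ofReal (hKle s hs)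
      _ = _ := by
          rw [lintegral_add_right _ measurable_const, lintegral_const_mul _ (by fun_prop),
            lintegral_const, measure_univ, mul_one]
  set y := ∫⁻ s, ENNReal.ofReal (s ^ (q - 1)) ∂m
  set z := ∫⁻ s, ENNReal.ofReal s ∂m
  have hin : ∀ θ, ∫⁻ a, ∫⁻ b, ENNReal.ofReal (Real.cos θ ^ 2 * a + Real.sin θ ^ 2 * b) ^ q ∂m ∂m ≤
      ENNReal.ofReal (|Real.cos θ| ^ (2 * q)) * x + ENNReal.ofReal (|Real.sin θ| ^ (2 * q)) * x +
        ENNReal.ofReal K1 * (y * z + y * z) := by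
    intro θ
    calc _ ≤ ∫⁻ a, ∫⁻ b, (ENNReal.ofReal (|Real.cos θ| ^ (2 * q)) * ENNReal.ofReal a ^ q +
          ENNReal.ofReal (|Real.sin θ| ^ (2 * q)) * ENNReal.ofReal b ^ q +
          ENNReal.ofReal K1 * (ENNReal.ofReal (a ^ (q - 1)) * ENNReal.ofReal b +
          ENNReal.ofReal (b ^ (q - 1)) * ENNReal.ofReal a)) ∂m ∂m :=
          lintegral_mono_ae (hnn.mono fun a ha => lintegral_mono_ae (hnn.mono fun b hb =>
            rpow_weighted_add_le hq ha hb))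
      _ = ∫⁻ a, (ENNReal.ofReal (|Real.cos θ| ^ (2 * q)) * ENNReal.ofReal a ^ q +
          ENNReal.ofReal (|Real.sin θ| ^ (2 * q)) * x +
          ENNReal.ofReal K1 * (ENNReal.ofReal (a ^ (q - 1)) * z + y * ENNReal.ofReal a)) ∂m := by
          refine lintegral_congr fun a => ?_
          rw [lintegral_add_left (by fun_prop), lintegral_add_left (by fun_prop),
            lintegral_const, measure_univ, mul_one, lintegral_const_mul _ (by fun_prop),
            lintegral_const_mul _ (by fun_prop), lintegral_add_left (by fun_prop),
            lintegral_const_mul _ (by fun_prop), lintegral_mul_const _ (by fun_prop)]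
      _ = _ := by
          rw [lintegral_add_left (by fun_prop), lintegral_add_left (by fun_prop),
            lintegral_const, measure_univ, mul_one, lintegral_const_mul _ (by fun_prop),
            lintegral_const_mul _ (by fun_prop), lintegral_add_left (by fun_prop),
            lintegral_const_mul _ (by fun_prop), lintegral_mul_const _ (by fun_prop)]
  have hc : Measurable fun θ : ℝ => ENNReal.ofReal (|Real.cos θ| ^ (2 * q)) := by fun_prop
  have hs : Measurable fun θ : ℝ => ENNReal.ofReal (|Real.sin θ| ^ (2 * q)) := by fun_prop
  calc _ ≤ ∫⁻ θ, (ENNReal.ofReal (|Real.cos θ| ^ (2 * q)) * x +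
        ENNReal.ofReal (|Real.sin θ| ^ (2 * q)) * x +
        ENNReal.ofReal K1 * (y * z + y * z)) ∂uniformAngle := lintegral_mono hin
    _ = ENNReal.ofReal (1 - momentConst (2 * q)) * x + ENNReal.ofReal K1 * (y * z + y * z) := by
        rw [lintegral_add_right _ measurable_const, lintegral_add_left (by fun_prop),
          lintegral_mul_const _ hc, lintegral_mul_const _ hs, lintegral_abs_cos_rpow (by linarith),
          lintegral_abs_sin_rpow (by linarith), ← add_mul,
          ← ENNReal.ofReal_add (by linarith) (by linarith), add_halves, lintegral_const,
          measure_univ, mul_one]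
    _ ≤ ENNReal.ofReal (1 - momentConst (2 * q)) * x + ENNReal.ofReal (2 * K1 * E) *
          (ENNReal.ofReal (η / (2 * K1 * E)) * x + ENNReal.ofReal K) := by
        refine add_le_add_right ?_ _
        rw [← two_mul, mul_comm y z, ← mul_assoc, ← mul_assoc]
        have : ENNReal.ofReal (2 * K1 * E) = ENNReal.ofReal K1 * 2 * ENNReal.ofReal E := by
          rw [ENNReal.ofReal_mul (by positivity), ENNReal.ofReal_mul (by positivity)]
          simp [mul_comm]
        rw [this]
        gcongr
    _ = _ := by
        rw [mul_add, ← mul_assoc, ← ENNReal.ofReal_mul (by positivity), ← add_assoc, ← add_mul,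
          ← ENNReal.ofReal_add (by linarith) (by positivity), ← ENNReal.ofReal_mul (by positivity)]
        congr 4
        field_simp

section PositiveMoments

variable {lam mu E T : ℝ} {M : Measure ℝ}

/-- A uniform bound is propagated along the iterates from the point mass at `0`, whose moments are
trivially finite; the moment of `M` is their supremum. This avoids assuming finiteness for `M`
itself. -/
lemma IsVarianceLaw.lintegral_rpow_ne_top_of_lt {m : ℕ → Measure ℝ}
    (happ : IsVarianceApprox lam mu E T M m) (hlam : 0 ≤ lam) (hmu : 0 < mu) (hE : 0 < E)
    (hT : 0 < T) {q : ℝ} (hq : 1 < q)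
    (h : 2 * q * drift mu E T < 2 * lam * momentConst (2 * q) + mu) :
    ∫⁻ s, ENNReal.ofReal s ^ q ∂M ≠ ⊤ := by
  have hpos : 0 < 2 * lam + mu := by linarith
  have hC := momentConst_le_one (2 * q)
  set A := drift mu E T
  set c := momentConst (2 * q)
  have hlc : 2 * lam * c ≤ 2 * lam := by nlinarith
  have hD : 0 < 2 * lam + mu - 2 * A * q := by linarith
  set D := 2 * lam + mu - 2 * A * q with hDdef
  set gap := 2 * lam * c + mu - 2 * q * A with hgap
  have hgap0 : 0 < gap := by linarith
  -- Then `2λη ≤ gap / 2`, which leaves room for the contraction factor `a` to be less than one.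
  set η := gap / (2 * (2 * lam + 1)) with hη
  have hη0 : 0 < η := by positivity
  obtain ⟨C, hC0, hCle⟩ := collisionAverage_rpow_le hq hE hη0
  set a := 2 * lam / D * (1 - c + η) with ha
  have h1c : 0 ≤ 1 - c + η := by linarith
  have ha0 : 0 ≤ a := by positivity
  have ha1 : a < 1 := by
    rw [ha, div_mul_eq_mul_div, div_lt_one hD]
    have : 2 * lam * η ≤ gap / 2 := by
      rw [hη, mul_div_assoc', div_le_iff₀ (by positivity)]
      nlinarith
    nlinarith
  set b := 2 * lam / D * C + mu / D * T ^ q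
  have hb : 0 ≤ b := by positivity
  -- `b / (1 - a)` is the fixed point of `x ↦ a x + b`.
  have hbound : ∀ n, ∫⁻ s, ENNReal.ofReal s ^ q ∂(m n) ≤ ENNReal.ofReal (b / (1 - a)) := by
    intro n
    induction n with
    | zero => simp [happ.zero, ENNReal.zero_rpow_of_pos (show 0 < q by linarith)]
    | succ n ih =>
      rw [happ.succ n _ (by fun_prop), varianceStep_rpow, lintegral_expLaw_exp hpos (by linarith)]
      calc _ ≤ ENNReal.ofReal ((2 * lam + mu) / D) * (ENNReal.ofReal (2 * lam / (2 * lam + mu)) *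
            (ENNReal.ofReal (1 - c + η) * ENNReal.ofReal (b / (1 - a)) + ENNReal.ofReal C)
            + ENNReal.ofReal (mu / (2 * lam + mu)) * ENNReal.ofReal (T ^ q)) := by
            gcongr
            · refine (hCle (m n) (happ.prob n) (happ.nonneg n) (happ.mean_le n)).trans ?_
              gcongr
            · rw [ENNReal.ofReal_rpow_of_pos hT]
        _ = ENNReal.ofReal (a * (b / (1 - a)) + b) := by
            have hba : 0 ≤ b / (1 - a) := div_nonneg hb (by linarith)
            rw [← ENNReal.ofReal_mul h1c, ← ENNReal.ofReal_add (by positivity) hC0,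
              ← ENNReal.ofReal_mul (by positivity), ← ENNReal.ofReal_mul (by positivity),
              ← ENNReal.ofReal_add (by positivity) (by positivity),
              ← ENNReal.ofReal_mul (by positivity)]
            congr 1
            simp only [a, b]
            field_simp
            ring
        _ = _ := by
            congr 1
            have : 1 - a ≠ 0 := by linarith
            field_simp
            ring
  rw [happ.rpow q (by linarith)]
  exact ne_top_of_le_ne_top ENNReal.ofReal_ne_top (iSup_le hbound)

/-- For a finite moment `x` the fixed-point equation and superadditivity give `D x ≥ 2λ(1 - c) x + μ
T^q`. Since `μ T^q > 0`, the coefficient `2λc + μ - 2qA` of `x` must be strictly positive. -/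
lemma IsVarianceLaw.lt_of_lintegral_rpow_ne_top (hM : IsVarianceLaw lam mu E T M)
    (hlam : 0 ≤ lam) (hmu : 0 < mu) (hT : 0 < T) {q : ℝ} (hq : 1 < q)
    (h : ∫⁻ s, ENNReal.ofReal s ^ q ∂M ≠ ⊤) :
    2 * q * drift mu E T < 2 * lam * momentConst (2 * q) + mu := by
  have := hM.prob
  have hpos : 0 < 2 * lam + mu := by linarith
  have hC := momentConst_le_one (2 * q)
  set A := drift mu E T
  set c := momentConst (2 * q)
  have hfix := hM.fixed (fun s => ENNReal.ofReal s ^ q) (by fun_prop)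
  rw [varianceStep_rpow] at hfix
  have hthermo : 0 < ENNReal.ofReal (mu / (2 * lam + mu)) * ENNReal.ofReal T ^ q := by
    rw [ENNReal.ofReal_rpow_of_pos hT, ← ENNReal.ofReal_mul (by positivity), ENNReal.ofReal_pos]
    positivity
  have hA : 2 * A * q < 2 * lam + mu := by
    by_contra! hc
    rw [lintegral_expLaw_exp_eq_top hpos hc, ENNReal.top_mul
      (lt_of_lt_of_le hthermo le_add_self).ne'] at hfix
    exact h hfix
  rw [lintegral_expLaw_exp hpos hA] at hfix
  have hle := mul_le_mul_right (add_le_add_left (mul_le_mul_right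
    (le_collisionAverage_rpow hM.nonneg hq.le) (ENNReal.ofReal (2 * lam / (2 * lam + mu))))
    (ENNReal.ofReal (mu / (2 * lam + mu)) * ENNReal.ofReal T ^ q))
    (ENNReal.ofReal ((2 * lam + mu) / (2 * lam + mu - 2 * A * q)))
  rw [← hfix] at hle
  obtain ⟨x, hx⟩ : ∃ x : NNReal, ∫⁻ s, ENNReal.ofReal s ^ q ∂M = x :=
    ⟨_, (ENNReal.coe_toNNReal h).symm⟩
  have hD : 0 < 2 * lam + mu - 2 * A * q := by linarith
  set D := 2 * lam + mu - 2 * A * q with hDdef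
  have h1c : 0 ≤ 1 - c := by linarith
  rw [hx, ← ENNReal.ofReal_coe_nnreal, ENNReal.ofReal_rpow_of_pos hT,
    ← ENNReal.ofReal_mul h1c,
    ← ENNReal.ofReal_mul (by positivity), ← ENNReal.ofReal_mul (by positivity),
    ← ENNReal.ofReal_add (by positivity) (by positivity), ← ENNReal.ofReal_mul (by positivity),
    ENNReal.ofReal_le_ofReal_iff (by positivity)] at hle
  have h2 : (2 * lam + mu) / D * (2 * lam / (2 * lam + mu) * ((1 - c) * x) +
      mu / (2 * lam + mu) * T ^ q) = (2 * lam * (1 - c) * x + mu * T ^ q) / D := by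
    field_simp
  rw [h2, div_le_iff₀ hD] at hle
  have h3 : 0 < mu * T ^ q := by positivity
  have h4 : 0 < x * (2 * lam * c + mu - 2 * q * A) := by rw [hDdef] at hle; linarith
  have h5 := pos_of_mul_pos_right h4 x.2
  linarith

end PositiveMoments

/-! ### Integration by parts against exponentials -/

/-- Integrating factor for a function that is only absolutely continuous: the time integrands below
are merely measurable and bounded, so the derivative exists almost everywhere only. -/
lemma exp_mul_sub_eq_integral {f F : ℝ → ℝ} {t : ℝ} (c F0 : ℝ)
    (hf : IntervalIntegrable f volume 0 t)
    (hF : ∀ s ∈ Set.uIcc 0 t, F s = F0 + ∫ r in (0 : ℝ)..s, f r) :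
    Real.exp (c * t) * F t - F0 = ∫ s in (0 : ℝ)..t, Real.exp (c * s) * (f s + c * F s) := by
  have h1 : AbsolutelyContinuousOnInterval (fun s => F0 + ∫ r in (0 : ℝ)..s, f r) 0 t := by
    refine AbsolutelyContinuousOnInterval.add (f := fun _ => F0) ?_
      (hf.absolutelyContinuousOnInterval_intervalIntegral (by simp))
    exact ContDiffOn.absolutelyContinuousOnInterval contDiffOn_const
  have h2 : AbsolutelyContinuousOnInterval (fun s => Real.exp (c * s)) 0 t := by
    exact ContDiffOn.absolutelyContinuousOnInterval (by fun_prop)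
  have h3 := h1.integral_deriv_mul_eq_sub h2
  simp only [intervalIntegral.integral_same, mul_zero, Real.exp_zero, add_zero, mul_one] at h3
  rw [hF t (by simp), mul_comm, ← h3]
  refine intervalIntegral.integral_congr_ae ?_
  filter_upwards [hf.ae_hasDerivAt_integral] with s hs hs'
  have hs2 := Set.uIoc_subset_uIcc hs'
  have h4 : HasDerivAt (fun s => Real.exp (c * s)) (Real.exp (c * s) * (c * 1)) s :=
    ((hasDerivAt_id s).const_mul c).exp
  rw [((hs hs2 0 (by simp)).const_add F0).deriv, h4.deriv, hF s hs2]
  ring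

/-! ### Gaussian mixtures -/

/-- The law of `√s · x` for `s` of law `M` and `x` standard Gaussian. -/
noncomputable def gaussianMixture (M : Measure ℝ) : Measure ℝ :=
  (M.prod (gaussianReal 0 1)).map fun x => √x.1 * x.2

lemma gaussianReal_map_scale (c : ℝ) {s : ℝ} (hs : 0 ≤ s) :
    (gaussianReal 0 s.toNNReal).map (fun x => c * x) = gaussianReal 0 (c ^ 2 * s).toNNReal := by
  rw [gaussianReal_map_const_mul, mul_zero]
  congr 1
  ext
  simp [hs, mul_nonneg (sq_nonneg c) hs]

lemma lintegral_gaussianReal_scale (c : ℝ) {s : ℝ} (hs : 0 ≤ s) {F : ℝ → ℝ≥0∞}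
    (hF : Measurable F) : ∫⁻ x, F (c * x) ∂(gaussianReal 0 s.toNNReal) =
      ∫⁻ x, F x ∂(gaussianReal 0 (c ^ 2 * s).toNNReal) := by
  rw [← gaussianReal_map_scale c hs, lintegral_map hF (by fun_prop)]

lemma lintegral_gaussianMixture (M : Measure ℝ) [SFinite M] (hM : ∀ᵐ s ∂M, 0 ≤ s)
    {F : ℝ → ℝ≥0∞} (hF : Measurable F) :
    ∫⁻ x, F x ∂(gaussianMixture M) = ∫⁻ s, ∫⁻ x, F x ∂(gaussianReal 0 s.toNNReal) ∂M := by
  rw [gaussianMixture, lintegral_map hF (by fun_prop), lintegral_prod _ (by fun_prop)]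
  refine lintegral_congr_ae (hM.mono fun s hs => ?_)
  have := lintegral_gaussianReal_scale (√s) zero_le_one hF
  rw [Real.toNNReal_one, mul_one, Real.sq_sqrt hs] at this
  exact this

instance (M : Measure ℝ) [IsProbabilityMeasure M] : IsProbabilityMeasure (gaussianMixture M) :=
  Measure.isProbabilityMeasure_map (by fun_prop)

lemma measurable_lintegral_gaussianReal {F : ℝ → ℝ≥0∞} (hF : Measurable F) :
    Measurable fun s : ℝ => ∫⁻ x, F x ∂(gaussianReal 0 s.toNNReal) := by
  have h : Measurable fun s : ℝ => ∫⁻ x, F (√s * x) ∂(gaussianReal 0 1) :=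
    Measurable.lintegral_prod_right' (f := fun p : ℝ × ℝ => F (√p.1 * p.2)) (by fun_prop)
  have h0 : (fun s : ℝ => ∫⁻ x, F x ∂(gaussianReal 0 s.toNNReal)) =
      fun s : ℝ => ∫⁻ x, F (√s * x) ∂(gaussianReal 0 1) := by
    ext s
    have := lintegral_gaussianReal_scale (√s) zero_le_one hF
    rw [Real.toNNReal_one, mul_one] at this
    rw [this]
    congr 2
    rcases le_total 0 s with hs | hs
    · rw [Real.sq_sqrt hs]
    · rw [Real.sqrt_eq_zero_of_nonpos hs, Real.toNNReal_of_nonpos hs]; simp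
  rw [h0]; exact h

/-- The reason why Gaussian mixtures are preserved by collisions: independent centred Gaussians add
their variances, and the angle enters only through the weights `cos² θ`, `sin² θ`. -/
lemma lintegral_gaussianReal_rotate {a b : ℝ} (ha : 0 ≤ a) (hb : 0 ≤ b) (θ : ℝ)
    {F : ℝ → ℝ≥0∞} (hF : Measurable F) :
    ∫⁻ x, ∫⁻ y, F (x * Real.cos θ + y * Real.sin θ) ∂(gaussianReal 0 b.toNNReal)
        ∂(gaussianReal 0 a.toNNReal) =
      ∫⁻ x, F x ∂(gaussianReal 0 (Real.cos θ ^ 2 * a + Real.sin θ ^ 2 * b).toNNReal) := by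
  have h : gaussianReal 0 (Real.cos θ ^ 2 * a + Real.sin θ ^ 2 * b).toNNReal =
      ((gaussianReal 0 a.toNNReal).map (fun x => Real.cos θ * x)).conv
      ((gaussianReal 0 b.toNNReal).map (fun x => Real.sin θ * x)) := by
    rw [gaussianReal_map_scale _ ha, gaussianReal_map_scale _ hb, gaussianReal_conv_gaussianReal,
      Real.toNNReal_add (by positivity) (by positivity), add_zero]
  rw [h, Measure.lintegral_conv hF, lintegral_map (by fun_prop) (by fun_prop)]
  · refine lintegral_congr fun x => ?_
    rw [lintegral_map (by fun_prop) (by fun_prop)]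
    simp only [mul_comm]

lemma lintegral_sq_gaussianReal {s : ℝ} (hs : 0 ≤ s) :
    ∫⁻ x, ENNReal.ofReal (x ^ 2) ∂(gaussianReal 0 s.toNNReal) = ENNReal.ofReal s := by
  have h1 : Integrable (fun x : ℝ => x ^ 2) (gaussianReal 0 s.toNNReal) :=
    (memLp_id_gaussianReal 2).integrable_sq
  rw [← ofReal_integral_eq_lintegral_ofReal h1 (ae_of_all _ fun x => sq_nonneg x)]
  congr 1
  have h2 := variance_fun_id_gaussianReal (μ := 0) (v := s.toNNReal)
  rw [variance_eq_integral aemeasurable_id'] at h2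
  simpa [integral_id_gaussianReal, hs] using h2

lemma energy_gaussianMixture {M : Measure ℝ} [SFinite M] (hM : ∀ᵐ s ∂M, 0 ≤ s) :
    energy (gaussianMixture M) = ∫⁻ s, ENNReal.ofReal s ∂M := by
  rw [energy, lintegral_gaussianMixture M hM (by fun_prop)]
  exact lintegral_congr_ae (hM.mono fun s hs => lintegral_sq_gaussianReal hs)

/-! ### The collision operator -/

lemma lintegral_B2 (ν ν' : Measure ℝ) [SFinite ν] [SFinite ν'] {F : ℝ → ℝ≥0∞} (hF : Measurable F) :
    ∫⁻ x, F x ∂(B2 ν ν') =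
      ∫⁻ θ, ∫⁻ v, ∫⁻ w, F (v * Real.cos θ + w * Real.sin θ) ∂ν' ∂ν ∂uniformAngle := by
  rw [B2, lintegral_map hF (by fun_prop), lintegral_prod _ (by fun_prop)]
  refine lintegral_congr fun θ => ?_
  rw [lintegral_prod _ (by fun_prop)]

instance (ν ν' : Measure ℝ) [IsProbabilityMeasure ν] [IsProbabilityMeasure ν'] :
    IsProbabilityMeasure (B2 ν ν') :=
  Measure.isProbabilityMeasure_map (by fun_prop)

instance (T : ℝ) : IsProbabilityMeasure (thermostat T) := by unfold thermostat; infer_instance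

instance (A t : ℝ) (ν : Measure ℝ) [IsProbabilityMeasure ν] :
    IsProbabilityMeasure (contractBy A t ν) :=
  Measure.isProbabilityMeasure_map (by fun_prop)

instance (A T t : ℝ) : IsProbabilityMeasure (B1 A T t) := by unfold B1; infer_instance

/-- The collision rule is linear, so it commutes with dilations; hence the rescaled equation has the
same collision operator. -/
lemma B2_map_mul (c : ℝ) (ν ν' : Measure ℝ) [SFinite ν] [SFinite ν'] :
    B2 (ν.map (fun v => c * v)) (ν'.map (fun v => c * v)) = (B2 ν ν').map (fun v => c * v) := by
  refine Measure.ext_of_lintegral _ fun F hF => ?_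
  rw [lintegral_B2 _ _ hF, lintegral_map hF (by fun_prop), lintegral_B2 _ _ (by fun_prop)]
  refine lintegral_congr fun θ => ?_
  rw [lintegral_map _ (by fun_prop)]
  · refine lintegral_congr fun v => ?_
    rw [lintegral_map (by fun_prop) (by fun_prop)]
    refine lintegral_congr fun w => ?_
    congr 1; ring
  · exact Measurable.lintegral_prod_right' (f := fun p : ℝ × ℝ =>
      F (p.1 * Real.cos θ + p.2 * Real.sin θ)) (by fun_prop)

lemma lintegral_B2_gaussianMixture {M : Measure ℝ} [SFinite M] (hM : ∀ᵐ s ∂M, 0 ≤ s)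
    {F : ℝ → ℝ≥0∞} (hF : Measurable F) :
    ∫⁻ x, F x ∂(B2 (gaussianMixture M) (gaussianMixture M)) =
      ∫⁻ θ, ∫⁻ a, ∫⁻ b, ∫⁻ x, F x
        ∂(gaussianReal 0 (Real.cos θ ^ 2 * a + Real.sin θ ^ 2 * b).toNNReal) ∂M ∂M
        ∂uniformAngle := by
  have : SFinite (gaussianMixture M) := by unfold gaussianMixture; infer_instance
  rw [lintegral_B2 _ _ hF]
  refine lintegral_congr fun θ => ?_
  rw [lintegral_gaussianMixture M hM (Measurable.lintegral_prod_right' (f := fun p : ℝ × ℝ =>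
      F (p.1 * Real.cos θ + p.2 * Real.sin θ)) (by fun_prop))]
  refine lintegral_congr_ae (hM.mono fun a ha => ?_)
  have h1 : ∀ x, ∫⁻ y, F (x * Real.cos θ + y * Real.sin θ) ∂(gaussianMixture M) =
      ∫⁻ b, ∫⁻ y, F (x * Real.cos θ + y * Real.sin θ) ∂(gaussianReal 0 b.toNNReal) ∂M :=
    fun x => lintegral_gaussianMixture M hM (by fun_prop)
  simp only [h1]
  rw [lintegral_lintegral_swap]
  · exact lintegral_congr_ae (hM.mono fun b hb => lintegral_gaussianReal_rotate ha hb θ hF)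
  · refine Measurable.aemeasurable ?_
    have h2 : Measurable fun p : ℝ × ℝ =>
        ∫⁻ y, F (p.1 * Real.cos θ + √p.2 * y * Real.sin θ) ∂(gaussianReal 0 1) :=
      Measurable.lintegral_prod_right' (f := fun q : (ℝ × ℝ) × ℝ =>
        F (q.1.1 * Real.cos θ + √q.1.2 * q.2 * Real.sin θ)) (by fun_prop)
    convert h2 using 1
    ext ⟨x, b⟩
    have := lintegral_gaussianReal_scale (√b) zero_le_one
      (F := fun y => F (x * Real.cos θ + y * Real.sin θ)) (by fun_prop)
    rw [Real.toNNReal_one, mul_one] at this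
    simp only [Function.uncurry]
    rw [this]
    congr 2
    rcases le_total 0 b with hs | hs
    · rw [Real.sq_sqrt hs]
    · rw [Real.sqrt_eq_zero_of_nonpos hs, Real.toNNReal_of_nonpos hs]; simp

/-- The equilibrium is the law of `e^{Au} Z` with `u` exponential and `Z` of the law of the gain
term. -/
lemma IsVarianceLaw.gaussianMixture_eq {lam mu E T : ℝ} {M : Measure ℝ}
    (hM : IsVarianceLaw lam mu E T M) (hpos : 0 < 2 * lam + mu) (hT : 0 < T) :
    gaussianMixture M = ENNReal.ofReal (2 * lam / (2 * lam + mu)) •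
      ((expLaw (2 * lam + mu)).prod (B2 (gaussianMixture M) (gaussianMixture M))).map
        (fun x => Real.exp (drift mu E T * x.1) * x.2) +
      ENNReal.ofReal (mu / (2 * lam + mu)) •
      ((expLaw (2 * lam + mu)).prod (thermostat T)).map
        (fun x => Real.exp (drift mu E T * x.1) * x.2) := by
  have := hM.prob
  have := isProbabilityMeasure_expLaw hpos
  refine Measure.ext_of_lintegral _ fun F hF => ?_
  set A := drift mu E T
  have hexp : ∀ u : ℝ, Real.exp (A * u) ^ 2 = Real.exp (2 * A * u) := fun u => by
    rw [← Real.exp_nat_mul]; ring_nf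
  rw [lintegral_gaussianMixture M hM.nonneg hF, hM.fixed _ (measurable_lintegral_gaussianReal hF),
    varianceStep, lintegral_add_measure, lintegral_smul_measure, lintegral_smul_measure,
    lintegral_map hF (by fun_prop), lintegral_map hF (by fun_prop),
    lintegral_prod _ (by fun_prop), lintegral_prod _ (by fun_prop)]
  simp only [smul_eq_mul]
  congr 2
  · refine lintegral_congr fun u => ?_
    rw [lintegral_B2_gaussianMixture hM.nonneg (by fun_prop)]
    refine lintegral_congr fun θ => lintegral_congr_ae (hM.nonneg.mono fun a ha =>
      lintegral_congr_ae (hM.nonneg.mono fun b hb => ?_))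
    dsimp only
    rw [lintegral_gaussianReal_scale _ (by positivity) hF, hexp]
  · refine lintegral_congr fun u => ?_
    rw [thermostat, lintegral_gaussianReal_scale _ hT.le hF, hexp]

/-! ### Stationarity of the equilibrium -/

lemma integrable_of_bounded {X : Type*} [MeasurableSpace X] {ν : Measure X} [IsFiniteMeasure ν]
    {φ : X → ℝ} (hφ : Measurable φ) {C : ℝ} (hC : ∀ v, |φ v| ≤ C) : Integrable φ ν :=
  Integrable.of_bound hφ.aestronglyMeasurable C (ae_of_all _ hC)

lemma abs_integral_le_of_bounded {X : Type*} [MeasurableSpace X] {ν : Measure X}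
    [IsProbabilityMeasure ν] {φ : X → ℝ} {C : ℝ} (hC : ∀ v, |φ v| ≤ C) : |∫ v, φ v ∂ν| ≤ C := by
  have := norm_integral_le_of_norm_le_const (μ := ν) (f := φ) (C := C) (ae_of_all _ hC)
  simpa using this

lemma integral_contractBy (A t : ℝ) (ν : Measure ℝ) {φ : ℝ → ℝ} (hφ : Measurable φ) :
    ∫ v, φ v ∂(contractBy A t ν) = ∫ v, φ (Real.exp (-A * t) * v) ∂ν :=
  integral_map (by fun_prop) hφ.aestronglyMeasurable

lemma B2_contractBy (A t : ℝ) (ν ν' : Measure ℝ) [SFinite ν] [SFinite ν'] :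
    B2 (contractBy A t ν) (contractBy A t ν') = contractBy A t (B2 ν ν') :=
  B2_map_mul _ _ _

lemma contractBy_zero (A : ℝ) (ν : Measure ℝ) : contractBy A 0 ν = ν := by
  simp [contractBy]

lemma measurable_integral_scale (A : ℝ) (Q : Measure ℝ) [SFinite Q] {φ : ℝ → ℝ}
    (hφ : Measurable φ) : Measurable fun r : ℝ => ∫ x, φ (Real.exp (A * r) * x) ∂Q := by
  have : StronglyMeasurable fun p : ℝ × ℝ => φ (Real.exp (A * p.1) * p.2) :=
    (hφ.comp (by fun_prop)).stronglyMeasurable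
  exact this.integral_prod_right.measurable

lemma integral_expLaw_prod_map {k : ℝ} (hk : 0 < k) (A t : ℝ) (Q : Measure ℝ)
    [IsProbabilityMeasure Q] {φ : ℝ → ℝ} (hφ : Measurable φ) {C : ℝ} (hC : ∀ v, |φ v| ≤ C) :
    ∫ v, φ (Real.exp (-A * t) * v) ∂(((expLaw k).prod Q).map fun x => Real.exp (A * x.1) * x.2) =
      ∫ u in Set.Ioi 0, k * Real.exp (-k * u) * ∫ x, φ (Real.exp (A * (u - t)) * x) ∂Q := by
  have := isProbabilityMeasure_expLaw hk
  rw [integral_map (by fun_prop) (Measurable.aestronglyMeasurable (by fun_prop)), integral_prod _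
    (integrable_of_bounded (by fun_prop) (fun v => hC _)), expLaw,
    integral_withDensity_eq_integral_toReal_smul (by fun_prop)
      (ae_of_all _ fun _ => ENNReal.ofReal_lt_top)]
  refine integral_congr_ae (ae_of_all _ fun u => ?_)
  dsimp only
  rw [ENNReal.toReal_ofReal (by positivity), smul_eq_mul]
  congr 1
  refine integral_congr_ae (ae_of_all _ fun x => ?_)
  dsimp only
  rw [← mul_assoc, ← Real.exp_add]
  ring_nf

/-- Translate by `t` and split at the origin: the piece over `(-t, 0]` becomes the time integral of
Duhamel's formula. -/
lemma integral_exp_shift {k : ℝ} (hk : 0 < k) {G : ℝ → ℝ} (hG : Measurable G) {C : ℝ}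
    (hC : ∀ v, |G v| ≤ C) {t : ℝ} (ht : 0 ≤ t) :
    ∫ u in Set.Ioi 0, Real.exp (-k * u) * G (u - t) =
      Real.exp (-k * t) * ((∫ u in Set.Ioi 0, Real.exp (-k * u) * G u) +
        ∫ s in (0 : ℝ)..t, Real.exp (k * s) * G (-s)) := by
  have hint : ∀ c : ℝ, IntegrableOn (fun u => Real.exp (-k * u) * G u) (Set.Ioi c) := fun c => by
    refine Integrable.mul_bdd (c := C) (integrableOn_exp_mul_Ioi (by linarith) c)
      hG.aestronglyMeasurable (ae_of_all _ hC)
  have h1 : ∫ u in Set.Ioi 0, Real.exp (-k * u) * G (u - t) =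
      Real.exp (-k * t) * ∫ x in Set.Ioi (-t), Real.exp (-k * x) * G x := by
    rw [← integral_const_mul]
    have h3 : ∀ u : ℝ, Real.exp (-k * u) * G (u - t) =
        (fun x => Real.exp (-k * t) * (Real.exp (-k * x) * G x)) (u - t) := fun u => by
      dsimp only
      rw [← mul_assoc, ← Real.exp_add]; ring_nf
    simp only [h3]
    have h4 : Set.Ioi (0 : ℝ) = (fun u => u - t) ⁻¹' Set.Ioi (-t) := by
      ext u; simp
    rw [h4]
    exact (measurePreserving_sub_right volume t).setIntegral_preimage_emb
      (MeasurableEquiv.subRight t).measurableEmbedding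
      (fun x => Real.exp (-k * t) * (Real.exp (-k * x) * G x)) (Set.Ioi (-t))
  rw [h1]
  congr 1
  have h5 : Set.Ioi (-t) = Set.Ioc (-t) 0 ∪ Set.Ioi 0 :=
    (Set.Ioc_union_Ioi_eq_Ioi (by linarith)).symm
  rw [h5, setIntegral_union (Set.Ioc_disjoint_Ioi le_rfl) measurableSet_Ioi
    ((hint (-t)).mono_set Set.Ioc_subset_Ioi_self) (hint 0), add_comm]
  congr 1
  rw [← intervalIntegral.integral_of_le (by linarith)]
  have h6 := intervalIntegral.integral_comp_neg (a := 0) (b := t)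
    (fun x => Real.exp (-k * x) * G x)
  rw [neg_zero] at h6
  rw [← h6]
  simp

/-- A fixed point of the gain semigroup solves the integrated equation. -/
lemma integral_eq_of_fixedPoint {k : ℝ} (hk : 0 < k) {G a : ℝ → ℝ} (hG : Measurable G) {C : ℝ}
    (hC : ∀ v, |G v| ≤ C)
    (ha : ∀ t, a t = ∫ u in Set.Ioi 0, Real.exp (-k * u) * G (u - t)) {t : ℝ} (ht : 0 ≤ t) :
    a t = a 0 + ∫ s in (0 : ℝ)..t, (G (-s) - k * a s) := by
  have hint : IntervalIntegrable (fun s => Real.exp (k * s) * G (-s)) volume 0 t := by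
    rw [intervalIntegrable_iff_integrableOn_Ioc_of_le ht]
    refine Integrable.mul_bdd (c := C) ?_ (hG.comp measurable_neg).aestronglyMeasurable
      (ae_of_all _ fun s => hC _)
    exact (Continuous.integrableOn_Icc (by fun_prop)).mono_set Set.Ioc_subset_Icc_self
  have ha0 : a 0 = ∫ u in Set.Ioi 0, Real.exp (-k * u) * G u := by simp [ha]
  have hat : ∀ s, 0 ≤ s → a s = Real.exp (-k * s) * (a 0 + ∫ r in (0 : ℝ)..s,
      Real.exp (k * r) * G (-r)) := fun s hs => by
    rw [ha s, integral_exp_shift hk hG hC hs, ha0]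
  have h := exp_mul_sub_eq_integral (-k) (a 0) hint (F := fun s => a 0 + ∫ r in (0 : ℝ)..s,
      Real.exp (k * r) * G (-r)) (fun s _ => rfl)
  rw [← hat t ht] at h
  rw [← sub_eq_iff_eq_add', h]
  refine intervalIntegral.integral_congr fun s hs => ?_
  rw [Set.uIcc_of_le ht] at hs
  rw [hat s hs.1, mul_add, ← mul_assoc, ← Real.exp_add]
  have : -k * s + k * s = 0 := by ring
  rw [this, Real.exp_zero]
  ring

section GainSemigroup

variable {lam mu E T : ℝ} {M : Measure ℝ}

lemma tvDist_le_of_forall {ν ν' : Measure ℝ} {c : ℝ}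
    (h : ∀ S, MeasurableSet S → |ν.real S - ν'.real S| ≤ c) : tvDist ν ν' ≤ ENNReal.ofReal c :=
  iSup₂_le fun S hS => ENNReal.ofReal_le_ofReal (h S hS)

/-- The collision and thermostat gain at the scale `e^{Ar}`. -/
noncomputable def gain (lam mu T A : ℝ) (ν : Measure ℝ) (φ : ℝ → ℝ) (r : ℝ) : ℝ :=
  2 * lam * ∫ x, φ (Real.exp (A * r) * x) ∂(B2 ν ν) +
    mu * ∫ x, φ (Real.exp (A * r) * x) ∂(thermostat T)

lemma measurable_gain (ν : Measure ℝ) [IsProbabilityMeasure ν] {A : ℝ} {φ : ℝ → ℝ}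
    (hφ : Measurable φ) : Measurable (gain lam mu T A ν φ) :=
  ((measurable_integral_scale A _ hφ).const_mul _).add
    ((measurable_integral_scale A _ hφ).const_mul _)

lemma abs_gain_le (hlam : 0 ≤ lam) (hmu : 0 ≤ mu) (ν : Measure ℝ) [IsProbabilityMeasure ν]
    {A : ℝ} {φ : ℝ → ℝ} {C : ℝ} (hC : ∀ v, |φ v| ≤ C) (r : ℝ) :
    |gain lam mu T A ν φ r| ≤ (2 * lam + mu) * C := by
  have h1 := abs_integral_le_of_bounded (ν := B2 ν ν) (φ := fun x => φ (Real.exp (A * r) * x))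
    (fun v => hC _)
  have h2 := abs_integral_le_of_bounded (ν := thermostat T) (φ := fun x => φ (Real.exp (A * r) * x))
    (fun v => hC _)
  refine (abs_add_le _ _).trans ?_
  rw [abs_mul (2 * lam), abs_mul mu, abs_of_nonneg (by positivity : 0 ≤ 2 * lam),
    abs_of_nonneg hmu, add_mul]
  gcongr

/-- The contraction by `e^{-At}` only shifts the clock, as `e^{-At} e^{Au} = e^{A(u - t)}`. This
puts the fixed-point equation into the form required by `integral_eq_of_fixedPoint`. -/
lemma IsVarianceLaw.integral_contract_eq (hM : IsVarianceLaw lam mu E T M)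
    (hlam : 0 ≤ lam) (hmu : 0 ≤ mu) (hpos : 0 < 2 * lam + mu) (hT : 0 < T) {φ : ℝ → ℝ}
    (hφ : Measurable φ) {C : ℝ} (hC : ∀ v, |φ v| ≤ C) (t : ℝ) :
    ∫ v, φ (Real.exp (-drift mu E T * t) * v) ∂(gaussianMixture M) =
      ∫ u in Set.Ioi 0, Real.exp (-(2 * lam + mu) * u) *
        gain lam mu T (drift mu E T) (gaussianMixture M) φ (u - t) := by
  have := hM.prob
  have := isProbabilityMeasure_expLaw hpos
  set A := drift mu E T
  set ν := gaussianMixture M with hν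
  have hfix : ν = _ := hM.gaussianMixture_eq hpos hT
  have hφ' : Measurable fun v => φ (Real.exp (-A * t) * v) := by fun_prop
  have hb : ∀ Q : Measure ℝ, IsProbabilityMeasure Q → Integrable
      (fun v => φ (Real.exp (-A * t) * v))
      (((expLaw (2 * lam + mu)).prod Q).map fun x => Real.exp (A * x.1) * x.2) := fun Q hQ => by
    have : IsProbabilityMeasure
      (((expLaw (2 * lam + mu)).prod Q).map fun x => Real.exp (A * x.1) * x.2) :=
      Measure.isProbabilityMeasure_map (by fun_prop)
    exact integrable_of_bounded hφ' (fun v => hC _)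
  have hG : ∀ Q : Measure ℝ, IsProbabilityMeasure Q → Integrable (fun u =>
      Real.exp (-(2 * lam + mu) * u) * ∫ x, φ (Real.exp (A * (u - t)) * x) ∂Q)
      (volume.restrict (Set.Ioi 0)) := fun Q hQ => by
    refine Integrable.mul_bdd (c := C) (integrableOn_exp_mul_Ioi (by linarith) 0) ?_
      (ae_of_all _ fun u => abs_integral_le_of_bounded fun v => hC _)
    exact ((measurable_integral_scale A Q hφ).comp
      (measurable_id.sub_const t)).aestronglyMeasurable
  conv_lhs => rw [hfix]
  rw [integral_add_measure ((hb _ inferInstance).smul_measure ENNReal.ofReal_ne_top)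
    ((hb _ inferInstance).smul_measure ENNReal.ofReal_ne_top), integral_smul_measure,
    integral_smul_measure, integral_expLaw_prod_map hpos A t _ hφ hC,
    integral_expLaw_prod_map hpos A t _ hφ hC, ENNReal.toReal_ofReal (by positivity),
    ENNReal.toReal_ofReal (by positivity), smul_eq_mul, smul_eq_mul]
  simp only [mul_assoc, integral_const_mul]
  have h1 : ∀ u, Real.exp (-((2 * lam + mu) * u)) * gain lam mu T A ν φ (u - t) =
      2 * lam * (Real.exp (-((2 * lam + mu) * u)) * ∫ x, φ (Real.exp (A * (u - t)) * x) ∂(B2 ν ν)) +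
      mu * (Real.exp (-((2 * lam + mu) * u)) *
        ∫ x, φ (Real.exp (A * (u - t)) * x) ∂(thermostat T)) := fun u => by
    rw [gain]; ring
  have h3 := hG (B2 ν ν) inferInstance
  have h4 := hG (thermostat T) inferInstance
  simp only [neg_mul] at h1 h3 h4 ⊢
  simp only [h1]
  rw [integral_add (h3.const_mul _) (h4.const_mul _), integral_const_mul, integral_const_mul,
    ← mul_assoc, ← mul_assoc]
  congr 2 <;> field_simp

/-- The weak equation comes from the fixed-point property. Continuity in total variation then comes
from the equation, whose integrand is bounded uniformly over test functions bounded by one. -/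
theorem IsVarianceLaw.isStationary (hM : IsVarianceLaw lam mu E T M)
    (hlam : 0 ≤ lam) (hmu : 0 ≤ mu) (hpos : 0 < 2 * lam + mu) (hT : 0 < T)
    (ν : ProbabilityMeasure ℝ) (hν : (ν : Measure ℝ) = gaussianMixture M) :
    IsStationary lam mu E T ν := by
  have := hM.prob
  set A := drift mu E T with hA
  have heq : ∀ t : ℝ, 0 ≤ t → ∀ φ : ℝ → ℝ, Measurable φ → ∀ C : ℝ, (∀ v, |φ v| ≤ C) →
      ∫ v, φ v ∂(contractBy A t ν) = ∫ v, φ v ∂(ν : Measure ℝ) +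
        ∫ s in (0 : ℝ)..t, (gain lam mu T A ν φ (-s) -
          (2 * lam + mu) * ∫ v, φ v ∂(contractBy A s ν)) := by
    intro t ht φ hφ C hC
    have := integral_eq_of_fixedPoint hpos (G := gain lam mu T A ν φ)
      (a := fun t => ∫ v, φ v ∂(contractBy A t ν)) (measurable_gain _ hφ)
      (abs_gain_le hlam hmu _ hC) (fun t => ?_) ht
    · rw [contractBy_zero] at this
      exact this
    · rw [integral_contractBy _ _ _ hφ, hν, hM.integral_contract_eq hlam hmu hpos hT hφ hC]
  refine ⟨fun t ht => ?_, fun t ht φ hφ ⟨C, hC⟩ => ?_⟩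
  -- Gain and loss contribute at most `2λ + μ` each for every indicator function, whence a Lipschitz
  -- constant independent of the set.
  · have hlip : ∀ s, 0 ≤ s → tvDist (contractBy A s ν) (contractBy A t ν) ≤
        ENNReal.ofReal (2 * (2 * lam + mu) * |s - t|) := by
      intro s hs
      refine tvDist_le_of_forall fun S hS => ?_
      set φ : ℝ → ℝ := S.indicator 1
      have hφ : Measurable φ := measurable_one.indicator hS
      have hC : ∀ v, |φ v| ≤ 1 := fun v => by
        by_cases hv : v ∈ S <;> simp [φ, hv]
      have h1 : ∀ ρ : Measure ℝ, ρ.real S = ∫ v, φ v ∂ρ := fun ρ =>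
        (integral_indicator_one hS).symm
      have hmeas : Measurable fun s => gain lam mu T A ν φ (-s) -
          (2 * lam + mu) * ∫ v, φ v ∂(contractBy A s ν) := by
        refine ((measurable_gain _ hφ).comp measurable_neg).sub (Measurable.const_mul ?_ _)
        have := (measurable_integral_scale (-A) (ν : Measure ℝ) hφ)
        simpa only [integral_contractBy _ _ _ hφ] using this
      have hbd : ∀ s, ‖gain lam mu T A ν φ (-s) -
          (2 * lam + mu) * ∫ v, φ v ∂(contractBy A s ν)‖ ≤ 2 * (2 * lam + mu) := fun s => by
        have h2 := abs_gain_le (T := T) (A := A) hlam hmu (ν : Measure ℝ) hC (-s)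
        have h3 := abs_integral_le_of_bounded (ν := contractBy A s ν) hC
        refine (norm_sub_le _ _).trans ?_
        rw [Real.norm_eq_abs, Real.norm_eq_abs, abs_mul, abs_of_pos hpos]
        nlinarith
      have hii : ∀ x y, IntervalIntegrable (fun s => gain lam mu T A ν φ (-s) -
          (2 * lam + mu) * ∫ v, φ v ∂(contractBy A s ν)) volume x y := fun x y => by
        rw [intervalIntegrable_iff]
        exact Measure.integrableOn_of_bounded (by simp) hmeas.aestronglyMeasurable
          (ae_of_all _ hbd)
      rw [h1, h1, heq s hs φ hφ 1 hC, heq t ht φ hφ 1 hC, add_sub_add_left_eq_sub,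
        intervalIntegral.integral_interval_sub_left (hii _ _) (hii _ _)]
      exact intervalIntegral.norm_integral_le_of_norm_le_const fun s _ => hbd s
    refine tendsto_of_tendsto_of_tendsto_of_le_of_le' tendsto_const_nhds ?_
      (Eventually.of_forall fun _ => zero_le)
      (eventually_mem_nhdsWithin.mono fun s hs => hlip s hs)
    have : Tendsto (fun s => 2 * (2 * lam + mu) * |s - t|) (𝓝[Set.Ici 0] t)
        (𝓝 (2 * (2 * lam + mu) * |t - t|)) :=
      (Continuous.tendsto (by fun_prop) t).mono_left nhdsWithin_le_nhds
    rw [sub_self, abs_zero, mul_zero] at this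
    simpa using ENNReal.tendsto_ofReal this
  · rw [heq t ht φ hφ C hC]
    congr 1
    refine intervalIntegral.integral_congr fun s _ => ?_
    rw [B2_contractBy, B1, integral_contractBy A s (B2 _ _) hφ, integral_contractBy A s _ hφ, gain]
    have : ∀ x : ℝ, Real.exp (A * -s) * x = Real.exp (-A * s) * x := fun x => by ring_nf
    simp only [this]
    rw [integral_contractBy A s _ hφ]
    ring

end GainSemigroup

/-! ### Weak solutions in mild form -/

section Mild

variable {lam mu E T : ℝ} {f : ℝ → ProbabilityMeasure ℝ}

lemma ofReal_abs_sub_le_tvDist (ν ν' : Measure ℝ) {S : Set ℝ} (hS : MeasurableSet S) :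
    ENNReal.ofReal |ν.real S - ν'.real S| ≤ tvDist ν ν' :=
  le_iSup₂ (f := fun (S : Set ℝ) (_ : MeasurableSet S) => ENNReal.ofReal |ν.real S - ν'.real S|) S hS

lemma IsWeakSolution.continuousOn_real (hf : IsWeakSolution lam mu E T f) {S : Set ℝ}
    (hS : MeasurableSet S) :
    ContinuousOn (fun s => (contractBy (drift mu E T) s (f s)).real S) (Set.Ici 0) := by
  intro t ht
  have h1 : Tendsto (fun s => ENNReal.ofReal |(contractBy (drift mu E T) s (f s)).real S -
      (contractBy (drift mu E T) t (f t)).real S|) (𝓝[Set.Ici 0] t) (𝓝 0) :=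
    tendsto_of_tendsto_of_tendsto_of_le_of_le tendsto_const_nhds (hf.continuous_tv t ht)
      (fun _ => zero_le) (fun s => ofReal_abs_sub_le_tvDist _ _ hS)
  have h2 := (ENNReal.tendsto_toReal ENNReal.zero_ne_top).comp h1
  simp only [Function.comp_def, ENNReal.toReal_ofReal (abs_nonneg _), ENNReal.toReal_zero] at h2
  have h3 := (tendsto_zero_iff_abs_tendsto_zero _).2 h2
  exact tendsto_sub_nhds_zero_iff.1 h3

/-- The curve `g_t`, extended to negative times by `g_0`. -/
noncomputable def rescaled (A : ℝ) (f : ℝ → ProbabilityMeasure ℝ) (s : ℝ) : Measure ℝ :=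
  contractBy A (max s 0) (f (max s 0))

instance (A : ℝ) (s : ℝ) : IsProbabilityMeasure (rescaled A f s) := by
  unfold rescaled; infer_instance

lemma rescaled_of_nonneg {A s : ℝ} (hs : 0 ≤ s) : rescaled A f s = contractBy A s (f s) := by
  rw [rescaled, max_eq_left hs]

/-- Continuity in total variation makes the mass of each Borel set continuous in time; the constant
extension to negative times removes the boundary. The curve is then a kernel, and iterated integrals
over time and velocity make sense. -/
lemma IsWeakSolution.measurable_rescaled (hf : IsWeakSolution lam mu E T f) :
    Measurable (rescaled (drift mu E T) f) := by
  refine Measure.measurable_of_measurable_coe _ fun S hS => ?_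
  have h1 : Continuous fun s : ℝ => (rescaled (drift mu E T) f s).real S :=
    (hf.continuousOn_real hS).comp_continuous (f := fun s : ℝ => max s 0) (by fun_prop)
      (fun s => Set.mem_Ici.2 (le_max_right s 0))
  have h2 : (fun s => rescaled (drift mu E T) f s S) =
      fun s => ENNReal.ofReal ((rescaled (drift mu E T) f s).real S) := by
    ext s; rw [ofReal_measureReal]
  rw [h2]
  exact ENNReal.measurable_ofReal.comp h1.measurable

/-- The rescaled curve as a Markov kernel from time to velocity. -/
noncomputable def IsWeakSolution.kernel (hf : IsWeakSolution lam mu E T f) : Kernel ℝ ℝ where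
  toFun := rescaled (drift mu E T) f
  measurable' := hf.measurable_rescaled

instance (hf : IsWeakSolution lam mu E T f) : IsMarkovKernel hf.kernel :=
  ⟨fun s => inferInstanceAs (IsProbabilityMeasure (rescaled (drift mu E T) f s))⟩

lemma IsWeakSolution.kernel_apply (hf : IsWeakSolution lam mu E T f) (s : ℝ) :
    hf.kernel s = rescaled (drift mu E T) f s := rfl

/-- The collision operator along a kernel. -/
noncomputable def collideKernel (P : Kernel ℝ ℝ) : Kernel ℝ ℝ :=
  ((Kernel.const ℝ uniformAngle) ×ₖ (P ×ₖ P)).map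
    (fun x => x.2.1 * Real.cos x.1 + x.2.2 * Real.sin x.1)

lemma collideKernel_apply (P : Kernel ℝ ℝ) [IsSFiniteKernel P] (s : ℝ) :
    collideKernel P s = B2 (P s) (P s) := by
  rw [collideKernel, Kernel.map_apply _ (by fun_prop), Kernel.prod_apply, Kernel.prod_apply,
    Kernel.const_apply, B2]

instance (P : Kernel ℝ ℝ) [IsMarkovKernel P] : IsMarkovKernel (collideKernel P) :=
  ⟨fun s => by rw [collideKernel_apply]; infer_instance⟩

/-- The thermostat gain `B₁` as a kernel. -/
noncomputable def thermostatKernel (A T : ℝ) : Kernel ℝ ℝ :=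
  (Kernel.id ×ₖ Kernel.const ℝ (thermostat T)).map (fun p => Real.exp (-A * p.1) * p.2)

lemma thermostatKernel_apply (A T s : ℝ) : thermostatKernel A T s = B1 A T s := by
  rw [thermostatKernel, Kernel.map_apply _ (by fun_prop), Kernel.prod_apply, Kernel.id_apply,
    Kernel.const_apply, Measure.dirac_prod, Measure.map_map (by fun_prop) (by fun_prop)]
  rfl

instance (A T : ℝ) : IsMarkovKernel (thermostatKernel A T) :=
  ⟨fun s => by rw [thermostatKernel_apply]; infer_instance⟩

lemma measurable_integral_kernel (P : Kernel ℝ ℝ) [IsSFiniteKernel P] {φ : ℝ → ℝ}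
    (hφ : Measurable φ) : Measurable fun s => ∫ v, φ v ∂(P s) :=
  (hφ.stronglyMeasurable.comp_measurable measurable_snd).integral_kernel_prod_right'.measurable

/-- The gain term of the rescaled equation, tested against `φ`. -/
noncomputable def IsWeakSolution.gainTerm (hf : IsWeakSolution lam mu E T f) (φ : ℝ → ℝ) (s : ℝ) :
    ℝ :=
  2 * lam * ∫ v, φ v ∂(collideKernel hf.kernel s) +
    mu * ∫ v, φ v ∂(thermostatKernel (drift mu E T) T s)

lemma IsWeakSolution.measurable_gainTerm (hf : IsWeakSolution lam mu E T f) {φ : ℝ → ℝ}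
    (hφ : Measurable φ) : Measurable (hf.gainTerm φ) :=
  ((measurable_integral_kernel _ hφ).const_mul _).add
    ((measurable_integral_kernel _ hφ).const_mul _)

/-- Duhamel's formula: the loss terms, of total rate `2λ + μ`, go into the integrating factor and
only the gain remains. -/
lemma IsWeakSolution.mild (hf : IsWeakSolution lam mu E T f) {φ : ℝ → ℝ} (hφ : Measurable φ)
    {C : ℝ} (hC : ∀ v, |φ v| ≤ C) {t : ℝ} (ht : 0 ≤ t) :
    Real.exp ((2 * lam + mu) * t) * ∫ v, φ v ∂(hf.kernel t) - ∫ v, φ v ∂(hf.kernel 0) =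
      ∫ s in (0 : ℝ)..t, Real.exp ((2 * lam + mu) * s) * hf.gainTerm φ s := by
  set F := fun s => ∫ v, φ v ∂(hf.kernel s) with hF
  have hFm : Measurable F := measurable_integral_kernel _ hφ
  have hFC : ∀ s, |F s| ≤ C := fun s => abs_integral_le_of_bounded hC
  have hGC : ∀ s, |hf.gainTerm φ s| ≤ |2 * lam| * C + |mu| * C := fun s => by
    refine (abs_add_le _ _).trans ?_
    rw [abs_mul (2 * lam), abs_mul mu]
    gcongr <;> exact abs_integral_le_of_bounded hC
  have hii : IntervalIntegrable (fun s => hf.gainTerm φ s - (2 * lam + mu) * F s) volume 0 t := by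
    rw [intervalIntegrable_iff]
    refine Measure.integrableOn_of_bounded (M := |2 * lam| * C + |mu| * C + |2 * lam + mu| * C)
      (by simp) ((hf.measurable_gainTerm hφ).sub (hFm.const_mul _)).aestronglyMeasurable
      (ae_of_all _ fun s => ?_)
    refine (norm_sub_le _ _).trans ?_
    rw [Real.norm_eq_abs, Real.norm_eq_abs, abs_mul (2 * lam + mu)]
    gcongr
    · exact hGC s
    · exact hFC s
  have hint : ∀ s, 0 ≤ s → F s = F 0 + ∫ r in (0 : ℝ)..s,
      (hf.gainTerm φ r - (2 * lam + mu) * F r) := by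
    intro s hs
    have h0 : F s = ∫ v, φ v ∂(contractBy (drift mu E T) s (f s)) := by
      simp only [hF, hf.kernel_apply, rescaled_of_nonneg hs]
    have h1 : F 0 = ∫ v, φ v ∂(f 0 : Measure ℝ) := by
      simp only [hF, hf.kernel_apply, rescaled_of_nonneg le_rfl, contractBy_zero]
    rw [h0, h1, hf.integral_eq s hs φ hφ ⟨C, hC⟩]
    congr 1
    refine intervalIntegral.integral_congr fun r hr => ?_
    rw [Set.uIcc_of_le hs] at hr
    simp only [hF, IsWeakSolution.gainTerm, collideKernel_apply, thermostatKernel_apply,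
      hf.kernel_apply, rescaled_of_nonneg hr.1]
    ring
  rw [exp_mul_sub_eq_integral (2 * lam + mu) (F 0) hii (F := F) (fun s hs => hint s (by
    rw [Set.uIcc_of_le ht] at hs; exact hs.1))]
  refine intervalIntegral.integral_congr fun s _ => ?_
  ring

/-- The weights `c e^{-k (t - s)} ds` on `(0, t]`. -/
noncomputable def timeKernel (k c : ℝ) : Kernel ℝ ℝ :=
  Kernel.withDensity (Kernel.const ℝ volume) (fun t s =>
    (Set.Ioc 0 t).indicator (fun s => ENNReal.ofReal (c * Real.exp (-k * (t - s)))) s)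

lemma measurable_timeKernel_density (k c : ℝ) : Measurable (Function.uncurry fun t s : ℝ =>
    (Set.Ioc 0 t).indicator (fun s => ENNReal.ofReal (c * Real.exp (-k * (t - s)))) s) := by
  have h : (Function.uncurry fun t s : ℝ =>
      (Set.Ioc 0 t).indicator (fun s => ENNReal.ofReal (c * Real.exp (-k * (t - s)))) s) =
      {p : ℝ × ℝ | 0 < p.2 ∧ p.2 ≤ p.1}.indicator
        (fun p => ENNReal.ofReal (c * Real.exp (-k * (p.1 - p.2)))) := by
    ext ⟨t, s⟩
    simp only [Function.uncurry, Set.indicator, Set.mem_Ioc, Set.mem_ofPred_eq]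
  rw [h]
  refine Measurable.indicator (by fun_prop) ?_
  exact (measurableSet_lt measurable_const measurable_snd).inter
    (measurableSet_le measurable_snd measurable_fst)

instance (k c : ℝ) : IsSFiniteKernel (timeKernel k c) := by
  refine Kernel.IsSFiniteKernel.withDensity _ fun t s => ?_
  by_cases h : s ∈ Set.Ioc 0 t <;> simp [h]

lemma lintegral_timeKernel (k c t : ℝ) {F : ℝ → ℝ≥0∞} (hF : Measurable F) :
    ∫⁻ s, F s ∂(timeKernel k c t) =
      ∫⁻ s in Set.Ioc 0 t, ENNReal.ofReal (c * Real.exp (-k * (t - s))) * F s := by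
  rw [timeKernel, Kernel.lintegral_withDensity _ (measurable_timeKernel_density k c) _ hF,
    Kernel.const_apply, ← lintegral_indicator measurableSet_Ioc]
  refine lintegral_congr fun s => ?_
  by_cases h : s ∈ Set.Ioc 0 t <;> simp [h]

/-- The same formula as an identity between nonnegative quantities, so that solutions can be
compared with partial couplings by monotonicity. -/
lemma IsWeakSolution.mild_measure (hf : IsWeakSolution lam mu E T f) (hlam : 0 ≤ lam)
    (hmu : 0 ≤ mu) {t : ℝ} (ht : 0 ≤ t) {S : Set ℝ} (hS : MeasurableSet S) :
    hf.kernel t S = ENNReal.ofReal (Real.exp (-(2 * lam + mu) * t)) * hf.kernel 0 S +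
      ∫⁻ s, collideKernel hf.kernel s S ∂(timeKernel (2 * lam + mu) (2 * lam) t) +
      ∫⁻ s, thermostatKernel (drift mu E T) T s S ∂(timeKernel (2 * lam + mu) mu t) := by
  set k := 2 * lam + mu with hk
  have hk0 : 0 ≤ k := by positivity
  set φ : ℝ → ℝ := S.indicator 1
  have hφ : Measurable φ := measurable_one.indicator hS
  have hC : ∀ v, |φ v| ≤ 1 := fun v => by
    by_cases hv : v ∈ S <;> simp [φ, hv]
  have h1 : ∀ ρ : Measure ℝ, ∫ v, φ v ∂ρ = ρ.real S := fun ρ => integral_indicator_one hS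
  have hm := hf.mild hφ hC ht
  simp only [IsWeakSolution.gainTerm, h1] at hm
  have hreal : (hf.kernel t).real S = Real.exp (-k * t) * (hf.kernel 0).real S +
      ∫ s in (0 : ℝ)..t, (2 * lam * Real.exp (-k * (t - s)) * (collideKernel hf.kernel s).real S +
        mu * Real.exp (-k * (t - s)) * (thermostatKernel (drift mu E T) T s).real S) := by
    have h2 : ∀ s, 2 * lam * Real.exp (-k * (t - s)) * (collideKernel hf.kernel s).real S +
        mu * Real.exp (-k * (t - s)) * (thermostatKernel (drift mu E T) T s).real S =
        Real.exp (-k * t) * (Real.exp (k * s) * (2 * lam * (collideKernel hf.kernel s).real S +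
          mu * (thermostatKernel (drift mu E T) T s).real S)) := fun s => by
      have : Real.exp (-k * (t - s)) = Real.exp (-k * t) * Real.exp (k * s) := by
        rw [← Real.exp_add]; ring_nf
      rw [this]; ring
    simp only [h2]
    rw [intervalIntegral.integral_const_mul, ← hm, mul_sub, ← mul_assoc, ← Real.exp_add]
    have : -k * t + k * t = 0 := by ring
    rw [this, Real.exp_zero]
    ring
  have hmc : Measurable fun s => (collideKernel hf.kernel s).real S :=
    (Kernel.measurable_coe _ hS).ennreal_toReal
  have hmt : Measurable fun s => (thermostatKernel (drift mu E T) T s).real S :=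
    (Kernel.measurable_coe _ hS).ennreal_toReal
  have hint : ∀ c : ℝ, ∀ P : Kernel ℝ ℝ, IsMarkovKernel P → (Measurable fun s => (P s).real S) →
      IntegrableOn (fun s => c * Real.exp (-k * (t - s)) * (P s).real S) (Set.Ioc 0 t) := by
    intro c P hP hPm
    refine Integrable.mul_bdd (c := 1) ?_ hPm.aestronglyMeasurable
      (ae_of_all _ fun s => by rw [Real.norm_eq_abs, abs_of_nonneg measureReal_nonneg]
                               exact measureReal_le_one)
    exact (Continuous.integrableOn_Icc (by fun_prop)).mono_set Set.Ioc_subset_Icc_self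
  have hterm : ∀ c : ℝ, 0 ≤ c → ∀ P : Kernel ℝ ℝ, IsMarkovKernel P →
      (Measurable fun s => (P s).real S) →
      ∫⁻ s, P s S ∂(timeKernel k c t) =
      ENNReal.ofReal (∫ s in Set.Ioc 0 t, c * Real.exp (-k * (t - s)) * (P s).real S) := by
    intro c hc P hP hPm
    rw [lintegral_timeKernel _ _ _ (Kernel.measurable_coe _ hS),
      ofReal_integral_eq_lintegral_ofReal (hint c P hP hPm) (ae_of_all _ fun s => by positivity)]
    refine lintegral_congr fun s => ?_
    rw [ENNReal.ofReal_mul (p := c * Real.exp (-k * (t - s))) (by positivity), ofReal_measureReal]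
  rw [intervalIntegral.integral_of_le ht, integral_add (hint _ _ inferInstance hmc)
    (hint _ _ inferInstance hmt)] at hreal
  rw [hterm _ (by positivity) _ inferInstance hmc, hterm _ hmu _ inferInstance hmt,
    ← ofReal_measureReal (μ := hf.kernel t), ← ofReal_measureReal (μ := hf.kernel 0), hreal,
    ← ENNReal.ofReal_mul (by positivity), ← ENNReal.ofReal_add (by positivity)
      (integral_nonneg fun s => by positivity), ← ENNReal.ofReal_add (add_nonneg (by positivity)
      (integral_nonneg fun s => by positivity)) (integral_nonneg fun s => by positivity), add_assoc]

end Mild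

/-! ### Suprema of increasing sequences of measures -/

/-- Countable additivity is an exchange of suprema. The bound for integrals is tested on simple
functions below `F`, for which the integral is a finite sum of increasing quantities. -/
lemma exists_measure_iSup {X : Type*} [MeasurableSpace X] {P : ℕ → Measure X} (hP : Monotone P) :
    ∃ Q : Measure X, (∀ S, MeasurableSet S → Q S = ⨆ n, P n S) ∧
      ∀ F : X → ℝ≥0∞, ∀ c, (∀ n, ∫⁻ x, F x ∂(P n) ≤ c) → ∫⁻ x, F x ∂Q ≤ c := by
  have hmono : ∀ S, Monotone fun n => P n S := fun S n m h => hP h S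
  set Q : Measure X := Measure.ofMeasurable (fun S _ => ⨆ n, P n S) (by simp) (by
    intro S hS hd
    have h1 : ∀ n, P n (⋃ i, S i) = ∑' i, P n (S i) := fun n => measure_iUnion hd hS
    simp only [h1, ENNReal.tsum_eq_iSup_sum]
    rw [iSup_comm]
    refine iSup_congr fun s => ?_
    rw [ENNReal.finsetSum_iSup_of_monotone fun i => hmono _]) with hQ
  have hQS : ∀ S, MeasurableSet S → Q S = ⨆ n, P n S := fun S hS =>
    Measure.ofMeasurable_apply S hS
  refine ⟨Q, hQS, fun F c hc => ?_⟩
  rw [lintegral]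
  refine iSup₂_le fun g hg => ?_
  rw [SimpleFunc.lintegral]
  have h2 : ∀ x, x * Q (g ⁻¹' {x}) = ⨆ n, x * P n (g ⁻¹' {x}) := fun x => by
    rw [hQS _ (g.measurableSet_preimage _), ENNReal.mul_iSup]
  simp only [h2]
  rw [ENNReal.finsetSum_iSup_of_monotone fun x n m h => by exact mul_le_mul_right (hmono (g ⁻¹' {x}) h) x]
  refine iSup_le fun n => le_trans ?_ (hc n)
  have h3 := SimpleFunc.lintegral_eq_lintegral g (P n)
  exact h3.symm.le.trans (lintegral_mono hg)

/-! ### Synchronous coupling of two weak solutions -/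

section Coupling

/-- The cross term `sin θ cos θ` averages to zero. Therefore a common angle in two coupled
collisions does not increase the mean squared distance. -/
lemma lintegral_uniformAngle_sq (x y : ℝ) :
    ∫⁻ θ, ENNReal.ofReal ((Real.cos θ * x + Real.sin θ * y) ^ 2) ∂uniformAngle =
      ENNReal.ofReal ((x ^ 2 + y ^ 2) / 2) := by
  rw [lintegral_uniformAngle_ofReal (by fun_prop) (fun θ => sq_nonneg _)]
  congr 1
  have h : ∀ θ : ℝ, (Real.cos θ * x + Real.sin θ * y) ^ 2 =
      x ^ 2 * Real.cos θ ^ 2 + y ^ 2 * Real.sin θ ^ 2 + 2 * x * y * (Real.sin θ * Real.cos θ) :=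
    fun θ => by ring
  simp only [h]
  rw [intervalIntegral.integral_add, intervalIntegral.integral_add,
    intervalIntegral.integral_const_mul, intervalIntegral.integral_const_mul,
    intervalIntegral.integral_const_mul, integral_cos_sq, integral_sin_sq, integral_sin_mul_cos₁]
  · simp only [Real.sin_two_pi, Real.cos_two_pi, Real.sin_zero, Real.cos_zero]
    field_simp
    ring
  all_goals exact Continuous.intervalIntegrable (by fun_prop) _ _

/-- Two colliding pairs with a common collision angle. -/
noncomputable def coupleKernel (P : Kernel ℝ (ℝ × ℝ)) : Kernel ℝ (ℝ × ℝ) :=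
  ((Kernel.const ℝ uniformAngle) ×ₖ (P ×ₖ P)).map
    (fun x => Real.cos x.1 • x.2.1 + Real.sin x.1 • x.2.2)

instance (P : Kernel ℝ (ℝ × ℝ)) [IsSFiniteKernel P] : IsSFiniteKernel (coupleKernel P) := by
  unfold coupleKernel; infer_instance

lemma lintegral_coupleKernel (P : Kernel ℝ (ℝ × ℝ)) [IsSFiniteKernel P] (s : ℝ)
    {F : ℝ × ℝ → ℝ≥0∞} (hF : Measurable F) :
    ∫⁻ x, F x ∂(coupleKernel P s) = ∫⁻ θ, ∫⁻ z, ∫⁻ w,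
      F (Real.cos θ • z + Real.sin θ • w) ∂(P s) ∂(P s) ∂uniformAngle := by
  rw [coupleKernel, Kernel.map_apply _ (by fun_prop), Kernel.prod_apply, Kernel.prod_apply,
    Kernel.const_apply, lintegral_map hF (by fun_prop), lintegral_prod _ (by fun_prop)]
  refine lintegral_congr fun θ => ?_
  rw [lintegral_prod _ (by fun_prop)]

lemma coupleKernel_mono {P Q : Kernel ℝ (ℝ × ℝ)} [IsSFiniteKernel P] [IsSFiniteKernel Q] {s : ℝ}
    (h : P s ≤ Q s) : coupleKernel P s ≤ coupleKernel Q s := by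
  refine Measure.le_iff.2 fun S hS => ?_
  rw [← lintegral_indicator_one hS, ← lintegral_indicator_one hS,
    lintegral_coupleKernel _ _ (measurable_one.indicator hS),
    lintegral_coupleKernel _ _ (measurable_one.indicator hS)]
  exact lintegral_mono fun θ => lintegral_mono' h fun z => lintegral_mono' h fun w => le_rfl

/-- `L` stands for either coordinate projection; being linear, it commutes with the collision rule.
-/
lemma coupleKernel_map_le {P : Kernel ℝ (ℝ × ℝ)} [IsSFiniteKernel P] {s : ℝ}
    (L : ℝ × ℝ →L[ℝ] ℝ) {ρ : Measure ℝ} [SFinite ρ] (h : (P s).map L ≤ ρ) :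
    (coupleKernel P s).map L ≤ B2 ρ ρ := by
  refine Measure.le_iff.2 fun S hS => ?_
  have hm : Measurable (S.indicator (1 : ℝ → ℝ≥0∞)) := measurable_one.indicator hS
  have hL : Measurable L := L.continuous.measurable
  have hmL : Measurable fun z => S.indicator (1 : ℝ → ℝ≥0∞) (L z) := hm.comp hL
  rw [← lintegral_indicator_one hS, ← lintegral_indicator_one hS, lintegral_map hm hL,
    lintegral_coupleKernel _ _ hmL, lintegral_B2 _ _ hm]
  refine lintegral_mono fun θ => ?_
  calc ∫⁻ z, ∫⁻ w, S.indicator 1 (L (Real.cos θ • z + Real.sin θ • w)) ∂(P s) ∂(P s)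
      = ∫⁻ v, ∫⁻ w, S.indicator 1 (v * Real.cos θ + w * Real.sin θ) ∂((P s).map L)
          ∂((P s).map L) := by
        rw [lintegral_map _ hL]
        · refine lintegral_congr fun z => ?_
          rw [lintegral_map (by fun_prop) hL]
          refine lintegral_congr fun w => ?_
          rw [map_add, map_smul, map_smul, smul_eq_mul, smul_eq_mul, mul_comm, mul_comm (L w)]
        · have hsf : SFinite ((P s).map L) := inferInstance
          exact Measurable.lintegral_prod_right' (f := fun p : ℝ × ℝ =>
            S.indicator (1 : ℝ → ℝ≥0∞) (p.1 * Real.cos θ + p.2 * Real.sin θ)) (by fun_prop)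
    _ ≤ _ := lintegral_mono' h fun v => lintegral_mono' h fun w => le_rfl

/-- Mass of the initial coupling that has not been hit by a collision up to time `t`. -/
noncomputable def initKernel (k : ℝ) (ρ : Measure (ℝ × ℝ)) [SFinite ρ] : Kernel ℝ (ℝ × ℝ) :=
  Kernel.withDensity (Kernel.const ℝ ρ) (fun t _ => ENNReal.ofReal (Real.exp (-k * t)))

lemma initKernel_apply (k : ℝ) (ρ : Measure (ℝ × ℝ)) [SFinite ρ] (t : ℝ) :
    initKernel k ρ t = ENNReal.ofReal (Real.exp (-k * t)) • ρ := by
  rw [initKernel, Kernel.withDensity_apply _ (by unfold Function.uncurry; fun_prop),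
    Kernel.const_apply, withDensity_const]

instance (k : ℝ) (ρ : Measure (ℝ × ℝ)) [SFinite ρ] : IsSFiniteKernel (initKernel k ρ) := by
  unfold initKernel
  exact Kernel.IsSFiniteKernel.withDensity _ fun _ _ => ENNReal.ofReal_ne_top

/-- The thermostat hits both components with the same velocity. -/
noncomputable def diagonalThermostat (A T : ℝ) : Kernel ℝ (ℝ × ℝ) :=
  (thermostatKernel A T).map (fun v => (v, v))

instance (A T : ℝ) : IsMarkovKernel (diagonalThermostat A T) := by
  unfold diagonalThermostat
  exact Kernel.IsMarkovKernel.map _ (by fun_prop)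

/-- The part of the synchronous coupling with collision trees of height less than `n`. -/
noncomputable def coupling (lam mu E T : ℝ) (ρ : Measure (ℝ × ℝ)) [SFinite ρ] :
    ℕ → Kernel ℝ (ℝ × ℝ)
  | 0 => 0
  | n + 1 => initKernel (2 * lam + mu) ρ +
      (coupleKernel (coupling lam mu E T ρ n)) ∘ₖ (timeKernel (2 * lam + mu) (2 * lam)) +
      (diagonalThermostat (drift mu E T) T) ∘ₖ (timeKernel (2 * lam + mu) mu)

variable {lam mu E T : ℝ} {ρ : Measure (ℝ × ℝ)} {f g : ℝ → ProbabilityMeasure ℝ}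

instance [SFinite ρ] (n : ℕ) : IsSFiniteKernel (coupling lam mu E T ρ n) := by
  induction n with
  | zero => unfold coupling; infer_instance
  | succ n ih => unfold coupling; infer_instance

lemma lintegral_coupling_succ [SFinite ρ] (n : ℕ) (t : ℝ) {F : ℝ × ℝ → ℝ≥0∞} (hF : Measurable F) :
    ∫⁻ x, F x ∂(coupling lam mu E T ρ (n + 1) t) =
      ENNReal.ofReal (Real.exp (-(2 * lam + mu) * t)) * ∫⁻ x, F x ∂ρ +
      ∫⁻ s, ∫⁻ x, F x ∂(coupleKernel (coupling lam mu E T ρ n) s)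
        ∂(timeKernel (2 * lam + mu) (2 * lam) t) +
      ∫⁻ s, ∫⁻ x, F x ∂(diagonalThermostat (drift mu E T) T s)
        ∂(timeKernel (2 * lam + mu) mu t) := by
  rw [coupling, add_apply, add_apply, lintegral_add_measure, lintegral_add_measure,
    Kernel.lintegral_comp _ _ _ hF, Kernel.lintegral_comp _ _ _ hF, initKernel_apply,
    lintegral_smul_measure, smul_eq_mul]

lemma ae_timeKernel_nonneg (k c t : ℝ) : ∀ᵐ s ∂(timeKernel k c t), 0 ≤ s ∧ s ≤ t := by
  have hS : MeasurableSet {s : ℝ | 0 ≤ s ∧ s ≤ t}ᶜ :=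
    (measurableSet_Icc (a := (0:ℝ)) (b := t)).compl
  have h : ∫⁻ s, ({s : ℝ | 0 ≤ s ∧ s ≤ t}ᶜ).indicator 1 s ∂(timeKernel k c t) = 0 := by
    rw [lintegral_timeKernel _ _ _ (measurable_one.indicator hS)]
    refine (setLIntegral_congr_fun measurableSet_Ioc fun s hs => ?_).trans lintegral_zero
    have : s ∉ {s : ℝ | 0 ≤ s ∧ s ≤ t}ᶜ := fun h => h ⟨hs.1.le, hs.2⟩
    simp [Set.indicator_of_notMem this]
  rw [lintegral_indicator_one hS] at h
  exact h

lemma coupling_monotone [SFinite ρ] (t : ℝ) : Monotone fun n => coupling lam mu E T ρ n t := by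
  refine monotone_nat_of_le_succ fun n => ?_
  induction n generalizing t with
  | zero => simp only [coupling, zero_apply]; exact Measure.zero_le _
  | succ n ih =>
    refine Measure.le_iff.2 fun S hS => ?_
    rw [← lintegral_indicator_one hS, ← lintegral_indicator_one hS,
      lintegral_coupling_succ _ _ (measurable_one.indicator hS),
      lintegral_coupling_succ _ _ (measurable_one.indicator hS)]
    gcongr with s
    exact coupleKernel_mono (ih s)

/-- Induction over the height of the trees: the recursion for the coupling projects to the mild form
of the equation, with the solution replaced by something smaller in the collision term. Thus any
weak solution with the right initial datum dominates the marginal. -/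
lemma coupling_map_le [SFinite ρ] (hlam : 0 ≤ lam) (hmu : 0 ≤ mu)
    (hf : IsWeakSolution lam mu E T f) (L : ℝ × ℝ →L[ℝ] ℝ) (hL : ∀ v, L (v, v) = v)
    (hρ : ρ.map L = f 0) (n : ℕ) {t : ℝ} (ht : 0 ≤ t) :
    (coupling lam mu E T ρ n t).map L ≤ hf.kernel t := by
  have hLm : Measurable L := L.continuous.measurable
  induction n generalizing t with
  | zero => simp only [coupling, zero_apply, Measure.map_zero]; exact Measure.zero_le _
  | succ n ih =>
    refine Measure.le_iff.2 fun S hS => ?_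
    have hm : Measurable (S.indicator (1 : ℝ → ℝ≥0∞)) := measurable_one.indicator hS
    have hmL : Measurable fun z => S.indicator (1 : ℝ → ℝ≥0∞) (L z) := hm.comp hLm
    rw [hf.mild_measure hlam hmu ht hS, ← lintegral_indicator_one hS, lintegral_map hm hLm,
      lintegral_coupling_succ _ _ hmL]
    refine add_le_add (add_le_add (le_of_eq ?_) (lintegral_mono_ae ?_)) (le_of_eq ?_)
    · rw [← lintegral_map hm hLm, hρ, lintegral_indicator_one hS, hf.kernel_apply,
        rescaled_of_nonneg le_rfl, contractBy_zero]
    · filter_upwards [ae_timeKernel_nonneg (2 * lam + mu) (2 * lam) t] with s hs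
      rw [← lintegral_map hm hLm, lintegral_indicator_one hS, collideKernel_apply]
      exact coupleKernel_map_le L (ih hs.1) S
    · refine lintegral_congr fun s => ?_
      rw [diagonalThermostat, Kernel.map_apply _ (by fun_prop), lintegral_map hmL
        (by fun_prop)]
      simp only [hL]
      rw [lintegral_indicator_one hS]

lemma coupling_univ_le [SFinite ρ] (hlam : 0 ≤ lam) (hmu : 0 ≤ mu)
    (hf : IsWeakSolution lam mu E T f) (hρ : ρ.map Prod.fst = f 0) (n : ℕ) {t : ℝ} (ht : 0 ≤ t) :
    coupling lam mu E T ρ n t Set.univ ≤ 1 := by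
  have h := coupling_map_le hlam hmu hf (ContinuousLinearMap.fst ℝ ℝ ℝ) (fun v => rfl) hρ n ht
    Set.univ
  rwa [Measure.map_apply (ContinuousLinearMap.continuous _).measurable .univ, Set.preimage_univ,
    measure_univ (μ := hf.kernel t)] at h

/-- A pair of incoming particles at most doubles the missing mass. -/
lemma one_le_sq_add {m d : ℝ≥0∞} (h : 1 ≤ m + d) : 1 ≤ m * m + 2 * d := by
  rcases le_total 1 m with hm | hm
  · exact (one_le_mul_of_one_le_of_one_le hm hm).trans le_self_add
  · have h1 : m ≤ m * m + d := calc
      m = m * 1 := (mul_one m).symm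
      _ ≤ m * (m + d) := by gcongr
      _ = m * m + m * d := mul_add _ _ _
      _ ≤ m * m + 1 * d := by gcongr
      _ = m * m + d := by rw [one_mul]
    calc 1 ≤ m + d := h
      _ ≤ (m * m + d) + d := by gcongr
      _ = m * m + 2 * d := by rw [add_assoc, two_mul]

/-- Collisions occur at rate `2λ` and double the missing mass, so the defect satisfies `d_{n+1}(t) ≤
∫₀ᵗ 4λ d_n(s) ds`. It tends to zero: no mass is lost to infinite trees. -/
lemma one_le_coupling_univ_add [SFinite ρ] (hlam : 0 ≤ lam) (hmu : 0 ≤ mu)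
    (hf : IsWeakSolution lam mu E T f) (hρ : ρ Set.univ = 1) (n : ℕ) {t : ℝ} (ht : 0 ≤ t) :
    1 ≤ coupling lam mu E T ρ n t Set.univ + ENNReal.ofReal ((4 * lam * t) ^ n / n.factorial) := by
  induction n generalizing t with
  | zero => simp
  | succ n ih =>
    have hmild := hf.mild_measure hlam hmu ht .univ
    simp only [measure_univ, mul_one] at hmild
    have hcm : Measurable fun s : ℝ => ENNReal.ofReal ((4 * lam * s) ^ n / n.factorial) := by
      fun_prop
    have hc := lintegral_coupling_succ (lam := lam) (mu := mu) (E := E) (T := T) (ρ := ρ) n t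
      (F := fun _ => 1) measurable_const
    simp only [lintegral_const, one_mul, measure_univ, mul_one, hρ] at hc
    rw [hc, hmild]
    have h1 : (∫⁻ _, 1 ∂(timeKernel (2 * lam + mu) (2 * lam) t)) ≤
        ∫⁻ s, (coupleKernel (coupling lam mu E T ρ n) s Set.univ +
          2 * ENNReal.ofReal ((4 * lam * s) ^ n / n.factorial))
          ∂(timeKernel (2 * lam + mu) (2 * lam) t) := by
      refine lintegral_mono_ae ?_
      filter_upwards [ae_timeKernel_nonneg (2 * lam + mu) (2 * lam) t] with s hs
      have h2 := lintegral_coupleKernel (coupling lam mu E T ρ n) s (F := fun _ => 1)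
        measurable_const
      simp only [lintegral_const, one_mul, measure_univ, mul_one] at h2
      rw [h2]
      exact one_le_sq_add (ih hs.1)
    rw [lintegral_add_right _ (by fun_prop)] at h1
    have h3 : ∫⁻ s, 2 * ENNReal.ofReal ((4 * lam * s) ^ n / n.factorial)
        ∂(timeKernel (2 * lam + mu) (2 * lam) t) ≤
        ENNReal.ofReal ((4 * lam * t) ^ (n + 1) / (n + 1).factorial) := by
      rw [lintegral_timeKernel _ _ _ (by fun_prop)]
      have h4 : ∫ s in (0 : ℝ)..t, 4 * lam * ((4 * lam * s) ^ n / n.factorial) =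
          (4 * lam * t) ^ (n + 1) / (n + 1).factorial := by
        have : ∀ s, 4 * lam * ((4 * lam * s) ^ n / n.factorial) =
            (4 * lam) ^ (n + 1) / n.factorial * s ^ n := fun s => by
          rw [mul_pow, pow_succ]; ring
        simp only [this]
        rw [intervalIntegral.integral_const_mul, integral_pow, Nat.factorial_succ, mul_pow]
        push_cast
        have := Nat.factorial_pos n
        field_simp
        rw [zero_pow (Nat.succ_ne_zero n), sub_zero]
        ring
      rw [← h4, intervalIntegral.integral_of_le ht, ofReal_integral_eq_lintegral_ofReal]
      · refine lintegral_mono_ae ?_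
        filter_upwards [ae_restrict_mem measurableSet_Ioc] with s hs
        have h5 : Real.exp (-(2 * lam + mu) * (t - s)) ≤ 1 := by
          rw [Real.exp_le_one_iff]
          nlinarith [hs.1, hs.2]
        have h6 : 0 ≤ (4 * lam * s) ^ n / n.factorial := by
          have := hs.1.le
          positivity
        rw [← ENNReal.ofReal_ofNat, ← ENNReal.ofReal_mul (by norm_num),
          ← ENNReal.ofReal_mul (by positivity)]
        refine ENNReal.ofReal_le_ofReal ?_
        calc 2 * lam * Real.exp (-(2 * lam + mu) * (t - s)) *
              (2 * ((4 * lam * s) ^ n / n.factorial))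
            ≤ 2 * lam * 1 * (2 * ((4 * lam * s) ^ n / n.factorial)) := by gcongr
          _ = _ := by ring
      · exact (Continuous.integrableOn_Icc (by fun_prop)).mono_set Set.Ioc_subset_Icc_self
      · filter_upwards [ae_restrict_mem measurableSet_Ioc] with s hs
        have := hs.1.le
        simp only [Pi.zero_apply]
        positivity
    simp only [lintegral_const, one_mul] at h1 ⊢
    calc _ ≤ ENNReal.ofReal (Real.exp (-(2 * lam + mu) * t)) +
          (∫⁻ s, coupleKernel (coupling lam mu E T ρ n) s Set.univ
            ∂(timeKernel (2 * lam + mu) (2 * lam) t) +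
            ENNReal.ofReal ((4 * lam * t) ^ (n + 1) / (n + 1).factorial)) +
          timeKernel (2 * lam + mu) mu t Set.univ := by
          gcongr
          exact h1.trans (by gcongr)
      _ = _ := by ring

/-- The squared distance of the two components. -/
noncomputable def gap (z : ℝ × ℝ) : ℝ≥0∞ := ENNReal.ofReal ((z.1 - z.2) ^ 2)

lemma measurable_gap : Measurable gap := by unfold gap; fun_prop

/-- Each of the two incoming pairs contributes half of its squared gap. The factor `P s Set.univ` is
the mass of the other one, since the partial couplings need not be probability measures. -/
lemma lintegral_gap_coupleKernel (P : Kernel ℝ (ℝ × ℝ)) [IsSFiniteKernel P] (s : ℝ) :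
    ∫⁻ x, gap x ∂(coupleKernel P s) = P s Set.univ * ∫⁻ x, gap x ∂(P s) := by
  rw [lintegral_coupleKernel P s measurable_gap, lintegral_lintegral_swap]
  · have h1 : ∀ z : ℝ × ℝ, ∫⁻ θ, ∫⁻ w, gap (Real.cos θ • z + Real.sin θ • w) ∂(P s)
        ∂uniformAngle = ∫⁻ w, (gap z / 2 + gap w / 2) ∂(P s) := fun z => by
      rw [lintegral_lintegral_swap]
      · refine lintegral_congr fun w => ?_
        have h2 := lintegral_uniformAngle_sq (z.1 - z.2) (w.1 - w.2)
        rw [add_div, ENNReal.ofReal_add (by positivity) (by positivity),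
          ENNReal.ofReal_div_of_pos two_pos, ENNReal.ofReal_div_of_pos two_pos,
          ENNReal.ofReal_ofNat] at h2
        rw [gap, gap, ← h2]
        refine lintegral_congr fun θ => ?_
        simp only [gap, Prod.fst_add, Prod.snd_add, Prod.smul_fst, Prod.smul_snd, smul_eq_mul]
        congr 2
        ring
      · exact (measurable_gap.comp (by fun_prop)).aemeasurable
    simp only [h1]
    have hm := measurable_gap
    have h2 : ∀ z, ∫⁻ w, (gap z / 2 + gap w / 2) ∂(P s) =
        gap z / 2 * P s Set.univ + (∫⁻ w, gap w ∂(P s)) / 2 := fun z => by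
      rw [lintegral_add_left measurable_const, lintegral_const]
      simp only [div_eq_mul_inv]
      rw [lintegral_mul_const _ hm]
    simp only [h2]
    rw [lintegral_add_right _ measurable_const, lintegral_const]
    simp only [div_eq_mul_inv]
    rw [lintegral_mul_const _ (by fun_prop), lintegral_mul_const _ hm]
    set I := ∫⁻ w, gap w ∂(P s)
    set m := P s Set.univ
    calc I * 2⁻¹ * m + I * 2⁻¹ * m = m * I * (2⁻¹ + 2⁻¹) := by ring
      _ = m * I := by rw [ENNReal.inv_two_add_inv_two, mul_one]
  · refine Measurable.aemeasurable ?_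
    exact Measurable.lintegral_prod_right' (f := fun p : (ℝ × (ℝ × ℝ)) × (ℝ × ℝ) =>
      gap (Real.cos p.1.1 • p.1.2 + Real.sin p.1.1 • p.2)) (measurable_gap.comp (by fun_prop))

/-- Collisions do not increase the squared gap, because the mass is at most one, and thermostat
events set it to zero. The function `e^{-μt}` is the exact solution of the resulting renewal
inequality. -/
lemma lintegral_gap_coupling_le [SFinite ρ] (hlam : 0 ≤ lam) (hmu : 0 ≤ mu)
    (hf : IsWeakSolution lam mu E T f) (hρ : ρ.map Prod.fst = f 0) (n : ℕ) {t : ℝ} (ht : 0 ≤ t) :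
    ∫⁻ x, gap x ∂(coupling lam mu E T ρ n t) ≤
      ENNReal.ofReal (Real.exp (-mu * t)) * ∫⁻ x, gap x ∂ρ := by
  induction n generalizing t with
  | zero => simp [coupling]
  | succ n ih =>
    set D := ∫⁻ x, gap x ∂ρ
    have hd : ∀ s, ∫⁻ x, gap x ∂(diagonalThermostat (drift mu E T) T s) = 0 := fun s => by
      rw [diagonalThermostat, Kernel.map_apply _ (by fun_prop), lintegral_map measurable_gap
        (by fun_prop)]
      simp [gap]
    rw [lintegral_coupling_succ _ _ measurable_gap]
    simp only [hd, lintegral_zero, add_zero]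
    have h1 : ∫⁻ s, ∫⁻ x, gap x ∂(coupleKernel (coupling lam mu E T ρ n) s)
        ∂(timeKernel (2 * lam + mu) (2 * lam) t) ≤
        ∫⁻ s, ENNReal.ofReal (Real.exp (-mu * s)) * D
          ∂(timeKernel (2 * lam + mu) (2 * lam) t) := by
      refine lintegral_mono_ae ?_
      filter_upwards [ae_timeKernel_nonneg (2 * lam + mu) (2 * lam) t] with s hs
      rw [lintegral_gap_coupleKernel]
      exact (mul_le_mul' (coupling_univ_le hlam hmu hf hρ n hs.1) (ih hs.1)).trans (one_mul _).le
    -- Collision contribution; with the uncollided weight `e^{-(2λ+μ)t}` it adds up to `e^{-μt}`.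
    have h2 : ∫⁻ s, ENNReal.ofReal (Real.exp (-mu * s))
          ∂(timeKernel (2 * lam + mu) (2 * lam) t) =
        ENNReal.ofReal (Real.exp (-mu * t) - Real.exp (-(2 * lam + mu) * t)) := by
      rw [lintegral_timeKernel _ _ _ (by fun_prop)]
      have h4 : ∫ s in (0 : ℝ)..t, 2 * lam * Real.exp (-(2 * lam + mu) * (t - s)) *
          Real.exp (-mu * s) = Real.exp (-mu * t) - Real.exp (-(2 * lam + mu) * t) := by
        have h5 : ∀ s ∈ Set.uIcc 0 t, HasDerivAt
            (fun s => Real.exp (-(2 * lam + mu) * t + 2 * lam * s))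
            (2 * lam * Real.exp (-(2 * lam + mu) * (t - s)) * Real.exp (-mu * s)) s := by
          intro s _
          have h6 : HasDerivAt (fun s => -(2 * lam + mu) * t + 2 * lam * s) (2 * lam) s := by
            simpa using ((hasDerivAt_id s).const_mul (2 * lam)).const_add (-(2 * lam + mu) * t)
          convert h6.exp using 1
          rw [mul_assoc, ← Real.exp_add, mul_comm]
          congr 2; ring
        rw [intervalIntegral.integral_eq_sub_of_hasDerivAt h5
          (Continuous.intervalIntegrable (by fun_prop) _ _)]
        ring_nf
      rw [← h4, intervalIntegral.integral_of_le ht, ofReal_integral_eq_lintegral_ofReal]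
      · refine lintegral_congr fun s => ?_
        rw [ENNReal.ofReal_mul (p := 2 * lam * Real.exp (-(2 * lam + mu) * (t - s)))
          (by positivity)]
      · exact (Continuous.integrableOn_Icc (by fun_prop)).mono_set Set.Ioc_subset_Icc_self
      · exact ae_of_all _ fun s => by simp only [Pi.zero_apply]; positivity
    rw [lintegral_mul_const _ (by fun_prop), h2] at h1
    calc _ ≤ ENNReal.ofReal (Real.exp (-(2 * lam + mu) * t)) * D +
        ENNReal.ofReal (Real.exp (-mu * t) - Real.exp (-(2 * lam + mu) * t)) * D := by gcongr
      _ = ENNReal.ofReal (Real.exp (-mu * t)) * D := by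
        rw [← add_mul, ← ENNReal.ofReal_add (by positivity) (by
          rw [sub_nonneg, Real.exp_le_exp]; nlinarith [mul_nonneg hlam ht])]
        congr 2; ring

/-- The synchronous coupling of two weak solutions. -/
lemma exists_coupling (hlam : 0 ≤ lam) (hmu : 0 ≤ mu)
    (hf : IsWeakSolution lam mu E T f) (hg : IsWeakSolution lam mu E T g)
    (hρf : ρ.map Prod.fst = f 0) (hρg : ρ.map Prod.snd = g 0) {t : ℝ} (ht : 0 ≤ t) :
    ∃ Q, IsCoupling Q (hf.kernel t) (hg.kernel t) ∧
      ∫⁻ x, gap x ∂Q ≤ ENNReal.ofReal (Real.exp (-mu * t)) * ∫⁻ x, gap x ∂ρ := by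
  have hρ1 : ρ Set.univ = 1 := by
    have : (ρ.map Prod.fst) Set.univ = 1 := by rw [hρf]; exact measure_univ
    rwa [Measure.map_apply measurable_fst .univ, Set.preimage_univ] at this
  have : IsProbabilityMeasure ρ := ⟨hρ1⟩
  obtain ⟨Q, hQ, hQF⟩ := exists_measure_iSup (coupling_monotone (lam := lam) (mu := mu) (E := E)
    (T := T) (ρ := ρ) t)
  have hQ1 : 1 ≤ Q Set.univ := by
    have hlim : Tendsto (fun n : ℕ => Q Set.univ +
        ENNReal.ofReal ((4 * lam * t) ^ n / n.factorial)) atTop (𝓝 (Q Set.univ + ENNReal.ofReal 0)) :=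
      tendsto_const_nhds.add (ENNReal.tendsto_ofReal
        (FloorSemiring.tendsto_pow_div_factorial_atTop _))
    rw [ENNReal.ofReal_zero, add_zero] at hlim
    refine ge_of_tendsto' hlim fun n => (one_le_coupling_univ_add hlam hmu hf hρ1 n ht).trans ?_
    refine add_le_add_left ?_ _
    rw [hQ _ .univ]
    exact le_iSup (fun n => coupling lam mu E T ρ n t Set.univ) n
  have key : ∀ {u : ℝ → ProbabilityMeasure ℝ} (hu : IsWeakSolution lam mu E T u)
      (L : ℝ × ℝ →L[ℝ] ℝ), (∀ v, L (v, v) = v) → ρ.map L = u 0 → Q.map L = hu.kernel t := by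
    intro u hu L hL hLu
    have hLm : Measurable L := L.continuous.measurable
    have hle : Q.map L ≤ hu.kernel t := by
      refine Measure.le_iff.2 fun S hS => ?_
      rw [Measure.map_apply hLm hS, hQ _ (hLm hS)]
      refine iSup_le fun n => ?_
      rw [← Measure.map_apply hLm hS]
      exact coupling_map_le hlam hmu hu L hL hLu n ht S
    have hfin : IsFiniteMeasure (Q.map L) := ⟨(hle _).trans_lt (measure_lt_top _ _)⟩
    -- The marginal is dominated by a probability measure and has full mass, hence equals it.
    refine Measure.eq_of_le_of_measure_univ_eq hle (le_antisymm (hle _) ?_)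
    rw [Measure.map_apply hLm .univ, Set.preimage_univ, measure_univ (μ := hu.kernel t)]
    exact hQ1
  refine ⟨Q, ⟨key hf (ContinuousLinearMap.fst ℝ ℝ ℝ) (fun v => rfl) hρf,
    key hg (ContinuousLinearMap.snd ℝ ℝ ℝ) (fun v => rfl) hρg⟩, hQF _ _ fun n =>
    lintegral_gap_coupling_le hlam hmu hf hρf n ht⟩

end Coupling

/-! ### Contraction in the Wasserstein distance -/

section Contraction

variable {lam mu E T : ℝ} {f g : ℝ → ProbabilityMeasure ℝ}

/-- Undoing the rescaling multiplies the squared gap by `e^{2At}`, and `2A - μ = -μT/E`. -/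
lemma exists_coupling_of_isCoupling (hlam : 0 ≤ lam) (hmu : 0 ≤ mu) (hE : 0 < E)
    (hf : IsWeakSolution lam mu E T f) (hg : IsWeakSolution lam mu E T g) {ρ : Measure (ℝ × ℝ)}
    (hρ : IsCoupling ρ (f 0) (g 0)) {t : ℝ} (ht : 0 ≤ t) :
    ∃ Q, IsCoupling Q (f t) (g t) ∧
      ∫⁻ x, gap x ∂Q ≤ ENNReal.ofReal (Real.exp (-(mu * T / E) * t)) * ∫⁻ x, gap x ∂ρ := by
  obtain ⟨Q, hQ, hcost⟩ := exists_coupling hlam hmu hf hg hρ.1 hρ.2 ht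
  set A := drift mu E T with hA
  set e := Real.exp (A * t) with he
  have hback : ∀ ν : Measure ℝ, (contractBy A t ν).map (fun v => e * v) = ν := fun ν => by
    rw [contractBy, Measure.map_map (by fun_prop) (by fun_prop)]
    have : (fun v => e * v) ∘ (fun v => Real.exp (-A * t) * v) = id := by
      ext v
      simp only [Function.comp_apply, ← mul_assoc, he, ← Real.exp_add, id]
      rw [neg_mul, add_neg_cancel, Real.exp_zero, one_mul]
    rw [this, Measure.map_id]
  refine ⟨Q.map fun z => (e * z.1, e * z.2), ⟨?_, ?_⟩, ?_⟩
  · rw [Measure.map_map (by fun_prop) (by fun_prop), ← hback (f t), ← rescaled_of_nonneg ht,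
      ← hf.kernel_apply, ← hQ.1, Measure.map_map (by fun_prop) (by fun_prop)]
    rfl
  · rw [Measure.map_map (by fun_prop) (by fun_prop), ← hback (g t), ← rescaled_of_nonneg ht,
      ← hg.kernel_apply, ← hQ.2, Measure.map_map (by fun_prop) (by fun_prop)]
    rfl
  · rw [lintegral_map measurable_gap (by fun_prop)]
    have h1 : ∀ z : ℝ × ℝ, gap (e * z.1, e * z.2) = ENNReal.ofReal (e ^ 2) * gap z := fun z => by
      simp only [gap]
      rw [← ENNReal.ofReal_mul (by positivity)]
      congr 1; ring
    simp only [h1]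
    rw [lintegral_const_mul _ measurable_gap]
    calc _ ≤ ENNReal.ofReal (e ^ 2) * (ENNReal.ofReal (Real.exp (-mu * t)) * ∫⁻ x, gap x ∂ρ) := by
          gcongr
      _ = _ := by
          rw [← mul_assoc, ← ENNReal.ofReal_mul (by positivity), he, ← Real.exp_nat_mul,
            ← Real.exp_add]
          congr 3
          rw [hA, drift]
          field_simp
          push_cast
          ring

theorem IsWeakSolution.W2_le (hlam : 0 ≤ lam) (hmu : 0 ≤ mu) (hE : 0 < E)
    (hf : IsWeakSolution lam mu E T f) (hg : IsWeakSolution lam mu E T g) {t : ℝ} (ht : 0 ≤ t) :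
    W2 (f t) (g t) ≤ W2 (f 0) (g 0) * ENNReal.ofReal (Real.exp (-(mu * T / (2 * E)) * t)) := by
  have hgap : ∀ Q : Measure (ℝ × ℝ), ∫⁻ z, ENNReal.ofReal (|z.1 - z.2| ^ 2) ∂Q =
      ∫⁻ z, gap z ∂Q := fun Q => by simp only [sq_abs, gap]
  set c := ENNReal.ofReal (Real.exp (-(mu * T / E) * t)) with hc
  -- A nonzero finite constant may be moved inside an infimum in `[0, ∞]`, so the case of infinite
  -- distance needs no separate treatment.
  have hc0 : c ≠ 0 := by
    rw [hc, Ne, ENNReal.ofReal_eq_zero, not_le]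
    positivity
  have hc2 : ENNReal.ofReal (Real.exp (-(mu * T / (2 * E)) * t)) = c ^ (1 / 2 : ℝ) := by
    rw [hc, ENNReal.ofReal_rpow_of_pos (by positivity), ← Real.exp_mul]
    congr 2
    field_simp
  rw [hc2, mul_comm, W2, W2, ← ENNReal.mul_rpow_of_nonneg _ _ (by norm_num)]
  refine ENNReal.rpow_le_rpow ?_ (by norm_num)
  rw [ENNReal.mul_iInf_of_ne hc0 ENNReal.ofReal_ne_top]
  refine le_iInf fun ρ => ?_
  rw [ENNReal.mul_iInf_of_ne hc0 ENNReal.ofReal_ne_top]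
  refine le_iInf fun hρ => ?_
  obtain ⟨Q, hQ, hcost⟩ := exists_coupling_of_isCoupling hlam hmu hE hf hg hρ ht
  refine (iInf₂_le Q hQ).trans ?_
  rw [hgap, hgap]
  exact hcost

end Contraction

/-! ### Convergence of cosine and sine transforms -/

section Trig

/-- The cosine transform. -/
noncomputable def cosMean (ν : Measure ℝ) (ξ : ℝ) : ℝ := ∫ v, Real.cos (ξ * v) ∂ν

/-- The sine transform. -/
noncomputable def sinMean (ν : Measure ℝ) (ξ : ℝ) : ℝ := ∫ v, Real.sin (ξ * v) ∂ν

variable {ν : Measure ℝ} [IsProbabilityMeasure ν]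

lemma abs_cosMean_le (ξ : ℝ) : |cosMean ν ξ| ≤ 1 :=
  abs_integral_le_of_bounded fun _ => Real.abs_cos_le_one _

lemma abs_sinMean_le (ξ : ℝ) : |sinMean ν ξ| ≤ 1 :=
  abs_integral_le_of_bounded fun _ => Real.abs_sin_le_one _

lemma measurable_cosMean : Measurable (cosMean ν) :=
  (StronglyMeasurable.integral_prod_right (f := fun ξ v : ℝ => Real.cos (ξ * v)) (by
    exact (Continuous.measurable (by fun_prop)).stronglyMeasurable)).measurable

lemma measurable_sinMean : Measurable (sinMean ν) :=
  (StronglyMeasurable.integral_prod_right (f := fun ξ v : ℝ => Real.sin (ξ * v)) (by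
    exact (Continuous.measurable (by fun_prop)).stronglyMeasurable)).measurable

lemma charFun_eq_cosMean_add (ξ : ℝ) :
    charFun ν ξ = (cosMean ν ξ : ℂ) + (sinMean ν ξ : ℂ) * Complex.I := by
  rw [charFun_apply_real, cosMean, sinMean, ← integral_complex_ofReal, ← integral_complex_ofReal,
    ← integral_mul_const, ← integral_add]
  · refine integral_congr_ae (ae_of_all _ fun v => ?_)
    simp only []
    rw [← Complex.ofReal_mul, Complex.exp_mul_I, Complex.ofReal_cos, Complex.ofReal_sin]
  · exact (integrable_of_bounded (Continuous.measurable (by fun_prop))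
      (fun v => Real.abs_cos_le_one (ξ * v))).ofReal
  · exact ((integrable_of_bounded (Continuous.measurable (by fun_prop))
      (fun v => Real.abs_sin_le_one (ξ * v))).ofReal).mul_const _

/-- Lévy's continuity theorem, applied along sequences of times. -/
lemma tendsto_of_forall_cosMean_sinMean {f : ℝ → ProbabilityMeasure ℝ} {ν : ProbabilityMeasure ℝ}
    (hc : ∀ ξ, Tendsto (fun t => cosMean (f t) ξ - cosMean ν ξ) atTop (𝓝 0))
    (hs : ∀ ξ, Tendsto (fun t => sinMean (f t) ξ - sinMean ν ξ) atTop (𝓝 0)) :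
    Tendsto f atTop (𝓝 ν) := by
  refine tendsto_of_seq_tendsto fun u hu => ?_
  refine ProbabilityMeasure.tendsto_iff_tendsto_charFun.2 fun ξ => ?_
  simp only [charFun_eq_cosMean_add]
  have h1 := (tendsto_sub_nhds_zero_iff.1 (hc ξ)).comp hu
  have h2 := (tendsto_sub_nhds_zero_iff.1 (hs ξ)).comp hu
  exact ((Complex.continuous_ofReal.tendsto _).comp h1).add
    (((Complex.continuous_ofReal.tendsto _).comp h2).mul_const _)

/-- For the centred part of the collision operator only the even parts of the transforms matter. -/
lemma cosMean_B2 (ξ : ℝ) : cosMean (B2 ν ν) ξ =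
    ∫ θ, cosMean ν (ξ * Real.cos θ) * cosMean ν (ξ * Real.sin θ) ∂uniformAngle := by
  have hbd : ∀ {φ : ℝ → ℝ} (_ : Measurable φ) (_ : ∀ v, |φ v| ≤ 1), Integrable φ uniformAngle :=
    fun h1 h2 => integrable_of_bounded h1 h2
  have hcc : Integrable (fun θ => cosMean ν (ξ * Real.cos θ) * cosMean ν (ξ * Real.sin θ))
      uniformAngle := integrable_of_bounded (C := 1)
    ((measurable_cosMean.comp (by fun_prop)).mul (measurable_cosMean.comp (by fun_prop)))
    fun θ => by rw [abs_mul]; exact mul_le_one₀ (abs_cosMean_le _) (abs_nonneg _) (abs_cosMean_le _)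
  have hss : Integrable (fun θ => sinMean ν (ξ * Real.cos θ) * sinMean ν (ξ * Real.sin θ))
      uniformAngle := integrable_of_bounded (C := 1)
    ((measurable_sinMean.comp (by fun_prop)).mul (measurable_sinMean.comp (by fun_prop)))
    fun θ => by rw [abs_mul]; exact mul_le_one₀ (abs_sinMean_le _) (abs_nonneg _) (abs_sinMean_le _)
  -- The product of sine transforms is odd under `θ ↦ -θ`.
  have h0 : ∫ θ, sinMean ν (ξ * Real.cos θ) * sinMean ν (ξ * Real.sin θ) ∂uniformAngle = 0 := by
    have h := integral_uniformAngle_neg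
      (F := fun θ => sinMean ν (ξ * Real.cos θ) * sinMean ν (ξ * Real.sin θ))
      (fun θ => by simp [Real.cos_add_two_pi, Real.sin_add_two_pi])
    have hodd : ∀ x, sinMean ν (-x) = -sinMean ν x := fun x => by
      simp only [sinMean, neg_mul, Real.sin_neg, integral_neg]
    simp only [Real.cos_neg, Real.sin_neg, mul_neg, hodd, integral_neg] at h
    linarith
  rw [cosMean, B2, integral_map (by fun_prop)
    (Continuous.measurable (by fun_prop)).aestronglyMeasurable, integral_prod _
    (integrable_of_bounded (Continuous.measurable (by fun_prop)) fun v => Real.abs_cos_le_one _),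
    ← sub_zero (∫ θ, cosMean ν (ξ * Real.cos θ) * cosMean ν (ξ * Real.sin θ) ∂uniformAngle), ← h0,
    ← integral_sub hcc hss]
  refine integral_congr_ae (ae_of_all _ fun θ => ?_)
  simp only [cosMean, sinMean]
  rw [← integral_prod_mul, ← integral_prod_mul, ← integral_sub]
  · refine integral_congr_ae (ae_of_all _ fun z => ?_)
    simp only []
    rw [← Real.cos_add]; congr 1; ring
  · refine integrable_of_bounded (C := 1) (Continuous.measurable (by fun_prop)) fun v => ?_
    rw [abs_mul]; exact mul_le_one₀ (Real.abs_cos_le_one _) (abs_nonneg _) (Real.abs_cos_le_one _)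
  · refine integrable_of_bounded (C := 1) (Continuous.measurable (by fun_prop)) fun v => ?_
    rw [abs_mul]; exact mul_le_one₀ (Real.abs_sin_le_one _) (abs_nonneg _) (Real.abs_sin_le_one _)

/-- Of the two products in the addition formula, one is odd under `θ ↦ -θ` and the other changes
sign under `θ ↦ θ + π`. A single collision destroys the odd part. -/
lemma sinMean_B2 (ξ : ℝ) : sinMean (B2 ν ν) ξ = 0 := by
  have hodd : ∀ x, sinMean ν (-x) = -sinMean ν x := fun x => by
    simp only [sinMean, neg_mul, Real.sin_neg, integral_neg]
  have heven : ∀ x, cosMean ν (-x) = cosMean ν x := fun x => by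
    simp only [cosMean, neg_mul, Real.cos_neg]
  have hsc : Integrable (fun θ => sinMean ν (ξ * Real.cos θ) * cosMean ν (ξ * Real.sin θ))
      uniformAngle := integrable_of_bounded (C := 1)
    ((measurable_sinMean.comp (by fun_prop)).mul (measurable_cosMean.comp (by fun_prop)))
    fun θ => by rw [abs_mul]; exact mul_le_one₀ (abs_sinMean_le _) (abs_nonneg _) (abs_cosMean_le _)
  have hcs : Integrable (fun θ => cosMean ν (ξ * Real.cos θ) * sinMean ν (ξ * Real.sin θ))
      uniformAngle := integrable_of_bounded (C := 1)
    ((measurable_cosMean.comp (by fun_prop)).mul (measurable_sinMean.comp (by fun_prop)))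
    fun θ => by rw [abs_mul]; exact mul_le_one₀ (abs_cosMean_le _) (abs_nonneg _) (abs_sinMean_le _)
  have h0 : ∫ θ, cosMean ν (ξ * Real.cos θ) * sinMean ν (ξ * Real.sin θ) ∂uniformAngle = 0 := by
    have h := integral_uniformAngle_neg
      (F := fun θ => cosMean ν (ξ * Real.cos θ) * sinMean ν (ξ * Real.sin θ))
      (fun θ => by simp [Real.cos_add_two_pi, Real.sin_add_two_pi])
    simp only [Real.cos_neg, Real.sin_neg, mul_neg, hodd, integral_neg] at h
    linarith
  have h1 : ∫ θ, sinMean ν (ξ * Real.cos θ) * cosMean ν (ξ * Real.sin θ) ∂uniformAngle = 0 := by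
    have h := integral_uniformAngle_add
      (F := fun θ => sinMean ν (ξ * Real.cos θ) * cosMean ν (ξ * Real.sin θ))
      (fun θ => by simp [Real.cos_add_two_pi, Real.sin_add_two_pi]) Real.pi
    simp only [Real.cos_add_pi, Real.sin_add_pi, mul_neg, hodd, heven, neg_mul, integral_neg] at h
    linarith
  rw [sinMean, B2, integral_map (by fun_prop)
    (Continuous.measurable (by fun_prop)).aestronglyMeasurable, integral_prod _
    (integrable_of_bounded (Continuous.measurable (by fun_prop)) fun v => Real.abs_sin_le_one _),
    ← add_zero (0 : ℝ)]
  nth_rewrite 1 [← h1]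
  rw [← h0, ← integral_add hsc hcs]
  refine integral_congr_ae (ae_of_all _ fun θ => ?_)
  simp only [cosMean, sinMean]
  rw [← integral_prod_mul, ← integral_prod_mul, ← integral_add]
  · refine integral_congr_ae (ae_of_all _ fun z => ?_)
    simp only []
    rw [← Real.sin_add]; congr 1; ring
  · refine integrable_of_bounded (C := 1) (Continuous.measurable (by fun_prop)) fun v => ?_
    rw [abs_mul]; exact mul_le_one₀ (Real.abs_sin_le_one _) (abs_nonneg _) (Real.abs_cos_le_one _)
  · refine integrable_of_bounded (C := 1) (Continuous.measurable (by fun_prop)) fun v => ?_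
    rw [abs_mul]; exact mul_le_one₀ (Real.abs_cos_le_one _) (abs_nonneg _) (Real.abs_sin_le_one _)

lemma tendsto_one_sub_cos_div (v : ℝ) :
    Tendsto (fun ξ => (1 - Real.cos (ξ * v)) / ξ ^ 2) (𝓝[≠] 0) (𝓝 (v ^ 2 / 2)) := by
  rcases eq_or_ne v 0 with rfl | hv
  · simp
  have h2 : ∀ ξ : ℝ, ξ ≠ 0 → (1 - Real.cos (ξ * v)) / ξ ^ 2 =
      v ^ 2 / 2 * Real.sinc (ξ * v / 2) ^ 2 := fun ξ hξ => by
    rw [Real.sinc_of_ne_zero (by positivity)]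
    have h := Real.cos_two_mul (ξ * v / 2)
    have h' := Real.sin_sq_add_cos_sq (ξ * v / 2)
    have h'' : 2 * (ξ * v / 2) = ξ * v := by ring
    rw [h''] at h
    have h3 : Real.cos (ξ * v) = 1 - 2 * Real.sin (ξ * v / 2) ^ 2 := by linarith
    rw [h3]; field_simp; ring
  have h3 : Tendsto (fun ξ : ℝ => v ^ 2 / 2 * Real.sinc (ξ * v / 2) ^ 2) (𝓝[≠] 0)
      (𝓝 (v ^ 2 / 2)) := by
    have h4 : Continuous fun ξ : ℝ => v ^ 2 / 2 * Real.sinc (ξ * v / 2) ^ 2 := by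
      have := Real.continuous_sinc
      fun_prop
    have h5 := h4.tendsto 0
    simp only [zero_mul, zero_div, Real.sinc_zero, one_pow, mul_one] at h5
    exact h5.mono_left nhdsWithin_le_nhds
  refine h3.congr' ?_
  filter_upwards [self_mem_nhdsWithin] with ξ hξ using (h2 ξ hξ).symm

/-- Dominated convergence with majorant `v²/2`. Only the second moment is available, so there is a
limit but no rate. -/
lemma tendsto_one_sub_cosMean_div {E : ℝ} (hE : 0 ≤ E) (hν : energy ν = ENNReal.ofReal E) :
    Tendsto (fun ξ => (1 - cosMean ν ξ) / ξ ^ 2) (𝓝[≠] 0) (𝓝 (E / 2)) := by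
  have hint : Integrable (fun v : ℝ => v ^ 2) ν := by
    refine ⟨by fun_prop, ?_⟩
    rw [hasFiniteIntegral_iff_ofReal (ae_of_all _ fun v => sq_nonneg v)]
    rw [energy] at hν
    rw [hν]; exact ENNReal.ofReal_lt_top
  have hval : ∫ v, v ^ 2 / 2 ∂ν = E / 2 := by
    rw [integral_div, integral_eq_lintegral_of_nonneg_ae (ae_of_all _ fun v => sq_nonneg v)
      (by fun_prop), ← energy, hν, ENNReal.toReal_ofReal hE]
  have h1 : ∀ ξ, (1 - cosMean ν ξ) / ξ ^ 2 = ∫ v, (1 - Real.cos (ξ * v)) / ξ ^ 2 ∂ν := fun ξ => by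
    rw [integral_div, integral_sub (integrable_const _) (integrable_of_bounded
      (Continuous.measurable (by fun_prop)) fun v => Real.abs_cos_le_one _), cosMean]
    simp
  simp only [h1]
  rw [← hval]
  refine tendsto_integral_filter_of_dominated_convergence (fun v => v ^ 2 / 2) ?_ ?_
    (hint.div_const 2) (ae_of_all _ fun v => ?_)
  · exact Eventually.of_forall fun ξ => (Measurable.aestronglyMeasurable (by fun_prop))
  · filter_upwards [self_mem_nhdsWithin] with ξ hξ
    refine ae_of_all _ fun v => ?_
    have hξ' : 0 < ξ ^ 2 := by have : ξ ≠ 0 := hξ; positivity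
    rw [Real.norm_eq_abs, abs_of_nonneg (div_nonneg (by linarith [Real.cos_le_one (ξ * v)]) hξ'.le),
      div_le_iff₀ hξ']
    have := Real.one_sub_sq_div_two_le_cos (x := ξ * v)
    nlinarith
  · exact tendsto_one_sub_cos_div v

end Trig

/-! ### Convergence to equilibrium -/

section Convergence

variable {lam mu E T : ℝ} {f g : ℝ → ProbabilityMeasure ℝ}

lemma exists_isCoupling_lintegral_gap_lt_top {ν ν' : ProbabilityMeasure ℝ} (hν : energy ν < ⊤)
    (hν' : energy ν' < ⊤) : ∃ ρ, IsCoupling ρ ν ν' ∧ ∫⁻ x, gap x ∂ρ < ⊤ := by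
  refine ⟨(ν : Measure ℝ).prod ν', ⟨?_, ?_⟩, ?_⟩
  · rw [← Measure.fst, Measure.fst_prod]
  · rw [← Measure.snd, Measure.snd_prod]
  · rw [lintegral_prod _ measurable_gap.aemeasurable]
    have h1 : ∀ x y : ℝ, gap (x, y) ≤ 2 * ENNReal.ofReal (x ^ 2) + 2 * ENNReal.ofReal (y ^ 2) := by
      intro x y
      rw [← ENNReal.ofReal_ofNat, ← ENNReal.ofReal_mul (by norm_num),
        ← ENNReal.ofReal_mul (by norm_num), ← ENNReal.ofReal_add (by positivity) (by positivity)]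
      exact ENNReal.ofReal_le_ofReal (by dsimp only; nlinarith [sq_nonneg (x + y)])
    refine (lintegral_mono fun x => lintegral_mono fun y => h1 x y).trans_lt ?_
    have h2 : ∀ x : ℝ, ∫⁻ y, (2 * ENNReal.ofReal (x ^ 2) + 2 * ENNReal.ofReal (y ^ 2))
        ∂(ν' : Measure ℝ) = 2 * ENNReal.ofReal (x ^ 2) + 2 * energy ν' := fun x => by
      rw [lintegral_add_left measurable_const, lintegral_const, measure_univ, mul_one,
        lintegral_const_mul _ (by fun_prop), energy]
    simp only [h2]
    rw [lintegral_add_left (by fun_prop), lintegral_const, measure_univ, mul_one,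
      lintegral_const_mul _ (by fun_prop), ← energy]
    exact ENNReal.add_lt_top.2 ⟨ENNReal.mul_lt_top (by simp) hν, ENNReal.mul_lt_top (by simp) hν'⟩

/-- Pointwise `L |x - y| ≤ ε + L² |x - y|² / (4ε)`, which turns a small mean squared distance into
closeness of integrals without taking a root. -/
lemma abs_integral_sub_integral_le {ν ν' : Measure ℝ} {Q : Measure (ℝ × ℝ)}
    [IsProbabilityMeasure Q] (hQ : IsCoupling Q ν ν') {φ : ℝ → ℝ} (hφ : Measurable φ)
    (hφ1 : ∀ v, |φ v| ≤ 1) {L : ℝ} (hL : ∀ x y, |φ x - φ y| ≤ L * |x - y|) {ε : ℝ} (hε : 0 < ε) :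
    ENNReal.ofReal |∫ v, φ v ∂ν - ∫ v, φ v ∂ν'| ≤
      ENNReal.ofReal ε + ENNReal.ofReal (L ^ 2 / (4 * ε)) * ∫⁻ x, gap x ∂Q := by
  have h1 : ∫ v, φ v ∂ν - ∫ v, φ v ∂ν' = ∫ z, (φ z.1 - φ z.2) ∂Q := by
    rw [← hQ.1, ← hQ.2, integral_map (by fun_prop) hφ.aestronglyMeasurable,
      integral_map (by fun_prop) hφ.aestronglyMeasurable, integral_sub]
    · exact integrable_of_bounded (hφ.comp measurable_fst) fun v => hφ1 _
    · exact integrable_of_bounded (hφ.comp measurable_snd) fun v => hφ1 _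
  rw [h1, ← Real.norm_eq_abs, ofReal_norm]
  refine (enorm_integral_le_lintegral_enorm _).trans ?_
  have h2 : ∀ z : ℝ × ℝ, ‖φ z.1 - φ z.2‖ₑ ≤
      ENNReal.ofReal ε + ENNReal.ofReal (L ^ 2 / (4 * ε)) * gap z := fun z => by
    rw [← ofReal_norm, Real.norm_eq_abs, gap, ← ENNReal.ofReal_mul (by positivity),
      ← ENNReal.ofReal_add hε.le (by positivity)]
    refine ENNReal.ofReal_le_ofReal ((hL _ _).trans ?_)
    rw [← sq_abs (z.1 - z.2)]
    have h3 : ε + L ^ 2 / (4 * ε) * |z.1 - z.2| ^ 2 - L * |z.1 - z.2| =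
        (2 * ε - L * |z.1 - z.2|) ^ 2 / (4 * ε) := by field_simp; ring
    have : 0 ≤ (2 * ε - L * |z.1 - z.2|) ^ 2 / (4 * ε) := by positivity
    linarith
  refine (lintegral_mono h2).trans_eq ?_
  rw [lintegral_add_left measurable_const, lintegral_const, measure_univ, mul_one,
    lintegral_const_mul _ measurable_gap]

lemma tendsto_integral_sub_of_pos (hlam : 0 ≤ lam) (hmu : 0 < mu) (hE : 0 < E) (hT : 0 < T)
    (hf : IsWeakSolution lam mu E T f) (hg : IsWeakSolution lam mu E T g)
    (hf0 : energy (f 0) < ⊤) (hg0 : energy (g 0) < ⊤) {φ : ℝ → ℝ} (hφ : Measurable φ)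
    (hφ1 : ∀ v, |φ v| ≤ 1) {L : ℝ} (hL : ∀ x y, |φ x - φ y| ≤ L * |x - y|) :
    Tendsto (fun t => ∫ v, φ v ∂(f t : Measure ℝ) - ∫ v, φ v ∂(g t : Measure ℝ)) atTop (𝓝 0) := by
  obtain ⟨ρ, hρ, hD⟩ := exists_isCoupling_lintegral_gap_lt_top hf0 hg0
  set D := ∫⁻ x, gap x ∂ρ
  have hbd : ∀ ε : ℝ, 0 < ε → ∀ t : ℝ, 0 ≤ t →
      |∫ v, φ v ∂(f t : Measure ℝ) - ∫ v, φ v ∂(g t : Measure ℝ)| ≤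
        ε + L ^ 2 / (4 * ε) * (Real.exp (-(mu * T / E) * t) * D.toReal) := by
    intro ε hε t ht
    obtain ⟨Q, hQ, hcost⟩ := exists_coupling_of_isCoupling hlam hmu.le hE hf hg hρ ht
    have hQ1 : IsProbabilityMeasure Q := ⟨by
      have : (Q.map Prod.fst) Set.univ = 1 := by rw [hQ.1]; exact measure_univ
      rwa [Measure.map_apply measurable_fst .univ, Set.preimage_univ] at this⟩
    have h1 := (abs_integral_sub_integral_le hQ hφ hφ1 hL hε).trans
      (add_le_add_right (mul_le_mul_right hcost _) _)
    change _ ≤ _ + _ * (_ * D) at h1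
    rw [← ENNReal.ofReal_toReal hD.ne, ← ENNReal.ofReal_mul (by positivity),
      ← ENNReal.ofReal_mul (by positivity), ← ENNReal.ofReal_add hε.le (by positivity)] at h1
    exact (ENNReal.ofReal_le_ofReal_iff (by positivity)).1 h1
  rw [Metric.tendsto_atTop]
  intro ε hε
  have hlim : Tendsto (fun t : ℝ => ε / 2 + L ^ 2 / (4 * (ε / 2)) *
      (Real.exp (-(mu * T / E) * t) * D.toReal)) atTop (𝓝 (ε / 2 + L ^ 2 / (4 * (ε / 2)) *
      (0 * D.toReal))) := by
    refine tendsto_const_nhds.add (tendsto_const_nhds.mul (Tendsto.mul_const _ ?_))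
    refine Real.tendsto_exp_atBot.comp ?_
    exact tendsto_id.const_mul_atTop_of_neg (by rw [neg_lt_zero]; positivity)
  rw [zero_mul, mul_zero, add_zero] at hlim
  obtain ⟨N, hN⟩ := (hlim.eventually (gt_mem_nhds (half_lt_self hε))).exists_forall_of_atTop
  refine ⟨max N 0, fun t ht => ?_⟩
  rw [dist_zero_right, Real.norm_eq_abs]
  exact (hbd (ε / 2) (by positivity) t ((le_max_right _ _).trans ht)).trans_lt
    (hN t ((le_max_left _ _).trans ht))

/-- The fourth-order bound for the even parts of two energy-conserving solutions. -/
lemma abs_cosMean_sub_le (hlam : 0 < lam) (hf : IsWeakSolution lam 0 E T f)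
    (hg : IsWeakSolution lam 0 E T g) {ε K : ℝ} (hε : 0 ≤ ε) (hK : 0 ≤ K)
    (h0 : ∀ ξ, |cosMean (f 0) ξ - cosMean (g 0) ξ| ≤ ε * ξ ^ 2 + K * ξ ^ 4) (n : ℕ) {t : ℝ}
    (ht : 0 ≤ t) (ξ : ℝ) :
    |cosMean (hf.kernel t) ξ - cosMean (hg.kernel t) ξ| ≤
      ε * ξ ^ 2 + K * Real.exp (-(lam / 2) * t) * ξ ^ 4 +
        2 * ((4 * lam * t) ^ n / n.factorial) := by
  induction n generalizing t ξ with
  | zero =>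
    have h1 := abs_cosMean_le (ν := hf.kernel t) ξ
    have h2 := abs_cosMean_le (ν := hg.kernel t) ξ
    have h3 : 0 ≤ ε * ξ ^ 2 + K * Real.exp (-(lam / 2) * t) * ξ ^ 4 := by positivity
    simp only [pow_zero, Nat.factorial_zero, Nat.cast_one, div_one]
    have := abs_sub (cosMean (hf.kernel t) ξ) (cosMean (hg.kernel t) ξ)
    linarith
  | succ n ih =>
    -- The remainder comes from starting with the trivial bound `2`. Bounding a difference of
    -- products by a sum of differences doubles it at each collision, and `R (n+1)` has derivative
    -- `4λ R n`.
    set R : ℕ → ℝ → ℝ := fun n s => 2 * ((4 * lam * s) ^ n / n.factorial) with hR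
    have hmild : ∀ {u : ℝ → ProbabilityMeasure ℝ} (hu : IsWeakSolution lam 0 E T u),
        Real.exp (2 * lam * t) * cosMean (hu.kernel t) ξ = cosMean (u 0) ξ +
        ∫ s in (0 : ℝ)..t, Real.exp (2 * lam * s) *
          (2 * lam * cosMean (collideKernel hu.kernel s) ξ) := by
      intro u hu
      have h := hu.mild (φ := fun v => Real.cos (ξ * v)) (by fun_prop)
        (fun v => Real.abs_cos_le_one _) ht
      simp only [IsWeakSolution.gainTerm, add_zero, zero_mul] at h
      have h' : cosMean (u 0) ξ = cosMean (hu.kernel 0) ξ := by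
        rw [hu.kernel_apply, rescaled_of_nonneg le_rfl, contractBy_zero]
      rw [h']
      simp only [cosMean]
      linarith
    have hm : ∀ {u : ℝ → ProbabilityMeasure ℝ} (hu : IsWeakSolution lam 0 E T u),
        Measurable fun s => cosMean (collideKernel hu.kernel s) ξ := fun hu =>
      measurable_integral_kernel _ (by fun_prop)
    have hii : ∀ {u : ℝ → ProbabilityMeasure ℝ} (hu : IsWeakSolution lam 0 E T u),
        IntervalIntegrable (fun s => Real.exp (2 * lam * s) *
          (2 * lam * cosMean (collideKernel hu.kernel s) ξ)) volume 0 t := by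
      intro u hu
      rw [intervalIntegrable_iff_integrableOn_Ioc_of_le ht]
      refine Integrable.mul_bdd (c := 2 * lam) ?_ ((hm hu).const_mul _).aestronglyMeasurable
        (ae_of_all _ fun s => ?_)
      · exact (Continuous.integrableOn_Icc (by fun_prop)).mono_set Set.Ioc_subset_Icc_self
      · rw [Real.norm_eq_abs, abs_mul, abs_of_pos (by positivity : 0 < 2 * lam)]
        exact mul_le_of_le_one_right (by positivity) (abs_cosMean_le _)
    have hcoll : ∀ s, 0 ≤ s →
        |cosMean (collideKernel hf.kernel s) ξ - cosMean (collideKernel hg.kernel s) ξ| ≤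
        ε * ξ ^ 2 + 3 / 4 * (K * Real.exp (-(lam / 2) * s) * ξ ^ 4) + 2 * R n s := by
      intro s hs
      set B := K * Real.exp (-(lam / 2) * s)
      have hprod : ∀ {u : ℝ → ProbabilityMeasure ℝ} (hu : IsWeakSolution lam 0 E T u),
          Integrable (fun θ => cosMean (hu.kernel s) (ξ * Real.cos θ) *
            cosMean (hu.kernel s) (ξ * Real.sin θ)) uniformAngle := fun hu =>
        integrable_of_bounded (C := 1)
          ((measurable_cosMean.comp (by fun_prop)).mul (measurable_cosMean.comp (by fun_prop)))
          fun θ => by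
            rw [abs_mul]; exact mul_le_one₀ (abs_cosMean_le _) (abs_nonneg _) (abs_cosMean_le _)
      rw [collideKernel_apply, collideKernel_apply, cosMean_B2, cosMean_B2,
        ← integral_sub (hprod hf) (hprod hg), ← Real.norm_eq_abs]
      have hcs : ∀ θ : ℝ, Real.cos θ ^ 4 + Real.sin θ ^ 4 =
          1 - 2 * (Real.sin θ ^ 2 * Real.cos θ ^ 2) := fun θ => by
        nlinarith [Real.sin_sq_add_cos_sq θ]
      -- The mean of `cos⁴ + sin⁴` is `3/4`, the source of decay; the quadratic term is preserved
      -- because `cos² + sin² = 1`.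
      have hval : ∫ θ, (ε * ξ ^ 2 + B * ξ ^ 4 * (1 - 2 * (Real.sin θ ^ 2 * Real.cos θ ^ 2)) +
          2 * R n s) ∂uniformAngle = ε * ξ ^ 2 + 3 / 4 * (B * ξ ^ 4) + 2 * R n s := by
        have hsplit : ∀ θ : ℝ, ε * ξ ^ 2 + B * ξ ^ 4 * (1 - 2 * (Real.sin θ ^ 2 * Real.cos θ ^ 2)) +
            2 * R n s = (ε * ξ ^ 2 + B * ξ ^ 4 + 2 * R n s) +
              (-2 * (B * ξ ^ 4)) * (Real.sin θ ^ 2 * Real.cos θ ^ 2) := fun θ => by ring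
        simp only [hsplit]
        rw [integral_uniformAngle, intervalIntegral.integral_add,
          intervalIntegral.integral_const_mul, integral_sin_sq_mul_cos_sq,
          intervalIntegral.integral_const]
        · have : Real.sin (4 * (2 * Real.pi)) = 0 := by
            have := Real.sin_nat_mul_pi 8
            rw [← this]; congr 1; push_cast; ring
          rw [this]
          simp only [mul_zero, Real.sin_zero, sub_zero, smul_eq_mul, zero_div, sub_self]
          field_simp
          ring
        all_goals exact Continuous.intervalIntegrable (by fun_prop) _ _
      rw [← hval]
      refine norm_integral_le_of_norm_le
        (integrable_uniformAngle_of_continuous (by fun_prop)) (ae_of_all _ fun θ => ?_)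
      have h1 := ih hs (ξ * Real.cos θ)
      have h2 := ih hs (ξ * Real.sin θ)
      set a := cosMean (hf.kernel s) (ξ * Real.cos θ)
      set a' := cosMean (hg.kernel s) (ξ * Real.cos θ)
      set b := cosMean (hf.kernel s) (ξ * Real.sin θ)
      set b' := cosMean (hg.kernel s) (ξ * Real.sin θ)
      have hb : |b| ≤ 1 := abs_cosMean_le _
      have ha' : |a'| ≤ 1 := abs_cosMean_le _
      calc ‖a * b - a' * b'‖ = |(a - a') * b + a' * (b - b')| := by
            rw [Real.norm_eq_abs]; congr 1; ring
        _ ≤ |a - a'| * |b| + |a'| * |b - b'| := by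
            rw [← abs_mul, ← abs_mul]; exact abs_add_le _ _
        _ ≤ |a - a'| * 1 + 1 * |b - b'| := by gcongr
        _ ≤ (ε * (ξ * Real.cos θ) ^ 2 + B * (ξ * Real.cos θ) ^ 4 + R n s) +
            (ε * (ξ * Real.sin θ) ^ 2 + B * (ξ * Real.sin θ) ^ 4 + R n s) := by
            rw [mul_one, one_mul]; exact add_le_add h1 h2
        _ = ε * ξ ^ 2 * (Real.sin θ ^ 2 + Real.cos θ ^ 2) +
            B * ξ ^ 4 * (Real.cos θ ^ 4 + Real.sin θ ^ 4) + 2 * R n s := by ring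
        _ = _ := by rw [Real.sin_sq_add_cos_sq, hcs, mul_one]
    -- An explicit antiderivative of the majorant. The rate `3λ/2 = 2λ · 3/4` becomes `-λ/2` after
    -- division by the integrating factor `e^{2λt}`.
    have hderiv : ∀ s ∈ Set.uIcc 0 t, HasDerivAt
        (fun s => ε * ξ ^ 2 * Real.exp (2 * lam * s) +
          K * ξ ^ 4 * Real.exp (3 / 2 * lam * s) + Real.exp (2 * lam * t) * R (n + 1) s)
        (Real.exp (2 * lam * s) * (2 * lam * (ε * ξ ^ 2)) +
          K * ξ ^ 4 * (Real.exp (3 / 2 * lam * s) * (3 / 2 * lam)) +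
          Real.exp (2 * lam * t) * (4 * lam * R n s)) s := by
      intro s _
      have hexp : ∀ c : ℝ, HasDerivAt (fun s => Real.exp (c * s)) (Real.exp (c * s) * c) s :=
        fun c => by simpa using ((hasDerivAt_id s).const_mul c).exp
      have hpow : HasDerivAt (R (n + 1)) (4 * lam * R n s) s := by
        have h1 : HasDerivAt (fun s => 4 * lam * s) (4 * lam) s := by
          simpa using (hasDerivAt_id s).const_mul (4 * lam)
        have h2 := ((h1.pow (n + 1)).div_const ((n + 1).factorial : ℝ)).const_mul 2
        refine h2.congr_deriv ?_
        simp only [hR, Nat.factorial_succ, Nat.add_sub_cancel]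
        push_cast
        have := Nat.factorial_pos n
        field_simp
      refine HasDerivAt.add (HasDerivAt.add ?_ ((hexp _).const_mul _)) (hpow.const_mul _)
      refine ((hexp (2 * lam)).const_mul (ε * ξ ^ 2)).congr_deriv ?_
      ring
    have hcont : Continuous fun s => Real.exp (2 * lam * s) * (2 * lam * (ε * ξ ^ 2)) +
          K * ξ ^ 4 * (Real.exp (3 / 2 * lam * s) * (3 / 2 * lam)) +
          Real.exp (2 * lam * t) * (4 * lam * R n s) := by
      simp only [hR]; fun_prop
    have hval := intervalIntegral.integral_eq_sub_of_hasDerivAt hderiv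
      (hcont.intervalIntegrable _ _)
    have hbound : ∀ s ∈ Set.Ioc 0 t, ‖Real.exp (2 * lam * s) *
          (2 * lam * cosMean (collideKernel hf.kernel s) ξ) - Real.exp (2 * lam * s) *
          (2 * lam * cosMean (collideKernel hg.kernel s) ξ)‖ ≤
        Real.exp (2 * lam * s) * (2 * lam * (ε * ξ ^ 2)) +
          K * ξ ^ 4 * (Real.exp (3 / 2 * lam * s) * (3 / 2 * lam)) +
          Real.exp (2 * lam * t) * (4 * lam * R n s) := by
      intro s hs
      have hs0 : 0 ≤ s := hs.1.le
      have hRs : 0 ≤ R n s := by simp only [hR]; positivity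
      have h1 : Real.exp (3 / 2 * lam * s) =
          Real.exp (2 * lam * s) * Real.exp (-(lam / 2) * s) := by
        rw [← Real.exp_add]; congr 1; ring
      have h2 : Real.exp (2 * lam * s) ≤ Real.exp (2 * lam * t) :=
        Real.exp_le_exp.2 (by nlinarith [hs.2])
      rw [← mul_sub, ← mul_sub, Real.norm_eq_abs, abs_mul, abs_mul,
        abs_of_pos (Real.exp_pos _), abs_of_pos (by positivity : 0 < 2 * lam)]
      calc _ ≤ Real.exp (2 * lam * s) * (2 * lam * (ε * ξ ^ 2 +
            3 / 4 * (K * Real.exp (-(lam / 2) * s) * ξ ^ 4) + 2 * R n s)) := by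
            gcongr; exact hcoll s hs0
        _ = Real.exp (2 * lam * s) * (2 * lam * (ε * ξ ^ 2)) +
          K * ξ ^ 4 * (Real.exp (3 / 2 * lam * s) * (3 / 2 * lam)) +
          Real.exp (2 * lam * s) * (4 * lam * R n s) := by rw [h1]; ring
        _ ≤ _ := by gcongr
    have hI := (intervalIntegral.norm_integral_le_of_norm_le ht (ae_of_all _ hbound)
      (hcont.intervalIntegrable _ _)).trans_eq hval
    rw [Real.norm_eq_abs] at hI
    have hdiff : Real.exp (2 * lam * t) *
        (cosMean (hf.kernel t) ξ - cosMean (hg.kernel t) ξ) =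
        (cosMean (f 0) ξ - cosMean (g 0) ξ) + ∫ s in (0 : ℝ)..t, (Real.exp (2 * lam * s) *
        (2 * lam * cosMean (collideKernel hf.kernel s) ξ) - Real.exp (2 * lam * s) *
        (2 * lam * cosMean (collideKernel hg.kernel s) ξ)) := by
      rw [mul_sub, hmild hf, hmild hg, intervalIntegral.integral_sub (hii hf) (hii hg)]
      ring
    have hR0 : R (n + 1) 0 = 0 := by simp [hR]
    rw [hR0] at hI
    simp only [mul_zero, Real.exp_zero, mul_one, add_zero] at hI
    have hfin : Real.exp (2 * lam * t) * |cosMean (hf.kernel t) ξ - cosMean (hg.kernel t) ξ| ≤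
        Real.exp (2 * lam * t) * (ε * ξ ^ 2 + K * Real.exp (-(lam / 2) * t) * ξ ^ 4 +
          R (n + 1) t) := by
      rw [← abs_of_pos (Real.exp_pos (2 * lam * t)), ← abs_mul, abs_of_pos (Real.exp_pos _), hdiff]
      refine (abs_add_le _ _).trans ((add_le_add (h0 ξ) hI).trans_eq ?_)
      have : Real.exp (3 / 2 * lam * t) =
          Real.exp (2 * lam * t) * Real.exp (-(lam / 2) * t) := by
        rw [← Real.exp_add]; congr 1; ring
      rw [this]; ring
    exact le_of_mul_le_mul_left hfin (Real.exp_pos _)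

lemma IsWeakSolution.kernel_of_mu_eq_zero (hf : IsWeakSolution lam 0 E T f) {t : ℝ} (ht : 0 ≤ t) :
    hf.kernel t = f t := by
  rw [hf.kernel_apply, rescaled_of_nonneg ht, contractBy]
  simp [drift]

/-- The gain term has vanishing sine transform, so only the loss at rate `2λ` acts. -/
lemma tendsto_sinMean_zero (hlam : 0 < lam) (hf : IsWeakSolution lam 0 E T f) (ξ : ℝ) :
    Tendsto (fun t => sinMean (f t) ξ) atTop (𝓝 0) := by
  have h1 : ∀ t, 0 ≤ t → sinMean (f t) ξ = Real.exp (-(2 * lam) * t) * sinMean (f 0) ξ := by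
    intro t ht
    have h := hf.mild (φ := fun v => Real.sin (ξ * v)) (by fun_prop)
      (fun v => Real.abs_sin_le_one _) ht
    have h2 : ∀ s, hf.gainTerm (fun v => Real.sin (ξ * v)) s = 0 := fun s => by
      simp only [IsWeakSolution.gainTerm, zero_mul, add_zero, collideKernel_apply]
      have := sinMean_B2 (ν := hf.kernel s) ξ
      rw [sinMean] at this
      rw [this, mul_zero]
    simp only [h2, mul_zero, intervalIntegral.integral_zero, add_zero,
      hf.kernel_of_mu_eq_zero ht, hf.kernel_of_mu_eq_zero le_rfl] at h
    rw [sinMean, sinMean, ← sub_eq_zero.1 h, ← mul_assoc, ← Real.exp_add]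
    ring_nf
    simp
  have h2 : Tendsto (fun t => Real.exp (-(2 * lam) * t) * sinMean (f 0) ξ) atTop
      (𝓝 (0 * sinMean (f 0) ξ)) := by
    refine Tendsto.mul_const _ (Real.tendsto_exp_atBot.comp ?_)
    exact tendsto_id.const_mul_atTop_of_neg (by linarith)
  rw [zero_mul] at h2
  refine h2.congr' ?_
  filter_upwards [eventually_ge_atTop 0] with t ht using (h1 t ht).symm

/-- Equal energies make the initial difference `o(ξ²)`, hence at most `ε ξ² + K ξ⁴` for every `ε`,
without any fourth moment. The quartic part decays in time, and `ε` is arbitrary. -/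
lemma tendsto_cosMean_sub (hlam : 0 < lam) (hE : 0 < E) (hf : IsWeakSolution lam 0 E T f)
    (hg : IsWeakSolution lam 0 E T g) (hf0 : energy (f 0) = ENNReal.ofReal E)
    (hg0 : energy (g 0) = ENNReal.ofReal E) (ξ : ℝ) :
    Tendsto (fun t => cosMean (f t) ξ - cosMean (g t) ξ) atTop (𝓝 0) := by
  have hsmall : ∀ ε : ℝ, 0 < ε → ∃ K : ℝ, 0 ≤ K ∧ ∀ ξ,
      |cosMean (f 0) ξ - cosMean (g 0) ξ| ≤ ε * ξ ^ 2 + K * ξ ^ 4 := by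
    intro ε hε
    have h1 := (tendsto_one_sub_cosMean_div hE.le hg0).sub (tendsto_one_sub_cosMean_div hE.le hf0)
    rw [sub_self] at h1
    obtain ⟨δ, hδ, h2⟩ := Metric.mem_nhdsWithin_iff.1
      (h1.eventually (Metric.ball_mem_nhds 0 hε))
    -- Away from the origin the trivial bound `2` is dominated by the quartic term.
    refine ⟨2 / δ ^ 4, by positivity, fun ξ => ?_⟩
    rcases eq_or_ne ξ 0 with rfl | hξ
    · simp [cosMean]
    rcases lt_or_ge |ξ| δ with hlt | hge
    · have h3 := h2 (show ξ ∈ Metric.ball 0 δ ∩ {0}ᶜ from ⟨by simpa using hlt, hξ⟩)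
      have h3' : |(1 - cosMean (g 0) ξ) / ξ ^ 2 - (1 - cosMean (f 0) ξ) / ξ ^ 2| < ε := by
        simpa using h3
      have hξ2 : 0 < ξ ^ 2 := by positivity
      rw [← sub_div, abs_div, abs_of_pos hξ2, div_lt_iff₀ hξ2] at h3'
      have h4 : 0 ≤ 2 / δ ^ 4 * ξ ^ 4 := by positivity
      have h5 : (1 - cosMean (g 0) ξ) - (1 - cosMean (f 0) ξ) =
        cosMean (f 0) ξ - cosMean (g 0) ξ := by ring
      rw [h5] at h3'
      linarith
    · have h3 := abs_cosMean_le (ν := (f 0 : Measure ℝ)) ξ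
      have h4 := abs_cosMean_le (ν := (g 0 : Measure ℝ)) ξ
      have h5 := abs_sub (cosMean (f 0) ξ) (cosMean (g 0) ξ)
      have h6 : 1 ≤ (ξ ^ 4) / δ ^ 4 := by
        rw [one_le_div (by positivity), ← abs_of_nonneg (by positivity : 0 ≤ ξ ^ 4), abs_pow]
        exact pow_le_pow_left₀ hδ.le hge 4
      have h7 : 2 / δ ^ 4 * ξ ^ 4 = 2 * (ξ ^ 4 / δ ^ 4) := by ring
      have h8 : 0 ≤ ε * ξ ^ 2 := by positivity
      rw [h7]
      linarith
  have hbd : ∀ ε : ℝ, 0 < ε → ∃ K : ℝ, ∀ t, 0 ≤ t → |cosMean (f t) ξ - cosMean (g t) ξ| ≤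
      ε * ξ ^ 2 + K * Real.exp (-(lam / 2) * t) * ξ ^ 4 := by
    intro ε hε
    obtain ⟨K, hK, h0⟩ := hsmall ε hε
    refine ⟨K, fun t ht => ?_⟩
    have hlim : Tendsto (fun n : ℕ => ε * ξ ^ 2 + K * Real.exp (-(lam / 2) * t) * ξ ^ 4 +
        2 * ((4 * lam * t) ^ n / n.factorial)) atTop
        (𝓝 (ε * ξ ^ 2 + K * Real.exp (-(lam / 2) * t) * ξ ^ 4 + 2 * 0)) :=
      tendsto_const_nhds.add (tendsto_const_nhds.mul
        (FloorSemiring.tendsto_pow_div_factorial_atTop _))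
    rw [mul_zero, add_zero] at hlim
    refine ge_of_tendsto' hlim fun n => ?_
    have := abs_cosMean_sub_le hlam hf hg hε.le hK h0 n ht ξ
    rwa [hf.kernel_of_mu_eq_zero ht, hg.kernel_of_mu_eq_zero ht] at this
  rw [Metric.tendsto_atTop]
  intro η hη
  obtain ⟨K, hK⟩ := hbd (η / 2 / (ξ ^ 2 + 1)) (by positivity)
  have hle : η / 2 / (ξ ^ 2 + 1) * ξ ^ 2 ≤ η / 2 := by
    rw [div_mul_eq_mul_div, div_le_iff₀ (by positivity)]
    nlinarith
  have hlim : Tendsto (fun t : ℝ => η / 2 / (ξ ^ 2 + 1) * ξ ^ 2 +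
      K * Real.exp (-(lam / 2) * t) * ξ ^ 4) atTop
      (𝓝 (η / 2 / (ξ ^ 2 + 1) * ξ ^ 2 + K * 0 * ξ ^ 4)) := by
    refine tendsto_const_nhds.add (Tendsto.mul_const _ (tendsto_const_nhds.mul
      (Real.tendsto_exp_atBot.comp ?_)))
    exact tendsto_id.const_mul_atTop_of_neg (by linarith)
  rw [mul_zero, zero_mul, add_zero] at hlim
  obtain ⟨N, hN⟩ := (hlim.eventually (gt_mem_nhds
    (hle.trans_lt (half_lt_self hη)))).exists_forall_of_atTop
  refine ⟨max N 0, fun t ht => ?_⟩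
  rw [dist_zero_right, Real.norm_eq_abs]
  exact (hK t ((le_max_right _ _).trans ht)).trans_lt (hN t ((le_max_left _ _).trans ht))

/-- Admissible weak solutions converge to an admissible stationary solution. -/
theorem IsWeakSolution.tendsto (hlam : 0 ≤ lam) (hmu : 0 ≤ mu) (hpos : 0 < 2 * lam + mu)
    (hE : 0 < E) (hT : 0 < T) (hf : IsWeakSolution lam mu E T f)
    (hf0 : HasAdmissibleEnergy mu E (f 0)) {ν : ProbabilityMeasure ℝ}
    (hν : IsStationary lam mu E T ν) (hν0 : HasAdmissibleEnergy mu E ν) :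
    Tendsto f atTop (𝓝 ν) := by
  rcases hmu.eq_or_lt with rfl | hmu
  · have hlam' : 0 < lam := by linarith
    refine tendsto_of_forall_cosMean_sinMean
      (fun ξ => tendsto_cosMean_sub hlam' hE hf hν (hf0.2 rfl) (hν0.2 rfl) ξ) fun ξ => ?_
    have := (tendsto_sinMean_zero hlam' hf ξ).sub (tendsto_sinMean_zero hlam' hν ξ)
    rwa [sub_zero] at this
  · refine tendsto_of_forall_cosMean_sinMean (fun ξ => ?_) fun ξ => ?_
    · refine tendsto_integral_sub_of_pos hlam hmu hE hT hf hν hf0.1 hν0.1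
        (φ := fun v => Real.cos (ξ * v)) (L := |ξ|) (by fun_prop)
        (fun v => Real.abs_cos_le_one _) fun x y => ?_
      rw [← abs_mul, mul_sub]
      exact Real.abs_cos_sub_cos_le _ _
    · refine tendsto_integral_sub_of_pos hlam hmu hE hT hf hν hf0.1 hν0.1
        (φ := fun v => Real.sin (ξ * v)) (L := |ξ|) (by fun_prop)
        (fun v => Real.abs_sin_le_one _) fun x y => ?_
      rw [← abs_mul, mul_sub]
      exact Real.abs_sin_sub_sin_le _ _

end Convergence

/-! ### The density of a Gaussian mixture -/

section Heat

/-- The centred Gaussian density of variance `s`. -/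
noncomputable def heat (s v : ℝ) : ℝ := (√(2 * Real.pi * s))⁻¹ * Real.exp (-v ^ 2 / (2 * s))

lemma heat_nonneg (s v : ℝ) : 0 ≤ heat s v := by unfold heat; positivity

@[fun_prop]
lemma measurable_heat {X : Type*} [MeasurableSpace X] {s v : X → ℝ} (hs : Measurable s)
    (hv : Measurable v) : Measurable fun x => heat (s x) (v x) := by
  unfold heat; fun_prop

lemma heat_eq_gaussianPDFReal {s : ℝ} (hs : 0 ≤ s) (v : ℝ) :
    heat s v = gaussianPDFReal 0 s.toNNReal v := by
  rw [heat, gaussianPDFReal, Real.coe_toNNReal _ hs, sub_zero]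

/-- A consequence of the conventions for roots and inverses; it lets the bounds on `heat` hold for
all `s` without a sign condition. -/
lemma heat_of_nonpos {s : ℝ} (hs : s ≤ 0) (v : ℝ) : heat s v = 0 := by
  rw [heat, Real.sqrt_eq_zero_of_nonpos, inv_zero, zero_mul]
  have := Real.pi_pos
  nlinarith

lemma heat_neg (s v : ℝ) : heat s (-v) = heat s v := by simp [heat]

lemma heat_le_heat {s v w : ℝ} (h : |v| ≤ |w|) : heat s w ≤ heat s v := by
  rcases le_or_gt s 0 with hs | hs
  · rw [heat_of_nonpos hs, heat_of_nonpos hs]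
  · unfold heat
    have := sq_le_sq.2 h
    gcongr

/-- Uniform in the variance: `e^y ≥ 1 + y` with `y = v²/(2s)`, and a completed square. Hence every
mixture has a finite density off the origin. -/
lemma abs_mul_heat_le (s v : ℝ) : |v| * heat s v ≤ 1 := by
  rcases le_or_gt s 0 with hs | hs
  · rw [heat_of_nonpos hs]; simp
  · have h1 : √s ≤ √(2 * Real.pi * s) :=
      Real.sqrt_le_sqrt (by nlinarith [Real.pi_gt_three])
    have hs' : 0 < √s := Real.sqrt_pos.2 hs
    have h2 : |v| ≤ √s * Real.exp (v ^ 2 / (2 * s)) := by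
      have h3 := Real.add_one_le_exp (v ^ 2 / (2 * s))
      have h4 : √s * (v ^ 2 / (2 * s) + 1) ≤ √s * Real.exp (v ^ 2 / (2 * s)) := by gcongr
      refine le_trans ?_ h4
      have h5 : √s * (v ^ 2 / (2 * s) + 1) - |v| =
          ((|v| - √s) ^ 2 + s) / (2 * √s) := by
        have h6 := Real.sq_sqrt hs.le
        rw [← sq_abs v]
        set r := √s
        rw [← h6]
        field_simp
        ring
      have h7 : 0 ≤ ((|v| - √s) ^ 2 + s) / (2 * √s) := by positivity
      linarith
    rw [heat, neg_div, Real.exp_neg, ← mul_inv, ← div_eq_mul_inv, div_le_one (by positivity)]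
    exact h2.trans (by gcongr)

lemma heat_le_inv {v : ℝ} (hv : v ≠ 0) (s : ℝ) : heat s v ≤ |v|⁻¹ := by
  have hv' : 0 < |v| := abs_pos.2 hv
  rw [← one_div, le_div_iff₀ hv', mul_comm]
  exact abs_mul_heat_le s v

lemma heat_exp_mul (c s v : ℝ) :
    heat (Real.exp (2 * c) * s) v = Real.exp (-c) * heat s (Real.exp (-c) * v) := by
  have h1 : Real.exp (2 * c) = Real.exp c ^ 2 := by rw [← Real.exp_nat_mul]; push_cast; rfl
  have h2 : √(2 * Real.pi * (Real.exp c ^ 2 * s)) = Real.exp c * √(2 * Real.pi * s) := by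
    rw [show 2 * Real.pi * (Real.exp c ^ 2 * s) = Real.exp c ^ 2 * (2 * Real.pi * s) by ring,
      Real.sqrt_mul (by positivity), Real.sqrt_sq (by positivity)]
  rw [heat, heat, h1, h2, mul_inv, Real.exp_neg, mul_assoc]
  congr 3
  have := Real.exp_pos c
  field_simp

lemma lintegral_gaussianReal_eq {s : ℝ} (hs : 0 < s) {F : ℝ → ℝ≥0∞} (hF : Measurable F) :
    ∫⁻ x, F x ∂(gaussianReal 0 s.toNNReal) = ∫⁻ x, ENNReal.ofReal (heat s x) * F x := by
  rw [gaussianReal_of_var_ne_zero _ (by simpa using hs),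
    lintegral_withDensity_eq_lintegral_mul _ (measurable_gaussianPDF _ _) hF]
  refine lintegral_congr fun x => ?_
  rw [Pi.mul_apply, gaussianPDF, heat_eq_gaussianPDFReal hs.le]

/-- The absolute moment of order `r` of the standard Gaussian. -/
noncomputable def gaussianAbsMoment (r : ℝ) : ℝ≥0∞ :=
  ∫⁻ v, ENNReal.ofReal (|v| ^ r) ∂(gaussianReal 0 1)

lemma lintegral_abs_rpow_gaussianReal {s : ℝ} (hs : 0 < s) (r : ℝ) :
    ∫⁻ v, ENNReal.ofReal (|v| ^ r) ∂(gaussianReal 0 s.toNNReal) =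
      ENNReal.ofReal s ^ (r / 2) * gaussianAbsMoment r := by
  have h := lintegral_gaussianReal_scale (√s) zero_le_one
    (F := fun v => ENNReal.ofReal (|v| ^ r)) (by fun_prop)
  rw [Real.toNNReal_one, mul_one, Real.sq_sqrt hs.le] at h
  rw [← h, gaussianAbsMoment, ← lintegral_const_mul _ (by fun_prop)]
  refine lintegral_congr fun v => ?_
  rw [abs_mul, Real.mul_rpow (abs_nonneg _) (abs_nonneg _), ENNReal.ofReal_mul (by positivity),
    abs_of_nonneg (Real.sqrt_nonneg _), Real.sqrt_eq_rpow, ← Real.rpow_mul hs.le,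
    ENNReal.ofReal_rpow_of_pos hs]
  congr 3; ring

lemma gaussianAbsMoment_ne_zero (r : ℝ) : gaussianAbsMoment r ≠ 0 := by
  rw [gaussianAbsMoment, Ne, lintegral_eq_zero_iff (by fun_prop)]
  intro h
  have := nullSingletonClass_gaussianReal (μ := 0) (v := 1) one_ne_zero
  have h0 : ∀ᵐ v ∂(gaussianReal 0 1), v ≠ 0 := by
    simp [ae_iff, measure_singleton]
  have h' : ∀ᵐ v ∂(gaussianReal 0 1), False := by
    filter_upwards [h, h0] with v hv hv0
    have hv' : ENNReal.ofReal (|v| ^ r) = 0 := hv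
    rw [ENNReal.ofReal_eq_zero] at hv'
    have : 0 < |v| ^ r := Real.rpow_pos_of_pos (abs_pos.2 hv0) _
    linarith
  simp [ae_iff] at h'

lemma gaussianAbsMoment_ne_top {r : ℝ} (hr : 0 ≤ r) : gaussianAbsMoment r ≠ ⊤ := by
  rcases hr.eq_or_lt with rfl | hr
  · simp [gaussianAbsMoment]
  have h := (memLp_id_gaussianReal (μ := 0) (v := 1) r.toNNReal).integrable_norm_rpow
    (by simpa using hr) (by simp)
  simp only [ENNReal.coe_toReal, Real.coe_toNNReal _ hr.le, id, Real.norm_eq_abs] at h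
  exact ((hasFiniteIntegral_iff_ofReal (ae_of_all _ fun v => by positivity)).1 h.2).ne

/-- The rotation of two independent centred Gaussians, at the level of densities. -/
lemma lintegral_heat_mul_heat {a b : ℝ} (ha : 0 < a) (hb : 0 < b) (θ v : ℝ) :
    ∫⁻ w, ENNReal.ofReal (heat a (v * Real.cos θ - w * Real.sin θ) *
      heat b (v * Real.sin θ + w * Real.cos θ)) =
      ENNReal.ofReal (heat (Real.cos θ ^ 2 * a + Real.sin θ ^ 2 * b) v) := by
  set c := Real.cos θ
  set s := Real.sin θ
  have hcs : c ^ 2 + s ^ 2 = 1 := Real.cos_sq_add_sin_sq θ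
  set D := c ^ 2 * a + s ^ 2 * b with hD
  have hD0 : 0 < D := by
    rcases eq_or_ne c 0 with hc | hc
    · have : s ^ 2 = 1 := by rw [hc] at hcs; linarith
      rw [hD, hc, this]; linarith
    · have : 0 < c ^ 2 * a := by positivity
      have : 0 ≤ s ^ 2 * b := by positivity
      linarith
  -- Completing the square in `w`: the product is Gaussian in `w` with mean `m` and variance `ab/D`,
  -- times the value at `v` of the Gaussian density of variance `D`.
  set m := v * c * s * (b - a) / D with hm
  have hV : 0 < a * b / D := by positivity
  have hpt : ∀ w, heat a (v * c - w * s) * heat b (v * s + w * c) =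
      heat D v * gaussianPDFReal m (a * b / D).toNNReal w := by
    intro w
    rw [gaussianPDFReal, Real.coe_toNNReal _ hV.le, heat, heat, heat]
    have h1 : √(2 * Real.pi * a) * √(2 * Real.pi * b) =
        √(2 * Real.pi * D) * √(2 * Real.pi * (a * b / D)) := by
      rw [← Real.sqrt_mul (by positivity), ← Real.sqrt_mul (by positivity)]
      congr 1
      field_simp
    have h2 : -(v * c - w * s) ^ 2 / (2 * a) + -(v * s + w * c) ^ 2 / (2 * b) =
        -v ^ 2 / (2 * D) + -(w - m) ^ 2 / (2 * (a * b / D)) := by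
      rw [hm]
      field_simp
      rw [hD]
      linear_combination (-(a * b * v ^ 2 * (c ^ 2 + s ^ 2 + 1))) * hcs
    rw [mul_mul_mul_comm, ← mul_inv, h1, ← Real.exp_add, h2, Real.exp_add, mul_inv,
      mul_mul_mul_comm]
  simp only [hpt]
  have h0 : ∀ w, ENNReal.ofReal (heat D v * gaussianPDFReal m (a * b / D).toNNReal w) =
      ENNReal.ofReal (heat D v) * ENNReal.ofReal (gaussianPDFReal m (a * b / D).toNNReal w) :=
    fun w => ENNReal.ofReal_mul (heat_nonneg _ _)
  simp only [h0]
  rw [lintegral_const_mul _ (measurable_gaussianPDFReal _ _).ennreal_ofReal,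
    lintegral_gaussianPDFReal_eq_one _ (by simpa using hV), mul_one]

end Heat

section MixtureDensity

/-- The density of the Gaussian mixture with variance law `M`. -/
noncomputable def mixtureDensity (M : Measure ℝ) (v : ℝ) : ℝ := ∫ s, heat s v ∂M

variable {M : Measure ℝ}

lemma mixtureDensity_nonneg (v : ℝ) : 0 ≤ mixtureDensity M v :=
  integral_nonneg fun _ => heat_nonneg _ _

lemma even_mixtureDensity : Function.Even (mixtureDensity M) := fun v => by
  simp only [mixtureDensity, heat_neg]

variable [IsProbabilityMeasure M]

lemma integrable_heat {v : ℝ} (hv : v ≠ 0) : Integrable (fun s => heat s v) M :=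
  integrable_of_bounded (by fun_prop) (C := |v|⁻¹) fun s => by
    rw [abs_of_nonneg (heat_nonneg _ _)]; exact heat_le_inv hv s

lemma ofReal_mixtureDensity {v : ℝ} (hv : v ≠ 0) :
    ENNReal.ofReal (mixtureDensity M v) = ∫⁻ s, ENNReal.ofReal (heat s v) ∂M :=
  ofReal_integral_eq_lintegral_ofReal (integrable_heat hv) (ae_of_all _ fun _ => heat_nonneg _ _)

lemma measurable_mixtureDensity : Measurable (mixtureDensity M) :=
  (StronglyMeasurable.integral_prod_right (f := fun v s : ℝ => heat s v) (by
    exact Measurable.stronglyMeasurable (by unfold Function.uncurry; fun_prop))).measurable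

lemma mixtureDensity_le {v w : ℝ} (hv : v ≠ 0) (h : |v| ≤ |w|) :
    mixtureDensity M w ≤ mixtureDensity M v := by
  have hw : w ≠ 0 := by
    rintro rfl
    rw [abs_zero] at h
    exact hv (abs_nonpos_iff.1 h)
  exact integral_mono (integrable_heat hw) (integrable_heat hv) fun s => heat_le_heat h

lemma antitoneOn_mixtureDensity : AntitoneOn (mixtureDensity M) (Set.Ioi 0) := by
  intro v hv w _ h
  have hv' : 0 < v := hv
  exact mixtureDensity_le hv'.ne' (by rw [abs_of_pos hv', abs_of_pos (hv'.trans_le h)]; exact h)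

/-- Variance zero has to be excluded, as it would put an atom at the origin. -/
lemma gaussianMixture_eq_withDensity (hM : ∀ᵐ s ∂M, 0 < s) :
    gaussianMixture M = volume.withDensity fun v => ENNReal.ofReal (mixtureDensity M v) := by
  refine Measure.ext_of_lintegral _ fun F hF => ?_
  rw [lintegral_gaussianMixture M (hM.mono fun s hs => hs.le) hF,
    lintegral_withDensity_eq_lintegral_mul _ measurable_mixtureDensity.ennreal_ofReal hF]
  calc ∫⁻ s, ∫⁻ x, F x ∂(gaussianReal 0 s.toNNReal) ∂M
      = ∫⁻ s, (∫⁻ x, ENNReal.ofReal (heat s x) * F x) ∂M :=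
        lintegral_congr_ae (hM.mono fun s hs => lintegral_gaussianReal_eq hs hF)
    _ = ∫⁻ x, ∫⁻ s, ENNReal.ofReal (heat s x) * F x ∂M :=
        lintegral_lintegral_swap (Measurable.aemeasurable (by
          unfold Function.uncurry; fun_prop))
    _ = _ := by
        -- At the origin the Bochner integral may be zero by convention while the lower integral is
        -- infinite.
        have h0 : ∀ᵐ x : ℝ, x ≠ 0 := by
          simp [ae_iff, measure_singleton]
        refine lintegral_congr_ae (h0.mono fun x hx => ?_)
        dsimp only
        rw [lintegral_mul_const _ (by fun_prop), Pi.mul_apply, ofReal_mixtureDensity hx]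

/-- Moments of the mixture in terms of moments of the variance. -/
lemma integrable_mixtureDensity_mul_iff (hM : ∀ᵐ s ∂M, 0 < s) {r : ℝ} (hr : 0 < r) :
    Integrable (fun v => mixtureDensity M v * |v| ^ r) ↔
      ∫⁻ s, ENNReal.ofReal s ^ (r / 2) ∂M ≠ ⊤ := by
  have hnn : ∀ v, 0 ≤ mixtureDensity M v * |v| ^ r := fun v =>
    mul_nonneg (mixtureDensity_nonneg v) (by positivity)
  have h1 : Integrable (fun v => mixtureDensity M v * |v| ^ r) ↔
      ∫⁻ v, ENNReal.ofReal (mixtureDensity M v * |v| ^ r) ≠ ⊤ := by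
    rw [← lt_top_iff_ne_top, ← hasFiniteIntegral_iff_ofReal (ae_of_all _ hnn), Integrable,
      and_iff_right]
    exact (measurable_mixtureDensity.mul (by fun_prop)).aestronglyMeasurable
  have h2 : ∫⁻ v, ENNReal.ofReal (mixtureDensity M v * |v| ^ r) =
      ∫⁻ v, ENNReal.ofReal (|v| ^ r) ∂(gaussianMixture M) := by
    rw [gaussianMixture_eq_withDensity hM, lintegral_withDensity_eq_lintegral_mul _
      measurable_mixtureDensity.ennreal_ofReal (by fun_prop)]
    refine lintegral_congr fun v => ?_
    rw [Pi.mul_apply, ENNReal.ofReal_mul (mixtureDensity_nonneg v)]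
  rw [h1, h2, lintegral_gaussianMixture M (hM.mono fun s hs => hs.le) (by fun_prop),
    lintegral_congr_ae (hM.mono fun s hs => lintegral_abs_rpow_gaussianReal hs r),
    lintegral_mul_const _ (by fun_prop), Ne, Ne, ENNReal.mul_eq_top]
  simp [gaussianAbsMoment_ne_zero, gaussianAbsMoment_ne_top hr.le]

end MixtureDensity

/-! ### Analyticity of Gaussian mixtures -/

section Analytic

/-- The holomorphic extension of the Gaussian density. -/
noncomputable def complexHeat (s : ℝ) (z : ℂ) : ℂ :=
  ((√(2 * Real.pi * s))⁻¹ : ℝ) * Complex.exp (-z ^ 2 / (2 * s))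

lemma complexHeat_ofReal (s v : ℝ) : complexHeat s v = heat s v := by
  rw [complexHeat, heat]; push_cast; rfl

lemma norm_complexHeat (s : ℝ) (z : ℂ) :
    ‖complexHeat s z‖ = (√(2 * Real.pi * s))⁻¹ * Real.exp (-(z ^ 2).re / (2 * s)) := by
  rw [complexHeat, norm_mul, Complex.norm_real, Real.norm_of_nonneg (by positivity),
    Complex.norm_exp]
  congr 2
  have : -z ^ 2 / (2 * (s : ℂ)) = -z ^ 2 / ((2 * s : ℝ) : ℂ) := by push_cast; rfl
  rw [this, Complex.div_ofReal_re, Complex.neg_re]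

lemma hasDerivAt_complexHeat (s : ℝ) (z : ℂ) :
    HasDerivAt (complexHeat s) (complexHeat s z * (-z / s)) z := by
  have h1 : HasDerivAt (fun z : ℂ => -z ^ 2 / (2 * (s : ℂ))) (-z / s) z := by
    have h := ((hasDerivAt_pow 2 z).neg.div_const (2 * (s : ℂ)))
    refine h.congr_deriv ?_
    rcases eq_or_ne (s : ℂ) 0 with hs | hs
    · simp [hs]
    · field_simp
      simp
  refine ((h1.cexp).const_mul (((√(2 * Real.pi * s))⁻¹ : ℝ) : ℂ)).congr_deriv ?_
  rw [complexHeat]; ring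

lemma measurable_complexHeat (z : ℂ) : Measurable fun s => complexHeat s z := by
  unfold complexHeat; fun_prop

variable {M : Measure ℝ} [IsProbabilityMeasure M]

/-- Differentiation under the integral shows that the holomorphic extension is differentiable in a
complex disc, hence analytic; restrict to the real axis and take real parts. -/
lemma analyticAt_mixtureDensity {v δ K : ℝ} (hδ : 0 < δ)
    (hb : ∀ᵐ s ∂M, ∀ z ∈ Metric.ball (v : ℂ) δ, ‖complexHeat s z‖ ≤ K ∧
      ‖complexHeat s z * (-z / s)‖ ≤ K) : AnalyticAt ℝ (mixtureDensity M) v := by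
  have hint : ∀ z ∈ Metric.ball (v : ℂ) δ, Integrable (fun s => complexHeat s z) M :=
    fun z hz => Integrable.of_bound (measurable_complexHeat z).aestronglyMeasurable K
      (hb.mono fun s hs => (hs z hz).1)
  have hd : DifferentiableOn ℂ (fun z => ∫ s, complexHeat s z ∂M) (Metric.ball (v : ℂ) δ) := by
    intro z hz
    refine (hasDerivAt_integral_of_dominated_loc_of_deriv_le (bound := fun _ => K)
      (F' := fun z s => complexHeat s z * (-z / s)) (Metric.isOpen_ball.mem_nhds hz)
      (Eventually.of_forall fun w => (measurable_complexHeat w).aestronglyMeasurable) (hint z hz)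
      ?_ (hb.mono fun s hs w hw => (hs w hw).2) (integrable_const _)
      (ae_of_all _ fun s w _ => hasDerivAt_complexHeat s w)).2.differentiableAt.differentiableWithinAt
    exact ((measurable_complexHeat z).mul (by fun_prop)).aestronglyMeasurable
  have ha : AnalyticAt ℂ (fun z => ∫ s, complexHeat s z ∂M) (v : ℂ) :=
    hd.analyticAt (Metric.ball_mem_nhds _ hδ)
  have hr : AnalyticAt ℝ (fun x : ℝ => (∫ s, complexHeat s (x : ℂ) ∂M).re) v :=
    (Complex.reCLM.analyticAt _).comp
      (f := fun x : ℝ => ∫ s, complexHeat s (x : ℂ) ∂M)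
      (ha.restrictScalars.comp (f := fun x : ℝ => (x : ℂ)) (Complex.ofRealCLM.analyticAt v))
  convert hr using 1
  ext x
  simp only [complexHeat_ofReal]
  rw [integral_complex_ofReal, Complex.ofReal_re, mixtureDensity]

lemma exp_neg_le_two_div_sq {y : ℝ} (hy : 0 < y) : Real.exp (-y) ≤ 2 / y ^ 2 := by
  rw [Real.exp_neg, ← one_div, div_le_div_iff₀ (Real.exp_pos _) (by positivity)]
  have := Real.quadratic_le_exp_of_nonneg hy.le
  nlinarith

/-- The factor `s` for small variances is what pays for the `1/s` in the derivative of the Gaussian.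
-/
lemma inv_sqrt_mul_exp_le {a s : ℝ} (ha : 0 < a) (hs : 0 < s) :
    (√(2 * Real.pi * s))⁻¹ * Real.exp (-a / (2 * s)) ≤ (8 / a ^ 2 + 1) * min s 1 := by
  have h1 : √s ≤ √(2 * Real.pi * s) := Real.sqrt_le_sqrt (by nlinarith [Real.pi_gt_three])
  rcases le_total s 1 with h | h
  · rw [min_eq_left h]
    have h2 : s ≤ √s := by
      rw [Real.le_sqrt' hs]; nlinarith
    have h3 : (√(2 * Real.pi * s))⁻¹ ≤ s⁻¹ := inv_anti₀ hs (h2.trans h1)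
    have h4 : Real.exp (-a / (2 * s)) ≤ 8 * s ^ 2 / a ^ 2 := by
      rw [neg_div]
      refine (exp_neg_le_two_div_sq (by positivity)).trans_eq ?_
      field_simp; norm_num
    calc _ ≤ s⁻¹ * (8 * s ^ 2 / a ^ 2) := by gcongr
      _ = 8 / a ^ 2 * s := by field_simp
      _ ≤ _ := by nlinarith
  · rw [min_eq_right h, mul_one]
    have h2 : 1 ≤ √s := Real.one_le_sqrt.2 h
    have h3 : (√(2 * Real.pi * s))⁻¹ ≤ 1 := inv_le_one_of_one_le₀ (h2.trans h1)
    have h4 : Real.exp (-a / (2 * s)) ≤ 1 := by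
      rw [Real.exp_le_one_iff, neg_div]
      have : 0 < a / (2 * s) := by positivity
      linarith
    calc _ ≤ (1 : ℝ) * 1 := by gcongr
      _ ≤ _ := by
        have : 0 < 8 / a ^ 2 := by positivity
        linarith

/-- In the disc of radius `|v|/4` one has `Re z² ≥ (9/16 - 1/16) v²`, so the exponential beats the
singularity at variance zero. -/
lemma analyticAt_mixtureDensity_of_ne_zero (hM : ∀ᵐ s ∂M, 0 < s) {v : ℝ} (hv : v ≠ 0) :
    AnalyticAt ℝ (mixtureDensity M) v := by
  have hv' : 0 < |v| := abs_pos.2 hv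
  set a := v ^ 2 / 2 with ha
  have ha0 : 0 < a := by positivity
  refine analyticAt_mixtureDensity (δ := |v| / 4) (K := (8 / a ^ 2 + 1) * (1 + 2 * |v|))
    (by positivity) (hM.mono fun s hs z hz => ?_)
  have hz1 : ‖z - v‖ < |v| / 4 := by simpa [dist_eq_norm] using hz
  have hre : |z.re - v| < |v| / 4 := by
    have := Complex.abs_re_le_norm (z - v); simp at this; linarith
  have him : |z.im| < |v| / 4 := by
    have := Complex.abs_im_le_norm (z - v); simp at this; linarith
  have hsq : a ≤ (z ^ 2).re := by
    have h1 : (z ^ 2).re = z.re ^ 2 - z.im ^ 2 := by rw [sq]; simp [sq]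
    have h2 : |v| * (3 / 4) ≤ |z.re| := by
      have := abs_sub_abs_le_abs_sub v z.re
      rw [abs_sub_comm] at this; linarith
    have h3 : z.im ^ 2 ≤ (|v| / 4) ^ 2 := by
      rw [← sq_abs]; gcongr
    have h4 : (|v| * (3 / 4)) ^ 2 ≤ z.re ^ 2 := by
      rw [← sq_abs z.re]; gcongr
    have h5 : |v| ^ 2 = v ^ 2 := sq_abs v
    rw [h1, ha]; nlinarith
  have hnz : ‖z‖ ≤ 2 * |v| := by
    have h1 := norm_add_le (z - v) (v : ℂ)
    rw [sub_add_cancel, Complex.norm_real, Real.norm_eq_abs] at h1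
    linarith
  have hF : ‖complexHeat s z‖ ≤ (8 / a ^ 2 + 1) * min s 1 := by
    rw [norm_complexHeat]
    refine le_trans ?_ (inv_sqrt_mul_exp_le ha0 hs)
    gcongr
  have hc : 0 ≤ 8 / a ^ 2 + 1 := by positivity
  constructor
  · calc _ ≤ (8 / a ^ 2 + 1) * min s 1 := hF
      _ ≤ (8 / a ^ 2 + 1) * (1 + 2 * |v|) := by
        gcongr
        exact (min_le_right _ _).trans (by linarith)
  · rw [norm_mul, norm_div, norm_neg, Complex.norm_real, Real.norm_of_nonneg hs.le]
    calc _ ≤ (8 / a ^ 2 + 1) * min s 1 * (2 * |v| / s) := by gcongr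
      _ = (8 / a ^ 2 + 1) * (2 * |v|) * (min s 1 / s) := by ring
      _ ≤ (8 / a ^ 2 + 1) * (2 * |v|) * 1 := by
        gcongr
        exact (div_le_one hs).2 (min_le_left _ _)
      _ ≤ _ := by rw [mul_one]; gcongr; linarith

/-- With the variance bounded below, a crude bound on `Re z²` suffices, also at the origin. -/
lemma analyticAt_mixtureDensity_of_le {s₀ : ℝ} (hs₀ : 0 < s₀) (hM : ∀ᵐ s ∂M, s₀ ≤ s) (v : ℝ) :
    AnalyticAt ℝ (mixtureDensity M) v := by
  set R := |v| + 1 with hR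
  have hR0 : 0 < R := by positivity
  set B := (√(2 * Real.pi * s₀))⁻¹ * Real.exp (R ^ 2 / (2 * s₀)) with hB
  have hB0 : 0 ≤ B := by positivity
  refine analyticAt_mixtureDensity (δ := 1) (K := B * (1 + R / s₀)) one_pos
    (hM.mono fun s hs z hz => ?_)
  have hs0 : 0 < s := hs₀.trans_le hs
  have hz1 : ‖z - v‖ < 1 := by simpa [dist_eq_norm] using hz
  have hnz : ‖z‖ ≤ R := by
    have h1 := norm_add_le (z - v) (v : ℂ)
    rw [sub_add_cancel, Complex.norm_real, Real.norm_eq_abs] at h1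
    linarith
  have hF : ‖complexHeat s z‖ ≤ B := by
    rw [norm_complexHeat, hB]
    have h1 : -(z ^ 2).re / (2 * s) ≤ R ^ 2 / (2 * s₀) := by
      have h2 : -(z ^ 2).re ≤ R ^ 2 := by
        have h3 := Complex.abs_re_le_norm (z ^ 2)
        rw [norm_pow] at h3
        have h4 := neg_abs_le (z ^ 2).re
        have h5 : ‖z‖ ^ 2 ≤ R ^ 2 := by gcongr
        linarith
      calc -(z ^ 2).re / (2 * s) ≤ R ^ 2 / (2 * s) := by gcongr
        _ ≤ _ := by gcongr
    gcongr
  have hRs : 0 ≤ R / s₀ := by positivity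
  constructor
  · nlinarith
  · rw [norm_mul, norm_div, norm_neg, Complex.norm_real, Real.norm_of_nonneg hs0.le]
    calc _ ≤ B * (R / s₀) := by gcongr
      _ ≤ _ := by nlinarith

end Analytic

/-! ### The collision operator on mixture densities and the stationary equation -/

section CollisionDensity

lemma collisionIntegrand_nonneg (M : Measure ℝ) (v w θ : ℝ) :
    0 ≤ collisionIntegrand (mixtureDensity M) (mixtureDensity M) v w θ :=
  mul_nonneg (mixtureDensity_nonneg _) (mixtureDensity_nonneg _)

variable {M : Measure ℝ} [IsProbabilityMeasure M]

/-- The law of the variance after a collision. -/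
noncomputable def collisionVariance (M : Measure ℝ) : Measure ℝ :=
  (uniformAngle.prod (M.prod M)).map
    fun x => Real.cos x.1 ^ 2 * x.2.1 + Real.sin x.1 ^ 2 * x.2.2

instance : IsProbabilityMeasure (collisionVariance M) :=
  Measure.isProbabilityMeasure_map (by fun_prop)

lemma lintegral_collisionVariance {F : ℝ → ℝ≥0∞} (hF : Measurable F) :
    ∫⁻ s, F s ∂(collisionVariance M) = ∫⁻ θ, ∫⁻ a, ∫⁻ b,
      F (Real.cos θ ^ 2 * a + Real.sin θ ^ 2 * b) ∂M ∂M ∂uniformAngle := by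
  rw [collisionVariance, lintegral_map hF (by fun_prop), lintegral_prod _ (by fun_prop)]
  refine lintegral_congr fun θ => ?_
  rw [lintegral_prod _ (by fun_prop)]

lemma ae_pos_collisionVariance (hM : ∀ᵐ s ∂M, 0 < s) : ∀ᵐ s ∂(collisionVariance M), 0 < s := by
  rw [collisionVariance, ae_map_iff (by fun_prop) measurableSet_Ioi]
  refine Measure.ae_prod_mem_iff_ae_ae_mem (s := {x : ℝ × ℝ × ℝ | 0 < Real.cos x.1 ^ 2 * x.2.1 +
    Real.sin x.1 ^ 2 * x.2.2}) (measurableSet_lt measurable_const (by fun_prop)) |>.2 ?_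
  refine ae_of_all _ fun θ => ?_
  refine Measure.ae_prod_mem_iff_ae_ae_mem (s := {x : ℝ × ℝ | 0 < Real.cos θ ^ 2 * x.1 +
    Real.sin θ ^ 2 * x.2}) (measurableSet_lt measurable_const (by fun_prop)) |>.2 ?_
  filter_upwards [hM] with a ha
  filter_upwards [hM] with b hb
  have hcs := Real.cos_sq_add_sin_sq θ
  rcases eq_or_ne (Real.cos θ) 0 with hc | hc
  · rw [hc] at hcs ⊢
    nlinarith
  · have : 0 < Real.cos θ ^ 2 * a := by positivity
    have : 0 ≤ Real.sin θ ^ 2 * b := by positivity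
    linarith

/-- At a nondegenerate angle only two values of `w` send an argument to the origin, where the
density need not equal the lower integral; then Tonelli and `lintegral_heat_mul_heat` apply. -/
lemma ae_lintegral_collision (hM : ∀ᵐ s ∂M, 0 < s) (v : ℝ) {θ : ℝ}
    (hθ : Real.sin θ * Real.cos θ ≠ 0) :
    ∫⁻ w, ENNReal.ofReal (collisionIntegrand (mixtureDensity M) (mixtureDensity M) v w θ) =
      ∫⁻ a, ∫⁻ b, ENNReal.ofReal (heat (Real.cos θ ^ 2 * a + Real.sin θ ^ 2 * b) v) ∂M ∂M := by
  have hs : Real.sin θ ≠ 0 := left_ne_zero_of_mul hθ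
  have hc : Real.cos θ ≠ 0 := right_ne_zero_of_mul hθ
  have h0 : ∀ᵐ w : ℝ, v * Real.cos θ - w * Real.sin θ ≠ 0 ∧ v * Real.sin θ + w * Real.cos θ ≠ 0 := by
    have h1 : ∀ᵐ w : ℝ, w ≠ v * Real.cos θ / Real.sin θ := by simp [ae_iff, measure_singleton]
    have h2 : ∀ᵐ w : ℝ, w ≠ -(v * Real.sin θ) / Real.cos θ := by simp [ae_iff, measure_singleton]
    filter_upwards [h1, h2] with w hw1 hw2
    constructor
    · intro h; apply hw1; field_simp; linarith
    · intro h; apply hw2; field_simp; linarith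
  calc ∫⁻ w, ENNReal.ofReal (collisionIntegrand (mixtureDensity M) (mixtureDensity M) v w θ)
      = ∫⁻ w, ∫⁻ a, ∫⁻ b, ENNReal.ofReal (heat a (v * Real.cos θ - w * Real.sin θ) *
          heat b (v * Real.sin θ + w * Real.cos θ)) ∂M ∂M := by
        refine lintegral_congr_ae (h0.mono fun w hw => ?_)
        dsimp only
        rw [collisionIntegrand, ENNReal.ofReal_mul (mixtureDensity_nonneg _),
          ofReal_mixtureDensity hw.1, ofReal_mixtureDensity hw.2,
          ← lintegral_mul_const _ (by fun_prop)]
        refine lintegral_congr fun a => ?_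
        rw [← lintegral_const_mul _ (by fun_prop)]
        refine lintegral_congr fun b => ?_
        rw [ENNReal.ofReal_mul (heat_nonneg _ _)]
    _ = ∫⁻ a, (∫⁻ w, ∫⁻ b, ENNReal.ofReal (heat a (v * Real.cos θ - w * Real.sin θ) *
          heat b (v * Real.sin θ + w * Real.cos θ)) ∂M) ∂M := by
        refine lintegral_lintegral_swap (Measurable.aemeasurable ?_)
        exact Measurable.lintegral_prod_right' (f := fun p : (ℝ × ℝ) × ℝ =>
          ENNReal.ofReal (heat p.1.2 (v * Real.cos θ - p.1.1 * Real.sin θ) *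
            heat p.2 (v * Real.sin θ + p.1.1 * Real.cos θ))) (by fun_prop)
    _ = _ := by
        refine lintegral_congr_ae (hM.mono fun a ha => ?_)
        dsimp only
        rw [lintegral_lintegral_swap (Measurable.aemeasurable (by
          unfold Function.uncurry; fun_prop))]
        exact lintegral_congr_ae (hM.mono fun b hb => lintegral_heat_mul_heat ha hb θ v)

lemma measurable_collisionIntegrand (v : ℝ) : Measurable fun x : ℝ × ℝ =>
    collisionIntegrand (mixtureDensity M) (mixtureDensity M) v x.1 x.2 :=
  (measurable_mixtureDensity.comp (by fun_prop)).mul (measurable_mixtureDensity.comp (by fun_prop))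

lemma lintegral_collisionIntegrand (hM : ∀ᵐ s ∂M, 0 < s) {v : ℝ} (hv : v ≠ 0) :
    ∫⁻ x : ℝ × ℝ, ENNReal.ofReal (collisionIntegrand (mixtureDensity M) (mixtureDensity M) v x.1 x.2)
      ∂(volume.prod (volume.restrict (Set.Ioc 0 (2 * Real.pi)))) =
      ENNReal.ofReal (2 * Real.pi * mixtureDensity (collisionVariance M) v) := by
  have hpi : ENNReal.ofReal (2 * Real.pi) ≠ 0 := by simp [Real.pi_pos]
  rw [lintegral_prod_symm _ (measurable_collisionIntegrand v).ennreal_ofReal.aemeasurable,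
    ENNReal.ofReal_mul (by positivity), ofReal_mixtureDensity hv,
    lintegral_collisionVariance (by fun_prop), uniformAngle_eq, lintegral_smul_measure, smul_eq_mul,
    ← mul_assoc, ENNReal.mul_inv_cancel hpi ENNReal.ofReal_ne_top, one_mul]
  have h0 : ∀ᵐ θ ∂(volume.restrict (Set.Ioc 0 (2 * Real.pi))), Real.sin θ * Real.cos θ ≠ 0 := by
    refine ae_restrict_of_ae ?_
    filter_upwards [measure_eq_zero_iff_ae_notMem.1 volume_sin_mul_cos_eq_zero] with θ hθ h
    exact hθ h
  exact lintegral_congr_ae (h0.mono fun θ hθ => ae_lintegral_collision hM v hθ)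

lemma integrable_collisionIntegrand (hM : ∀ᵐ s ∂M, 0 < s) {v : ℝ} (hv : v ≠ 0) :
    Integrable (fun x : ℝ × ℝ =>
      collisionIntegrand (mixtureDensity M) (mixtureDensity M) v x.1 x.2)
      (volume.prod (volume.restrict (Set.Ioc 0 (2 * Real.pi)))) := by
  refine ⟨(measurable_collisionIntegrand v).aestronglyMeasurable, ?_⟩
  rw [hasFiniteIntegral_iff_ofReal (ae_of_all _ fun x => collisionIntegrand_nonneg M _ _ _), lintegral_collisionIntegrand hM hv]
  exact ENNReal.ofReal_lt_top

lemma B2density_mixtureDensity (hM : ∀ᵐ s ∂M, 0 < s) {v : ℝ} (hv : v ≠ 0) :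
    B2density (mixtureDensity M) (mixtureDensity M) v = mixtureDensity (collisionVariance M) v := by
  have h1 : ∀ w, ∫ θ in (0 : ℝ)..(2 * Real.pi),
      collisionIntegrand (mixtureDensity M) (mixtureDensity M) v w θ =
      ∫ θ in Set.Ioc 0 (2 * Real.pi),
      collisionIntegrand (mixtureDensity M) (mixtureDensity M) v w θ := fun w =>
    intervalIntegral.integral_of_le (by positivity)
  simp only [B2density, h1]
  rw [integral_div, ← integral_prod (fun x : ℝ × ℝ =>
      collisionIntegrand (mixtureDensity M) (mixtureDensity M) v x.1 x.2)
      (integrable_collisionIntegrand hM hv), integral_eq_lintegral_of_nonneg_ae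
      (ae_of_all _ fun x => collisionIntegrand_nonneg M _ _ _)
      (measurable_collisionIntegrand v).aestronglyMeasurable, lintegral_collisionIntegrand hM hv,
      ENNReal.toReal_ofReal (mul_nonneg (by positivity) (mixtureDensity_nonneg _))]
  field_simp

end CollisionDensity

section StationaryEquation

variable {lam mu E T : ℝ} {M : Measure ℝ}

/-- The gain term of the stationary equation, as a density. -/
noncomputable def gainDensity (lam mu T : ℝ) (M : Measure ℝ) (v : ℝ) : ℝ :=
  2 * lam * mixtureDensity (collisionVariance M) v + mu * heat T v

lemma gainDensity_nonneg (hlam : 0 ≤ lam) (hmu : 0 ≤ mu) (v : ℝ) :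
    0 ≤ gainDensity lam mu T M v :=
  add_nonneg (mul_nonneg (by positivity) (mixtureDensity_nonneg _))
    (mul_nonneg hmu (heat_nonneg _ _))

lemma measurable_gainDensity [IsProbabilityMeasure M] : Measurable (gainDensity lam mu T M) :=
  (measurable_mixtureDensity.const_mul _).add ((by fun_prop : Measurable (heat T)).const_mul _)

/-- The factor `|v|` compensates a possible blow-up at the origin. For this reason the stationary
equation is derived for `v f(v)` rather than `f`. -/
lemma abs_mul_mixtureDensity_le {M : Measure ℝ} [IsProbabilityMeasure M] (v : ℝ) :
    |v| * mixtureDensity M v ≤ 1 := by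
  rw [mixtureDensity, ← integral_const_mul]
  exact (le_abs_self _).trans (abs_integral_le_of_bounded fun s => by
    rw [abs_of_nonneg (mul_nonneg (abs_nonneg _) (heat_nonneg _ _))]; exact abs_mul_heat_le s v)

lemma abs_mul_gainDensity_le [IsProbabilityMeasure M] (hlam : 0 ≤ lam) (hmu : 0 ≤ mu) (v : ℝ) :
    |v * gainDensity lam mu T M v| ≤ 2 * lam + mu := by
  rw [abs_mul, abs_of_nonneg (gainDensity_nonneg hlam hmu v), gainDensity]
  have h1 := abs_mul_mixtureDensity_le (M := collisionVariance M) v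
  have h2 := abs_mul_heat_le T v
  nlinarith

lemma continuousAt_gainDensity [IsProbabilityMeasure M] (hM : ∀ᵐ s ∂M, 0 < s) {v : ℝ}
    (hv : v ≠ 0) : ContinuousAt (gainDensity lam mu T M) v := by
  have h1 : Continuous (heat T) := by unfold heat; fun_prop
  exact ((analyticAt_mixtureDensity_of_ne_zero (ae_pos_collisionVariance hM)
    hv).continuousAt.const_mul _).add (h1.continuousAt.const_mul _)

/-- The stationary density as a superposition of rescaled gain densities. -/
lemma IsVarianceLaw.mul_mixtureDensity_eq (hM : IsVarianceLaw lam mu E T M) (hlam : 0 ≤ lam)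
    (hmu : 0 ≤ mu) (hpos : 0 < 2 * lam + mu) {v : ℝ} (hv : v ≠ 0) :
    v * mixtureDensity M v = ∫ u in Set.Ioi 0, Real.exp (-(2 * lam + mu) * u) *
      ((Real.exp (-drift mu E T * u) * v) *
        gainDensity lam mu T M (Real.exp (-drift mu E T * u) * v)) := by
  have := hM.prob
  set k := 2 * lam + mu with hk
  set A := drift mu E T with hA
  have hscale : ∀ u s : ℝ, heat (Real.exp (2 * A * u) * s) v =
      Real.exp (-A * u) * heat s (Real.exp (-A * u) * v) := fun u s => by
    have := heat_exp_mul (A * u) s v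
    rw [show 2 * (A * u) = 2 * A * u by ring, ← neg_mul] at this
    exact this
  have hne : ∀ u, Real.exp (-A * u) * v ≠ 0 := fun u => mul_ne_zero (Real.exp_ne_zero _) hv
  have hcol : ∀ u, ∫⁻ θ, ∫⁻ a, ∫⁻ b, ENNReal.ofReal
      (heat (Real.exp (2 * A * u) * (Real.cos θ ^ 2 * a + Real.sin θ ^ 2 * b)) v) ∂M ∂M
      ∂uniformAngle = ENNReal.ofReal (Real.exp (-A * u) *
        mixtureDensity (collisionVariance M) (Real.exp (-A * u) * v)) := by
    intro u
    rw [← lintegral_collisionVariance (F := fun s =>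
      ENNReal.ofReal (heat (Real.exp (2 * A * u) * s) v)) (by fun_prop)]
    simp only [hscale]
    rw [ENNReal.ofReal_mul (by positivity), ofReal_mixtureDensity (hne u),
      ← lintegral_const_mul _ (by fun_prop)]
    refine lintegral_congr fun s => ?_
    rw [ENNReal.ofReal_mul (p := Real.exp (-A * u)) (by positivity)]
  have hfix := hM.fixed (fun s => ENNReal.ofReal (heat s v)) (by fun_prop)
  rw [varianceStep, ← ofReal_mixtureDensity hv] at hfix
  simp only [← hA, hcol] at hfix
  simp only [hscale, lintegral_expLaw, ← hk] at hfix
  have hmeas1 : Measurable fun u : ℝ => mixtureDensity (collisionVariance M)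
      (Real.exp (-A * u) * v) := measurable_mixtureDensity.comp (by fun_prop)
  have hmeas2 : Measurable fun u : ℝ => gainDensity lam mu T M (Real.exp (-A * u) * v) :=
    measurable_gainDensity.comp (by fun_prop)
  rw [← lintegral_const_mul _ (by fun_prop), ← lintegral_const_mul _ (by fun_prop),
    ← lintegral_add_left (by fun_prop)] at hfix
  have hpt : ∀ u : ℝ, ENNReal.ofReal (2 * lam / k) * (ENNReal.ofReal (k * Real.exp (-k * u)) *
      ENNReal.ofReal (Real.exp (-A * u) *
        mixtureDensity (collisionVariance M) (Real.exp (-A * u) * v))) +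
      ENNReal.ofReal (mu / k) * (ENNReal.ofReal (k * Real.exp (-k * u)) *
      ENNReal.ofReal (Real.exp (-A * u) * heat T (Real.exp (-A * u) * v))) =
      ENNReal.ofReal (Real.exp (-k * u) *
        (Real.exp (-A * u) * gainDensity lam mu T M (Real.exp (-A * u) * v))) := by
    intro u
    have h1 := mixtureDensity_nonneg (M := collisionVariance M) (Real.exp (-A * u) * v)
    have h2 := heat_nonneg T (Real.exp (-A * u) * v)
    rw [← ENNReal.ofReal_mul (by positivity), ← ENNReal.ofReal_mul (by positivity),
      ← ENNReal.ofReal_mul (by positivity), ← ENNReal.ofReal_mul (by positivity),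
      ← ENNReal.ofReal_add (by positivity) (by positivity), gainDensity]
    congr 1
    field_simp
  simp only [hpt] at hfix
  have hval : mixtureDensity M v = ∫ u in Set.Ioi 0, Real.exp (-k * u) *
      (Real.exp (-A * u) * gainDensity lam mu T M (Real.exp (-A * u) * v)) := by
    rw [integral_eq_lintegral_of_nonneg_ae (ae_of_all _ fun u => ?_)
      (Measurable.aestronglyMeasurable (by fun_prop)), ← hfix,
      ENNReal.toReal_ofReal (mixtureDensity_nonneg v)]
    exact mul_nonneg (by positivity) (mul_nonneg (by positivity) (gainDensity_nonneg hlam hmu _))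
  rw [hval, ← integral_const_mul]
  refine integral_congr_ae (ae_of_all _ fun u => ?_)
  dsimp only
  ring

/-- The stationary equation holds pointwise away from the origin. -/
theorem IsVarianceLaw.drift_mul_deriv (hM : IsVarianceLaw lam mu E T M) (hlam : 0 ≤ lam)
    (hmu : 0 ≤ mu) (hpos : 0 < 2 * lam + mu) (hM0 : ∀ᵐ s ∂M, 0 < s) {v : ℝ} (hv : v ≠ 0) :
    drift mu E T * deriv (fun u => u * mixtureDensity M u) v =
      gainDensity lam mu T M v - (2 * lam + mu) * mixtureDensity M v := by
  have := hM.prob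
  set k := 2 * lam + mu
  set A := drift mu E T with hA
  set w : ℝ → ℝ := fun u => u * mixtureDensity M u with hw
  set G : ℝ → ℝ := fun r => (Real.exp (-A * r) * v) *
    gainDensity lam mu T M (Real.exp (-A * r) * v) with hG
  -- The function along the dilation orbit of `v`. Its derivative at time zero is computed twice, by
  -- the integral equation and by the chain rule; the case `A = 0` is included.
  set a : ℝ → ℝ := fun t => w (Real.exp (A * t) * v) with ha
  have hne : ∀ u, Real.exp u * v ≠ 0 := fun u => mul_ne_zero (Real.exp_ne_zero _) hv
  have hGm : Measurable G := by
    have : Measurable fun r : ℝ => gainDensity lam mu T M (Real.exp (-A * r) * v) :=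
      measurable_gainDensity.comp (by fun_prop)
    fun_prop
  have hat : ∀ t, a t = ∫ u in Set.Ioi 0, Real.exp (-k * u) * G (u - t) := by
    intro t
    have h := hM.mul_mixtureDensity_eq hlam hmu hpos (hne (A * t))
    simp only [ha, hw, h, hG]
    refine integral_congr_ae (ae_of_all _ fun u => ?_)
    have h1 : Real.exp (-A * u) * (Real.exp (A * t) * v) = Real.exp (-A * (u - t)) * v := by
      rw [← mul_assoc, ← Real.exp_add]; congr 2; ring
    simp only [← hA]
    rw [h1]
  have hint : ∀ t : ℝ, 0 ≤ t → a t = a 0 + ∫ s in (0 : ℝ)..t, (G (-s) - k * a s) := fun t ht =>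
    integral_eq_of_fixedPoint hpos hGm (fun r => abs_mul_gainDensity_le hlam hmu _) hat ht
  have hwd : ∀ u, u ≠ 0 → DifferentiableAt ℝ w u := fun u hu =>
    differentiableAt_id.mul (analyticAt_mixtureDensity_of_ne_zero hM0 hu).differentiableAt
  have hac : Continuous a := continuous_iff_continuousAt.2 fun t =>
    (hwd _ (hne _)).continuousAt.comp (f := fun t => Real.exp (A * t) * v)
      (Continuous.continuousAt (by fun_prop))
  have hGc : Continuous G := continuous_iff_continuousAt.2 fun t =>
    (Continuous.continuousAt (by fun_prop)).mul
      ((continuousAt_gainDensity hM0 (hne _)).comp (f := fun r => Real.exp (-A * r) * v)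
      (Continuous.continuousAt (by fun_prop)))
  -- The integral equation is known for `t ≥ 0` only, so this is a one-sided derivative; it still
  -- determines the value.
  have hd1 : HasDerivWithinAt a (G 0 - k * a 0) (Set.Ici 0) 0 := by
    have hc : Continuous fun s => G (-s) - k * a s := by fun_prop
    have h1 := (hc.integral_hasStrictDerivAt 0 0).hasDerivAt.const_add (a 0)
    rw [neg_zero] at h1
    exact h1.hasDerivWithinAt.congr (fun t ht => hint t ht) (hint 0 le_rfl)
  have hd2 : HasDerivAt a (deriv w v * (A * v)) 0 := by
    have h1 : HasDerivAt (fun t : ℝ => Real.exp (A * t) * v) (A * v) 0 := by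
      have h2 : HasDerivAt (fun t : ℝ => A * t) A 0 := by
        simpa using (hasDerivAt_id (0 : ℝ)).const_mul A
      simpa using h2.exp.mul_const v
    refine HasDerivAt.comp (h₂ := w) (h := fun t : ℝ => Real.exp (A * t) * v) 0 ?_ h1
    simpa using (hwd v hv).hasDerivAt
  have huniq := (uniqueDiffWithinAt_Ici (0 : ℝ)).eq_deriv _ hd1 hd2.hasDerivWithinAt
  have hG0 : G 0 = v * gainDensity lam mu T M v := by simp [hG]
  have ha0 : a 0 = v * mixtureDensity M v := by simp [ha, hw]
  rw [hG0, ha0] at huniq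
  refine mul_left_cancel₀ hv ?_
  linarith

end StationaryEquation

/-! ### Fourier transform of Gaussian mixtures -/

section Fourier

lemma fourier_heat {s : ℝ} (hs : 0 < s) (ξ : ℝ) :
    𝓕 (fun v => (heat s v : ℂ)) ξ = (Real.exp (-(2 * Real.pi ^ 2 * ξ ^ 2 * s)) : ℂ) := by
  have h := charFun_gaussianReal (μ := 0) (v := s.toNNReal) (-2 * Real.pi * ξ)
  rw [charFun_apply_real, integral_gaussianReal_eq_integral_smul (by simpa using hs)] at h
  rw [Real.fourier_real_eq_integral_exp_smul]
  calc ∫ v : ℝ, Complex.exp (↑(-2 * Real.pi * v * ξ) * Complex.I) • (heat s v : ℂ)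
      = ∫ x, gaussianPDFReal 0 s.toNNReal x •
          Complex.exp (((-2 * Real.pi * ξ : ℝ) : ℂ) * x * Complex.I) := by
        refine integral_congr_ae (ae_of_all _ fun v => ?_)
        dsimp only
        rw [heat_eq_gaussianPDFReal hs.le, smul_eq_mul, Complex.real_smul, mul_comm]
        congr 2
        push_cast; ring
    _ = _ := by
        rw [h, Complex.ofReal_exp, Real.coe_toNNReal _ hs.le]
        congr 1
        push_cast
        ring

variable {M : Measure ℝ}

/-- The Fourier transform of the Gaussian mixture with variance law `M`. -/
noncomputable def mixtureFourier (M : Measure ℝ) (ξ : ℝ) : ℝ :=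
  ∫ s, Real.exp (-(2 * Real.pi ^ 2 * ξ ^ 2 * s)) ∂M

lemma fourier_integral [SFinite M] {K : ℝ → ℝ → ℝ}
    (hK : Integrable (Function.uncurry K) (volume.prod M)) (ξ : ℝ) :
    𝓕 (fun x => ((∫ s, K x s ∂M : ℝ) : ℂ)) ξ = ∫ s, 𝓕 (fun x => (K x s : ℂ)) ξ ∂M := by
  simp only [Real.fourier_real_eq_integral_exp_smul]
  rw [← integral_integral_swap]
  · refine integral_congr_ae (ae_of_all _ fun x => ?_)
    dsimp only
    rw [← integral_complex_ofReal, integral_smul]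
  · have h : Integrable (fun z : ℝ × ℝ => (K z.1 z.2 : ℂ)) (volume.prod M) := hK.ofReal
    have h' : Integrable (fun z : ℝ × ℝ => Complex.exp (↑(-2 * Real.pi * z.1 * ξ) * Complex.I) *
        (K z.1 z.2 : ℂ)) (volume.prod M) := by
      refine Integrable.bdd_mul (c := 1) h ?_ (ae_of_all _ fun z => ?_)
      · exact Continuous.aestronglyMeasurable (by fun_prop)
      · rw [Complex.norm_exp_ofReal_mul_I]
    exact h'

lemma mixtureFourier_nonneg (ξ : ℝ) : 0 ≤ mixtureFourier M ξ :=
  integral_nonneg fun _ => (Real.exp_pos _).le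

variable [IsProbabilityMeasure M]

lemma integrable_exp_neg_mul (hM : ∀ᵐ s ∂M, 0 < s) (ξ : ℝ) :
    Integrable (fun s => Real.exp (-(2 * Real.pi ^ 2 * ξ ^ 2 * s))) M := by
  refine Integrable.of_bound (Measurable.aestronglyMeasurable (by fun_prop)) 1
    (hM.mono fun s hs => ?_)
  rw [Real.norm_eq_abs, abs_of_pos (Real.exp_pos _), Real.exp_le_one_iff]
  have : 0 ≤ 2 * Real.pi ^ 2 * ξ ^ 2 * s := by positivity
  linarith

lemma mixtureFourier_le_one (hM : ∀ᵐ s ∂M, 0 < s) (ξ : ℝ) : mixtureFourier M ξ ≤ 1 := by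
  have h : mixtureFourier M ξ ≤ ∫ _, (1 : ℝ) ∂M := by
    refine integral_mono_ae (integrable_exp_neg_mul hM ξ) (integrable_const _)
      (hM.mono fun s hs => ?_)
    dsimp only
    rw [Real.exp_le_one_iff]
    have : 0 ≤ 2 * Real.pi ^ 2 * ξ ^ 2 * s := by positivity
    linarith
  simpa using h

lemma ofReal_mixtureFourier (hM : ∀ᵐ s ∂M, 0 < s) (ξ : ℝ) :
    ENNReal.ofReal (mixtureFourier M ξ) =
      ∫⁻ s, ENNReal.ofReal (Real.exp (-(2 * Real.pi ^ 2 * ξ ^ 2 * s))) ∂M :=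
  ofReal_integral_eq_lintegral_ofReal (integrable_exp_neg_mul hM ξ)
    (ae_of_all _ fun _ => (Real.exp_pos _).le)

lemma measurable_mixtureFourier : Measurable (mixtureFourier M) :=
  (StronglyMeasurable.integral_prod_right
    (f := fun ξ s : ℝ => Real.exp (-(2 * Real.pi ^ 2 * ξ ^ 2 * s))) (by
    exact Measurable.stronglyMeasurable (by unfold Function.uncurry; fun_prop))).measurable

lemma lintegral_heat {s : ℝ} (hs : 0 < s) : ∫⁻ v, ENNReal.ofReal (heat s v) = 1 := by
  simp only [heat_eq_gaussianPDFReal hs.le]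
  exact lintegral_gaussianPDFReal_eq_one _ (by simpa using hs)

lemma fourier_mixtureDensity (hM : ∀ᵐ s ∂M, 0 < s) (ξ : ℝ) :
    𝓕 (fun v => (mixtureDensity M v : ℂ)) ξ = (mixtureFourier M ξ : ℂ) := by
  have hK : Integrable (Function.uncurry fun v s => heat s v) (volume.prod M) := by
    refine ⟨(Measurable.aestronglyMeasurable (by unfold Function.uncurry; fun_prop)), ?_⟩
    change HasFiniteIntegral (fun x : ℝ × ℝ => heat x.2 x.1) _
    rw [hasFiniteIntegral_iff_ofReal (ae_of_all _ fun x => heat_nonneg _ _),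
      lintegral_prod_symm _ (Measurable.aemeasurable (by fun_prop)),
      lintegral_congr_ae (hM.mono fun s hs => lintegral_heat hs)]
    simp
  simp only [mixtureDensity]
  rw [fourier_integral hK, integral_congr_ae (hM.mono fun s hs => fourier_heat hs ξ),
    mixtureFourier, ← integral_complex_ofReal]

/-- The transform of a Gaussian of variance `s` is a multiple of the Gaussian density of variance
`1/(4π²s)`. Weighted integrals in `ξ` thereby become Gaussian absolute moments. -/
lemma exp_eq_heat {s : ℝ} (hs : 0 < s) (ξ : ℝ) :
    Real.exp (-(2 * Real.pi ^ 2 * ξ ^ 2 * s)) =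
      (√(2 * Real.pi * s))⁻¹ * heat (1 / (4 * Real.pi ^ 2 * s)) ξ := by
  have h1 : 2 * Real.pi * (1 / (4 * Real.pi ^ 2 * s)) = (2 * Real.pi * s)⁻¹ := by
    field_simp; ring
  have h2 : -ξ ^ 2 / (2 * (1 / (4 * Real.pi ^ 2 * s))) = -(2 * Real.pi ^ 2 * ξ ^ 2 * s) := by
    field_simp; ring
  have h3 : 0 < √(2 * Real.pi * s) := Real.sqrt_pos.2 (by positivity)
  rw [heat, h1, h2, Real.sqrt_inv, inv_inv, ← mul_assoc, inv_mul_cancel₀ h3.ne', one_mul]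

/-- Weighted integrals of the Fourier transform are negative moments of the variance. -/
lemma lintegral_mixtureFourier_mul (hM : ∀ᵐ s ∂M, 0 < s) (p : ℝ) :
    ∃ c : ℝ≥0∞, c ≠ 0 ∧ (0 ≤ p → c ≠ ⊤) ∧ ∫⁻ ξ, ENNReal.ofReal (mixtureFourier M ξ * |ξ| ^ p) =
      c * ∫⁻ s, ENNReal.ofReal s ^ (-((p + 1) / 2)) ∂M := by
  set c₁ : ℝ := (2 * Real.pi) ^ (-(1 / 2) : ℝ) * (4 * Real.pi ^ 2) ^ (-(p / 2)) with hc₁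
  have hc₁0 : 0 < c₁ := by positivity
  refine ⟨ENNReal.ofReal c₁ * gaussianAbsMoment p, mul_ne_zero (by simpa using hc₁0)
    (gaussianAbsMoment_ne_zero p), fun hp => ENNReal.mul_ne_top ENNReal.ofReal_ne_top
    (gaussianAbsMoment_ne_top hp), ?_⟩
  have h1 : ∀ ξ : ℝ, ENNReal.ofReal (mixtureFourier M ξ * |ξ| ^ p) =
      ∫⁻ s, ENNReal.ofReal (Real.exp (-(2 * Real.pi ^ 2 * ξ ^ 2 * s)) * |ξ| ^ p) ∂M := fun ξ => by
    rw [ENNReal.ofReal_mul (mixtureFourier_nonneg ξ), ofReal_mixtureFourier hM,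
      ← lintegral_mul_const _ (by fun_prop)]
    refine lintegral_congr fun s => ?_
    rw [ENNReal.ofReal_mul (Real.exp_pos _).le]
  simp only [h1]
  rw [lintegral_lintegral_swap (Measurable.aemeasurable (by unfold Function.uncurry; fun_prop)),
    ← lintegral_const_mul _ (by fun_prop)]
  refine lintegral_congr_ae (hM.mono fun s hs => ?_)
  dsimp only
  have hσ : 0 < 1 / (4 * Real.pi ^ 2 * s) := by positivity
  have h2 : ∀ ξ : ℝ, ENNReal.ofReal (Real.exp (-(2 * Real.pi ^ 2 * ξ ^ 2 * s)) * |ξ| ^ p) =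
      ENNReal.ofReal (√(2 * Real.pi * s))⁻¹ *
        (ENNReal.ofReal (heat (1 / (4 * Real.pi ^ 2 * s)) ξ) * ENNReal.ofReal (|ξ| ^ p)) :=
    fun ξ => by
      rw [exp_eq_heat hs, mul_assoc, ENNReal.ofReal_mul (by positivity),
        ENNReal.ofReal_mul (heat_nonneg _ _)]
  simp only [h2]
  rw [lintegral_const_mul _ (by fun_prop), ← lintegral_gaussianReal_eq hσ (by fun_prop),
    lintegral_abs_rpow_gaussianReal hσ, ENNReal.ofReal_rpow_of_pos hσ,
    ENNReal.ofReal_rpow_of_pos hs, ← mul_assoc, mul_right_comm (ENNReal.ofReal c₁),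
    ← ENNReal.ofReal_mul (by positivity), ← ENNReal.ofReal_mul hc₁0.le]
  congr 2
  rw [hc₁, one_div, Real.inv_rpow (by positivity), ← Real.rpow_neg (by positivity),
    Real.sqrt_eq_rpow, ← Real.rpow_neg (by positivity), Real.mul_rpow (by positivity) hs.le,
    Real.mul_rpow (by positivity) hs.le]
  have h3 : s ^ (-((p + 1) / 2)) = s ^ (-(1 / 2) : ℝ) * s ^ (-(p / 2)) := by
    rw [← Real.rpow_add hs]; congr 1; ring
  rw [h3]; ring

lemma integrable_mixtureFourier_mul_iff (hM : ∀ᵐ s ∂M, 0 < s) {p : ℝ} (hp : 0 ≤ p) :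
    Integrable (fun ξ => mixtureFourier M ξ * |ξ| ^ p) ↔
      ∫⁻ s, ENNReal.ofReal s ^ (-((p + 1) / 2)) ∂M ≠ ⊤ := by
  have hnn : ∀ ξ, 0 ≤ mixtureFourier M ξ * |ξ| ^ p := fun ξ =>
    mul_nonneg (mixtureFourier_nonneg ξ) (by positivity)
  obtain ⟨c, hc0, hct, h⟩ := lintegral_mixtureFourier_mul hM p
  have hm : AEStronglyMeasurable (fun ξ => mixtureFourier M ξ * |ξ| ^ p) volume :=
    (measurable_mixtureFourier.mul (by fun_prop)).aestronglyMeasurable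
  rw [Integrable, and_iff_right hm,
    hasFiniteIntegral_iff_ofReal (ae_of_all _ hnn), h, lt_top_iff_ne_top, Ne, Ne,
    ENNReal.mul_eq_top]
  simp [hc0, hct hp]

/-- Fourier inversion, valid also at the origin. -/
lemma fourier_mixtureFourier (hM : ∀ᵐ s ∂M, 0 < s)
    (h : ∫⁻ s, ENNReal.ofReal s ^ (-(1 / 2) : ℝ) ∂M ≠ ⊤) (v : ℝ) :
    𝓕 (fun ξ => (mixtureFourier M ξ : ℂ)) v = (mixtureDensity M v : ℂ) := by
  have hK : Integrable (Function.uncurry fun ξ s : ℝ => Real.exp (-(2 * Real.pi ^ 2 * ξ ^ 2 * s)))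
      (volume.prod M) := by
    refine ⟨(Measurable.aestronglyMeasurable (by unfold Function.uncurry; fun_prop)), ?_⟩
    change HasFiniteIntegral
      (fun x : ℝ × ℝ => Real.exp (-(2 * Real.pi ^ 2 * x.1 ^ 2 * x.2))) _
    rw [hasFiniteIntegral_iff_ofReal (ae_of_all _ fun x => (Real.exp_pos _).le),
      lintegral_prod _ (Measurable.aemeasurable (by fun_prop))]
    obtain ⟨c, -, hct, h'⟩ := lintegral_mixtureFourier_mul hM 0
    simp only [Real.rpow_zero, mul_one, ofReal_mixtureFourier hM, zero_add] at h'
    rw [h']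
    exact ENNReal.mul_lt_top (hct le_rfl).lt_top h.lt_top
  simp only [mixtureFourier]
  rw [fourier_integral hK, mixtureDensity, ← integral_complex_ofReal]
  refine integral_congr_ae (hM.mono fun s hs => ?_)
  have hσ : 0 < 1 / (4 * Real.pi ^ 2 * s) := by positivity
  have h1 := fourier_heat hσ v
  have h2 : (fun ξ : ℝ => ((Real.exp (-(2 * Real.pi ^ 2 * ξ ^ 2 * s)) : ℝ) : ℂ)) =
      fun ξ => (((√(2 * Real.pi * s))⁻¹ : ℝ) : ℂ) • (heat (1 / (4 * Real.pi ^ 2 * s)) ξ : ℂ) := by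
    ext ξ
    rw [exp_eq_heat hs, Complex.ofReal_mul, smul_eq_mul]
  dsimp only
  rw [h2, Real.fourier_real_eq_integral_exp_smul]
  simp only [smul_comm _ (((√(2 * Real.pi * s))⁻¹ : ℝ) : ℂ)]
  rw [integral_smul, ← Real.fourier_real_eq_integral_exp_smul, h1, smul_eq_mul, heat,
    Complex.ofReal_mul]
  congr 3
  field_simp
  ring

end Fourier

/-! ### Regularity of Gaussian mixtures at the origin -/

section Regularity

variable {M : Measure ℝ} [IsProbabilityMeasure M]

/-- Low frequencies are controlled by the bound `1` on the transform, high ones by the power `p`. -/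
lemma integrable_pow_mul_mixtureFourier (hM : ∀ᵐ s ∂M, 0 < s) {p n : ℕ} (hn : n ≤ p)
    (h : ∫⁻ s, ENNReal.ofReal s ^ (-(((p : ℝ) + 1) / 2)) ∂M ≠ ⊤) :
    Integrable fun ξ => |ξ| ^ n * mixtureFourier M ξ := by
  have h1 := (integrable_mixtureFourier_mul_iff hM p.cast_nonneg).2 h
  simp only [Real.rpow_natCast] at h1
  have h2 : Integrable (Set.indicator (Set.Icc (-1 : ℝ) 1) fun _ => (1 : ℝ)) :=
    (integrableOn_const (by simp)).integrable_indicator measurableSet_Icc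
  refine (h2.add h1).mono' (by
    exact (Measurable.mul (by fun_prop) measurable_mixtureFourier).aestronglyMeasurable)
    (ae_of_all _ fun ξ => ?_)
  have h3 := mixtureFourier_nonneg (M := M) ξ
  have h4 := mixtureFourier_le_one hM ξ
  rw [Real.norm_eq_abs, abs_of_nonneg (by positivity), Pi.add_apply]
  by_cases hξ : |ξ| ≤ 1
  · rw [Set.indicator_of_mem (Set.mem_Icc.2 (abs_le.1 hξ))]
    have h5 : |ξ| ^ n ≤ 1 := pow_le_one₀ (abs_nonneg _) hξ
    have h6 : 0 ≤ mixtureFourier M ξ * |ξ| ^ p := by positivity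
    nlinarith
  · rw [Set.indicator_of_notMem (fun h => hξ (abs_le.2 (Set.mem_Icc.1 h))), zero_add, mul_comm]
    exact mul_le_mul_of_nonneg_left (pow_le_pow_right₀ (not_le.1 hξ).le hn) h3

lemma lintegral_rpow_neg_ne_top_of_le (hM : ∀ᵐ s ∂M, 0 < s) {p n : ℕ} (hn : n ≤ p)
    (h : ∫⁻ s, ENNReal.ofReal s ^ (-(((p : ℝ) + 1) / 2)) ∂M ≠ ⊤) :
    ∫⁻ s, ENNReal.ofReal s ^ (-(((n : ℝ) + 1) / 2)) ∂M ≠ ⊤ := by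
  rw [← integrable_mixtureFourier_mul_iff hM n.cast_nonneg]
  have h1 := integrable_pow_mul_mixtureFourier hM hn h
  simpa only [Real.rpow_natCast, mul_comm] using h1

lemma ofReal_mixtureDensity_eq_fourier (hM : ∀ᵐ s ∂M, 0 < s) {p : ℕ}
    (h : ∫⁻ s, ENNReal.ofReal s ^ (-(((p : ℝ) + 1) / 2)) ∂M ≠ ⊤) :
    (fun v => (mixtureDensity M v : ℂ)) = 𝓕 (fun ξ => (mixtureFourier M ξ : ℂ)) := by
  have h0 := lintegral_rpow_neg_ne_top_of_le hM (Nat.zero_le p) h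
  rw [Nat.cast_zero, zero_add] at h0
  ext v
  rw [fourier_mixtureFourier hM h0]

/-- The density is the Fourier transform of a function integrable against `|ξ|^n` for `n ≤ p`. As
inversion holds at every point, it is the density itself, with its value at the origin, that is
smooth. -/
theorem contDiff_mixtureDensity (hM : ∀ᵐ s ∂M, 0 < s) {p : ℕ}
    (h : ∫⁻ s, ENNReal.ofReal s ^ (-(((p : ℝ) + 1) / 2)) ∂M ≠ ⊤) :
    ContDiff ℝ p (mixtureDensity M) := by
  have h1 : ContDiff ℝ ((p : ℕ∞) : WithTop ℕ∞) (𝓕 (fun ξ => (mixtureFourier M ξ : ℂ))) := by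
    refine Real.contDiff_fourier fun n hn => ?_
    have := integrable_pow_mul_mixtureFourier hM (Nat.cast_le.1 hn) h
    refine this.congr (ae_of_all _ fun ξ => ?_)
    dsimp only
    rw [Complex.norm_real, Real.norm_eq_abs, Real.norm_eq_abs,
      abs_of_nonneg (mixtureFourier_nonneg ξ)]
  rw [← ofReal_mixtureDensity_eq_fourier hM h] at h1
  exact Complex.reCLM.contDiff.comp (f := fun v => (mixtureDensity M v : ℂ)) h1

/-- If the density at the origin is formally infinite, then it tends to infinity there. -/
theorem tendsto_mixtureDensity_atTop
    (h : ∫⁻ s, ENNReal.ofReal s ^ (-(1 / 2) : ℝ) ∂M = ⊤) (hM : ∀ᵐ s ∂M, 0 < s) :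
    Tendsto (mixtureDensity M) (𝓝[≠] 0) atTop := by
  set v : ℕ → ℝ := fun n => 1 / ((n : ℝ) + 1) with hv
  have hv0 : ∀ n, 0 < v n := fun n => by simp only [hv]; positivity
  have hlim : Tendsto v atTop (𝓝 0) := tendsto_one_div_add_atTop_nhds_zero_nat
  -- Fatou along one sequence of points gives large values; monotonicity in `|v|` then spreads them
  -- to a whole punctured neighbourhood.
  have hf := lintegral_liminf_le (μ := M) (u := atTop)
    (f := fun (n : ℕ) s => ENNReal.ofReal (heat s (v n))) (fun n => by fun_prop)
  have h1 : ∀ s, 0 < s → liminf (fun n => ENNReal.ofReal (heat s (v n))) atTop =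
      ENNReal.ofReal (√(2 * Real.pi))⁻¹ * ENNReal.ofReal s ^ (-(1 / 2) : ℝ) := by
    intro s hs
    have hc : Continuous (heat s) := by unfold heat; fun_prop
    have h2 : Tendsto (fun n => ENNReal.ofReal (heat s (v n))) atTop
        (𝓝 (ENNReal.ofReal (heat s 0))) :=
      ENNReal.tendsto_ofReal ((hc.tendsto 0).comp hlim)
    rw [h2.liminf_eq, ENNReal.ofReal_rpow_of_pos hs, ← ENNReal.ofReal_mul (by positivity)]
    congr 1
    rw [heat, Real.rpow_neg hs.le, ← Real.sqrt_eq_rpow, ← mul_inv,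
      ← Real.sqrt_mul (by positivity)]
    simp
  rw [lintegral_congr_ae (hM.mono fun s hs => h1 s hs), lintegral_const_mul _ (by fun_prop), h,
    ENNReal.mul_top (by simp [Real.pi_pos]), top_le_iff] at hf
  rw [tendsto_atTop]
  intro K
  have h2 : ENNReal.ofReal K < liminf (fun n => ∫⁻ s, ENNReal.ofReal (heat s (v n)) ∂M) atTop := by
    rw [hf]; exact ENNReal.ofReal_lt_top
  obtain ⟨n, hn⟩ := (eventually_lt_of_lt_liminf h2).exists
  rw [← ofReal_mixtureDensity (hv0 n).ne'] at hn
  have h3 : K ≤ mixtureDensity M (v n) := (ENNReal.ofReal_lt_ofReal_iff'.1 hn).1.le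
  have h4 : ∀ᶠ x in 𝓝[≠] (0 : ℝ), |x| < v n :=
    nhdsWithin_le_nhds (by
      have := Metric.ball_mem_nhds (0 : ℝ) (hv0 n)
      filter_upwards [this] with x hx
      simpa using hx)
  filter_upwards [h4, self_mem_nhdsWithin] with x hx hx0
  refine h3.trans (mixtureDensity_le hx0 ?_)
  rw [abs_of_pos (hv0 n)]
  exact hx.le

/-- Up to sign, the derivative of order `2k` of the mixture density. -/
noncomputable def cosFourier (M : Measure ℝ) (k : ℕ) (v : ℝ) : ℝ :=
  ∫ ξ, (2 * Real.pi * ξ) ^ (2 * k) * mixtureFourier M ξ * Real.cos (2 * Real.pi * ξ * v)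

omit [IsProbabilityMeasure M] in
lemma cosFourier_neg (k : ℕ) (v : ℝ) : cosFourier M k (-v) = cosFourier M k v := by
  simp only [cosFourier, mul_neg, Real.cos_neg]

lemma integrable_pow_two_mul (hM : ∀ᵐ s ∂M, 0 < s) {k : ℕ}
    (h : ∫⁻ s, ENNReal.ofReal s ^ (-((((2 * k : ℕ) : ℝ) + 1) / 2)) ∂M ≠ ⊤) :
    Integrable fun ξ => (2 * Real.pi * ξ) ^ (2 * k) * mixtureFourier M ξ := by
  refine ((integrable_pow_mul_mixtureFourier hM le_rfl h).const_mul
    ((2 * Real.pi) ^ (2 * k))).congr (ae_of_all _ fun ξ => ?_)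
  dsimp only
  rw [mul_pow, (even_two_mul k).pow_abs]
  ring

lemma integrable_pow_two_mul_cos (hM : ∀ᵐ s ∂M, 0 < s) {k : ℕ}
    (h : ∫⁻ s, ENNReal.ofReal s ^ (-((((2 * k : ℕ) : ℝ) + 1) / 2)) ∂M ≠ ⊤) (v : ℝ) :
    Integrable fun ξ => (2 * Real.pi * ξ) ^ (2 * k) * mixtureFourier M ξ *
      Real.cos (2 * Real.pi * ξ * v) :=
  (integrable_pow_two_mul hM h).mul_bdd (c := 1)
    (Continuous.aestronglyMeasurable (by fun_prop)) (ae_of_all _ fun ξ => Real.abs_cos_le_one _)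

lemma cosFourier_zero_sub (hM : ∀ᵐ s ∂M, 0 < s) {k : ℕ}
    (h : ∫⁻ s, ENNReal.ofReal s ^ (-((((2 * k : ℕ) : ℝ) + 1) / 2)) ∂M ≠ ⊤) (v : ℝ) :
    cosFourier M k 0 - cosFourier M k v = ∫ ξ, (2 * Real.pi * ξ) ^ (2 * k) * mixtureFourier M ξ *
      (1 - Real.cos (2 * Real.pi * ξ * v)) := by
  rw [cosFourier, cosFourier, ← integral_sub (integrable_pow_two_mul_cos hM h 0)
    (integrable_pow_two_mul_cos hM h v)]
  refine integral_congr_ae (ae_of_all _ fun ξ => ?_)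
  simp only [mul_zero, Real.cos_zero]
  ring

lemma integrable_pow_two_mul_one_sub_cos (hM : ∀ᵐ s ∂M, 0 < s) {k : ℕ}
    (h : ∫⁻ s, ENNReal.ofReal s ^ (-((((2 * k : ℕ) : ℝ) + 1) / 2)) ∂M ≠ ⊤) (v : ℝ) :
    Integrable fun ξ => (2 * Real.pi * ξ) ^ (2 * k) * mixtureFourier M ξ *
      (1 - Real.cos (2 * Real.pi * ξ * v)) := by
  refine ((integrable_pow_two_mul hM h).sub (integrable_pow_two_mul_cos hM h v)).congr
    (ae_of_all _ fun ξ => ?_)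
  simp only [Pi.sub_apply]
  ring

omit [IsProbabilityMeasure M] in
lemma pow_two_mul_one_sub_cos_nonneg (k : ℕ) (v ξ : ℝ) :
    0 ≤ (2 * Real.pi * ξ) ^ (2 * k) * mixtureFourier M ξ *
      (1 - Real.cos (2 * Real.pi * ξ * v)) :=
  mul_nonneg (mul_nonneg ((even_two_mul k).pow_nonneg _) (mixtureFourier_nonneg ξ))
    (by linarith [Real.cos_le_one (2 * Real.pi * ξ * v)])

/-- Differentiating the Fourier representation `2k` times identifies the derivative with
`cosFourier` up to the sign `(-1)^k`, and `r` orders of smoothness remain. -/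
lemma contDiff_cosFourier (hM : ∀ᵐ s ∂M, 0 < s) {k r : ℕ}
    (h : ∫⁻ s, ENNReal.ofReal s ^ (-((((2 * k : ℕ) : ℝ) + 1) / 2)) ∂M ≠ ⊤)
    (hd : ContDiff ℝ ((r + 2 * k : ℕ) : WithTop ℕ∞) (mixtureDensity M)) :
    ContDiff ℝ r (cosFourier M k) := by
  have hC : ContDiff ℝ ((r + 2 * k : ℕ) : WithTop ℕ∞) (fun v => (mixtureDensity M v : ℂ)) :=
    Complex.ofRealCLM.contDiff.comp hd
  rw [ofReal_mixtureDensity_eq_fourier hM h] at hC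
  have h1 := ContDiff.iterate_deriv' r (2 * k) hC
  rw [← iteratedDeriv_eq_iterate, Real.iteratedDeriv_fourier (N := (2 * k : ℕ)) (fun n hn => ?_)
    le_rfl] at h1
  · have h2 : cosFourier M k = fun v => Complex.reCLM ((-1 : ℂ) ^ k * 𝓕 (fun x : ℝ =>
        (-2 * Real.pi * Complex.I * x) ^ (2 * k) • (mixtureFourier M x : ℂ)) v) := by
      ext v
      rw [Real.fourier_real_eq_integral_exp_smul, ← integral_const_mul,
        ← ContinuousLinearMap.integral_comp_comm]
      · refine integral_congr_ae (ae_of_all _ fun x => ?_)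
        have h3 : (-2 * Real.pi * Complex.I * x : ℂ) ^ (2 * k) =
            (-1) ^ k * (((2 * Real.pi * x) ^ (2 * k) : ℝ) : ℂ) := by
          rw [pow_mul, pow_mul (2 * Real.pi * x)]
          push_cast
          rw [← mul_pow]
          congr 1
          ring_nf
          rw [Complex.I_sq]; ring
        have h4 : (-1 : ℂ) ^ k * (-1) ^ k = 1 := by
          rw [← mul_pow]; simp
        have h5 : (-1 : ℂ) ^ k * Complex.exp (↑(-2 * Real.pi * x * v) * Complex.I) •
            (-2 * Real.pi * Complex.I * x : ℂ) ^ (2 * k) • (mixtureFourier M x : ℂ) =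
            (((2 * Real.pi * x) ^ (2 * k) * mixtureFourier M x : ℝ) : ℂ) *
              Complex.exp (↑(-2 * Real.pi * x * v) * Complex.I) := by
          rw [h3, smul_eq_mul, smul_eq_mul, Complex.ofReal_mul ((2 * Real.pi * x) ^ (2 * k))]
          generalize Complex.exp (↑(-2 * Real.pi * x * v) * Complex.I) = e
          linear_combination (e * (((2 * Real.pi * x) ^ (2 * k) : ℝ) : ℂ) *
            (mixtureFourier M x : ℂ)) * h4
        dsimp only
        rw [h5, Complex.reCLM_apply, Complex.re_ofReal_mul, Complex.exp_ofReal_mul_I_re]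
        congr 1
        rw [← Real.cos_neg]; congr 1; ring
      · refine Integrable.const_mul ?_ _
        refine (integrable_pow_two_mul hM h).mono ?_ (ae_of_all _ fun x => ?_)
        · have := (measurable_mixtureFourier (M := M)).complex_ofReal
          exact Measurable.aestronglyMeasurable (by fun_prop)
        · rw [norm_smul, norm_smul, Complex.norm_exp_ofReal_mul_I, one_mul, norm_mul, norm_pow,
            norm_pow, Complex.norm_real]
          simp [Real.norm_eq_abs, abs_of_pos Real.pi_pos]
    rw [h2]
    exact Complex.reCLM.contDiff.comp (contDiff_const.mul h1)
  · have hn' : n ≤ 2 * k := Nat.cast_le.1 hn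
    refine (integrable_pow_mul_mixtureFourier hM hn' h).mono ?_ (ae_of_all _ fun x => ?_)
    · exact (Measurable.aestronglyMeasurable (by fun_prop : Measurable fun x : ℝ => x ^ n)).smul
        (measurable_mixtureFourier.complex_ofReal.aestronglyMeasurable)
    · rw [norm_smul, norm_mul, norm_pow, norm_pow, Complex.norm_real]
      simp

lemma deriv_zero_of_even {F : ℝ → ℝ} (hF : ∀ v, F (-v) = F v) : deriv F 0 = 0 := by
  have h := deriv_comp_neg F 0
  simp only [hF, neg_zero] at h
  linarith

/-- The second derivative of the even function `cosFourier` controls the next even moment. -/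
lemma lintegral_rpow_neg_ne_top_of_contDiff_two (hM : ∀ᵐ s ∂M, 0 < s) {k : ℕ}
    (h : ∫⁻ s, ENNReal.ofReal s ^ (-((((2 * k : ℕ) : ℝ) + 1) / 2)) ∂M ≠ ⊤)
    (hd : ContDiff ℝ 2 (cosFourier M k)) :
    ∫⁻ s, ENNReal.ofReal s ^ (-((((2 * k + 2 : ℕ) : ℝ) + 1) / 2)) ∂M ≠ ⊤ := by
  set H := cosFourier M k with hH
  have hd1 : Differentiable ℝ H := hd.differentiable (by norm_num)
  have hd2 : Differentiable ℝ (deriv H) := by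
    have : ContDiff ℝ (1 + 1) H := by
      have h2 : (1 + 1 : WithTop ℕ∞) = 2 := by norm_num
      rwa [h2]
    exact (contDiff_succ_iff_deriv.1 this).2.2.differentiable (by norm_num)
  have hd0 : deriv H 0 = 0 := deriv_zero_of_even (cosFourier_neg k)
  obtain ⟨C, hC, hbig⟩ := (hd2 0).isBigO_sub.exists_pos
  rw [Asymptotics.isBigOWith_iff] at hbig
  obtain ⟨δ, hδ, hball⟩ := Metric.eventually_nhds_iff_ball.1 hbig
  -- By evenness the first derivative vanishes at the origin, where it is differentiable, hence of
  -- order `v`; the mean value theorem gives a quadratic bound.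
  have hquad : ∀ v, 0 < v → v < δ → H 0 - H v ≤ C * v ^ 2 := by
    intro v hv hvδ
    obtain ⟨c, hc, hceq⟩ := exists_deriv_eq_slope H hv hd1.continuous.continuousOn
      hd1.differentiableOn
    have h1 := hball c (by
      rw [Metric.mem_ball, dist_zero_right, Real.norm_eq_abs, abs_of_pos hc.1]
      exact hc.2.trans hvδ)
    rw [hd0, sub_zero, sub_zero, Real.norm_eq_abs, Real.norm_eq_abs, abs_of_pos hc.1] at h1
    have h2 : deriv H c * v = H v - H 0 := by
      rw [hceq, sub_zero, div_mul_cancel₀ _ hv.ne']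
    have h3 := neg_abs_le (deriv H c)
    have h4 : C * c ≤ C * v := by
      have := hc.2.le
      gcongr
    nlinarith
  -- The quotient of `1 - cos` by `v²` is nonnegative and tends to half the squared frequency, so
  -- Fatou turns the quadratic bound into integrability with two more powers of `ξ`.
  have hf := lintegral_liminf_le (μ := (volume : Measure ℝ)) (u := 𝓝[>] (0 : ℝ))
    (f := fun v ξ => ENNReal.ofReal ((2 * Real.pi * ξ) ^ (2 * k) * mixtureFourier M ξ *
      (1 - Real.cos (2 * Real.pi * ξ * v)) / v ^ 2)) (fun v => by
        have := measurable_mixtureFourier (M := M)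
        fun_prop)
  have hl : ∀ ξ : ℝ, liminf (fun v => ENNReal.ofReal ((2 * Real.pi * ξ) ^ (2 * k) *
      mixtureFourier M ξ * (1 - Real.cos (2 * Real.pi * ξ * v)) / v ^ 2)) (𝓝[>] 0) =
      ENNReal.ofReal ((2 * Real.pi) ^ (2 * k + 2) / 2) *
        ENNReal.ofReal (mixtureFourier M ξ * |ξ| ^ ((2 * k + 2 : ℕ) : ℝ)) := by
    intro ξ
    have h1 := (tendsto_one_sub_cos_div (2 * Real.pi * ξ)).mono_left
      (nhdsGT_le_nhdsNE (0 : ℝ))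
    have h2 := ENNReal.tendsto_ofReal
      (h1.const_mul ((2 * Real.pi * ξ) ^ (2 * k) * mixtureFourier M ξ))
    have h3 : ∀ v : ℝ, (2 * Real.pi * ξ) ^ (2 * k) * mixtureFourier M ξ *
        ((1 - Real.cos (v * (2 * Real.pi * ξ))) / v ^ 2) = (2 * Real.pi * ξ) ^ (2 * k) *
        mixtureFourier M ξ * (1 - Real.cos (2 * Real.pi * ξ * v)) / v ^ 2 := fun v => by
      rw [mul_comm v, mul_div_assoc]
    simp only [h3] at h2
    rw [h2.liminf_eq, ← ENNReal.ofReal_mul (by positivity), Real.rpow_natCast]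
    congr 1
    have h4 : |ξ| ^ (2 * k + 2) = ξ ^ (2 * k + 2) :=
      (show Even (2 * k + 2) from ⟨k + 1, by ring⟩).pow_abs _
    rw [h4]
    ring
  simp only [hl] at hf
  have hle : liminf (fun v => ∫⁻ ξ, ENNReal.ofReal ((2 * Real.pi * ξ) ^ (2 * k) *
      mixtureFourier M ξ * (1 - Real.cos (2 * Real.pi * ξ * v)) / v ^ 2)) (𝓝[>] (0 : ℝ)) ≤
      ENNReal.ofReal C := by
    refine liminf_le_of_frequently_le' (Eventually.frequently ?_)
    filter_upwards [Ioo_mem_nhdsGT hδ] with v hv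
    have hv2 : 0 < v ^ 2 := by have := hv.1; positivity
    rw [← ofReal_integral_eq_lintegral_ofReal
      ((integrable_pow_two_mul_one_sub_cos hM h v).div_const _)
      (ae_of_all _ fun ξ => div_nonneg (pow_two_mul_one_sub_cos_nonneg k v ξ) hv2.le),
      integral_div, ← cosFourier_zero_sub hM h]
    refine ENNReal.ofReal_le_ofReal ?_
    rw [div_le_iff₀ hv2]
    exact hquad v hv.1 hv.2
  have hfin := hf.trans hle
  rw [lintegral_const_mul _ (by
    have := measurable_mixtureFourier (M := M)
    fun_prop)] at hfin
  have hne : ∫⁻ ξ, ENNReal.ofReal (mixtureFourier M ξ * |ξ| ^ ((2 * k + 2 : ℕ) : ℝ)) ≠ ⊤ := by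
    intro htop
    rw [htop, ENNReal.mul_top (by
      rw [Ne, ENNReal.ofReal_eq_zero, not_le]; positivity), top_le_iff] at hfin
    exact ENNReal.ofReal_ne_top hfin
  rw [← integrable_mixtureFourier_mul_iff hM (Nat.cast_nonneg _)]
  refine ⟨(measurable_mixtureFourier.mul (by fun_prop)).aestronglyMeasurable, ?_⟩
  rw [hasFiniteIntegral_iff_ofReal (ae_of_all _ fun ξ =>
    mul_nonneg (mixtureFourier_nonneg ξ) (by positivity))]
  exact hne.lt_top

/-- A lower bound on the Fourier transform excludes differentiability of `cosFourier`. -/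
lemma not_differentiableAt_cosFourier (hM : ∀ᵐ s ∂M, 0 < s) {k : ℕ}
    (h : ∫⁻ s, ENNReal.ofReal s ^ (-((((2 * k : ℕ) : ℝ) + 1) / 2)) ∂M ≠ ⊤) {c : ℝ} (hc : 0 < c)
    (hlow : ∀ ξ, 1 ≤ ξ → c / ξ ^ (2 * k + 2) ≤ mixtureFourier M ξ) :
    ¬ DifferentiableAt ℝ (cosFourier M k) 0 := by
  intro hd
  set H := cosFourier M k with hH
  -- For `1/4 ≤ ξv ≤ 1/2` the cosine is nonpositive and the integrand is at least `c (2v)²`; this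
  -- window has length `1/(4v)`, which gives `c v`.
  have hgrow : ∀ v, 0 < v → v < 1 / 4 → c * v ≤ H 0 - H v := by
    intro v hv hv4
    rw [hH, cosFourier_zero_sub hM h]
    have hint := integrable_pow_two_mul_one_sub_cos hM h v
    refine le_trans ?_ (setIntegral_le_integral (s := Set.Icc (1 / (4 * v)) (1 / (2 * v))) hint
      (ae_of_all _ fun ξ => pow_two_mul_one_sub_cos_nonneg k v ξ))
    have hconst := setIntegral_ge_of_const_le_real (μ := (volume : Measure ℝ))
      (s := Set.Icc (1 / (4 * v)) (1 / (2 * v))) (c := c * (2 * v) ^ 2)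
      (f := fun ξ => (2 * Real.pi * ξ) ^ (2 * k) * mixtureFourier M ξ *
      (1 - Real.cos (2 * Real.pi * ξ * v))) measurableSet_Icc (by simp) (fun ξ hξ => ?_)
      hint.integrableOn
    · refine le_trans (le_of_eq ?_) hconst
      rw [Real.volume_real_Icc_of_le (by gcongr; norm_num)]
      field_simp
      ring
    · have hξ1 : 1 ≤ ξ := by
        refine le_trans ?_ hξ.1
        rw [one_le_div (by positivity)]; linarith
      have hξ0 : 0 < ξ := by linarith
      have hpi := Real.pi_gt_three
      have hξv : ξ * v ≤ 1 / 2 := by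
        have := hξ.2
        rw [le_div_iff₀ (by positivity)] at this
        linarith
      have hξv' : 1 / 4 ≤ ξ * v := by
        have := hξ.1
        rw [div_le_iff₀ (by positivity)] at this
        linarith
      have hcos : 1 ≤ 1 - Real.cos (2 * Real.pi * ξ * v) := by
        have := Real.cos_nonpos_of_pi_div_two_le_of_le (x := 2 * Real.pi * ξ * v)
          (by nlinarith) (by nlinarith)
        linarith
      have h1 : ξ ^ (2 * k) ≤ (2 * Real.pi * ξ) ^ (2 * k) := by
        gcongr
        nlinarith
      have h2 : c / ξ ^ 2 ≤ (2 * Real.pi * ξ) ^ (2 * k) * mixtureFourier M ξ := by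
        calc c / ξ ^ 2 = ξ ^ (2 * k) * (c / ξ ^ (2 * k + 2)) := by
              rw [pow_add]; field_simp
          _ ≤ _ := by
              gcongr
              exact hlow ξ hξ1
      have h3 : c * (2 * v) ^ 2 ≤ c / ξ ^ 2 := by
        rw [le_div_iff₀ (by positivity), mul_assoc, ← mul_pow]
        have : (2 * v * ξ) ^ 2 ≤ 1 := pow_le_one₀ (by positivity) (by linarith)
        nlinarith
      have h4 : 0 ≤ (2 * Real.pi * ξ) ^ (2 * k) * mixtureFourier M ξ :=
        mul_nonneg (by positivity) (mixtureFourier_nonneg ξ)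
      nlinarith
  have hder : HasDerivAt H 0 0 := by
    have := hd.hasDerivAt
    rwa [deriv_zero_of_even (cosFourier_neg k)] at this
  have hslope := (hasDerivAt_iff_tendsto_slope.1 hder).mono_left
    (nhdsGT_le_nhdsNE (0 : ℝ))
  -- Evenness would force the derivative to be zero, while the slopes on the right stay below `-c`.
  have hle : (0 : ℝ) ≤ -c := by
    refine le_of_tendsto hslope ?_
    filter_upwards [Ioo_mem_nhdsGT (by norm_num : (0 : ℝ) < 1 / 4)] with v hv
    rw [slope_def_field, sub_zero, div_le_iff₀ hv.1]
    linarith [hgrow v hv.1 hv.2]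
  linarith

/-- Smoothness of order `p` forces the corresponding negative moment of the variance. -/
theorem lintegral_rpow_neg_ne_top_of_contDiff (hM : ∀ᵐ s ∂M, 0 < s)
    (hlow : ∀ p : ℕ, ∫⁻ s, ENNReal.ofReal s ^ (-(((p : ℝ) + 1) / 2)) ∂M = ⊤ →
      ∃ c > 0, ∀ ξ : ℝ, 1 ≤ ξ → c / ξ ^ (p + 1) ≤ mixtureFourier M ξ) (p : ℕ)
    (hd : ContDiff ℝ p (mixtureDensity M)) :
    ∫⁻ s, ENNReal.ofReal s ^ (-(((p : ℝ) + 1) / 2)) ∂M ≠ ⊤ := by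
  induction p with
  | zero =>
    intro h
    rw [Nat.cast_zero, zero_add] at h
    have h1 := tendsto_mixtureDensity_atTop h hM
    have h2 := (hd.continuous.tendsto 0).mono_left (nhdsWithin_le_nhds (s := {0}ᶜ))
    exact not_tendsto_nhds_of_tendsto_atTop h1 _ h2
  | succ p ih =>
    have hp := ih (hd.of_le (by exact_mod_cast Nat.le_succ p))
    -- Passing to odd order uses the corner of the even-order derivative; passing to even order goes
    -- back to the derivative of order `2k` and uses two further derivatives.
    rcases Nat.even_or_odd' p with ⟨k, rfl | rfl⟩
    · intro htop
      obtain ⟨c, hc, hcl⟩ := hlow _ htop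
      refine not_differentiableAt_cosFourier hM hp hc hcl ?_
      have hd' : ContDiff ℝ ((1 + 2 * k : ℕ) : WithTop ℕ∞) (mixtureDensity M) := by
        rwa [add_comm 1]
      exact ((contDiff_cosFourier hM hp hd').differentiable (by norm_num)).differentiableAt
    · have hk := lintegral_rpow_neg_ne_top_of_le hM (Nat.le_succ (2 * k)) hp
      have hd' : ContDiff ℝ ((2 + 2 * k : ℕ) : WithTop ℕ∞) (mixtureDensity M) := by
        rwa [add_comm 2]
      have h2 := contDiff_cosFourier hM hk hd'
      exact lintegral_rpow_neg_ne_top_of_contDiff_two hM hk (by exact_mod_cast h2)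

end Regularity

/-! ### Assembling the equilibrium -/

/-- The mean of `cos²` is `1/2`, and `|cos|^r` is strictly smaller somewhere. It makes the moment
condition automatic for `μ = 0`. -/
lemma momentConst_pos {r : ℝ} (hr : 2 < r) : 0 < momentConst r := by
  have hpi := Real.pi_pos
  have h : ∫ θ in (0 : ℝ)..(2 * Real.pi), |Real.cos θ| ^ r <
      ∫ θ in (0 : ℝ)..(2 * Real.pi), Real.cos θ ^ 2 := by
    refine intervalIntegral.integral_lt_integral_of_continuousOn_of_le_of_exists_lt
      (by positivity) (Continuous.continuousOn ?_) (by fun_prop) (fun θ _ => ?_)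
      ⟨Real.pi / 3, ⟨by positivity, by linarith⟩, ?_⟩
    · exact (Real.continuous_cos.abs).rpow_const fun _ => Or.inr (by linarith)
    · rw [← sq_abs, ← Real.rpow_two]
      exact Real.rpow_le_rpow_of_exponent_ge' (abs_nonneg _) (Real.abs_cos_le_one θ) (by norm_num)
        hr.le
    · rw [← sq_abs, ← Real.rpow_two, Real.cos_pi_div_three]
      exact Real.rpow_lt_rpow_of_exponent_gt (by norm_num) (by norm_num) hr
  have h2 : ∫ θ in (0 : ℝ)..(2 * Real.pi), Real.cos θ ^ 2 = Real.pi := by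
    rw [integral_cos_sq]; simp
  rw [h2] at h
  have h3 : (∫ θ in (0 : ℝ)..(2 * Real.pi), |Real.cos θ| ^ r) / (2 * Real.pi) < 1 / 2 := by
    rw [div_lt_iff₀ (by positivity)]; linarith
  rw [momentConst]
  linarith

lemma lintegral_Ioi_exp {k : ℝ} (hk : 0 < k) (u : ℝ) :
    ∫⁻ x in Set.Ioi u, ENNReal.ofReal (k * Real.exp (-k * x)) =
      ENNReal.ofReal (Real.exp (-k * u)) := by
  have hk' : -k < 0 := by linarith
  rw [← ofReal_integral_eq_lintegral_ofReal ((integrableOn_exp_mul_Ioi hk' u).const_mul k)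
    (ae_of_all _ fun x => by positivity), integral_const_mul, integral_exp_mul_Ioi hk']
  congr 1
  field_simp

/-- When the drift is strong enough, the Fourier transform of the equilibrium decays no faster than
`ξ ^ -(p + 1)`. -/
lemma IsVarianceLaw.exists_le_mixtureFourier {lam mu E T : ℝ} {M : Measure ℝ}
    (hM : IsVarianceLaw lam mu E T M) (hM0 : ∀ᵐ s ∂M, 0 < s) (hlam : 0 ≤ lam) (hmu : 0 < mu)
    (hT : 0 < T) {p : ℕ} (h : 2 * lam + mu + ((p : ℝ) + 1) * drift mu E T ≤ 0) :
    ∃ c > 0, ∀ ξ : ℝ, 1 ≤ ξ → c / ξ ^ (p + 1) ≤ mixtureFourier M ξ := by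
  have := hM.prob
  set A := drift mu E T with hA
  set k := 2 * lam + mu with hk
  have hk0 : 0 < k := by positivity
  have hA0 : A < 0 := by
    by_contra! h0
    have : 0 ≤ ((p : ℝ) + 1) * A := by positivity
    linarith
  refine ⟨mu / k * Real.exp (-(2 * Real.pi ^ 2 * T)), by positivity, fun ξ hξ => ?_⟩
  have hξ0 : 0 < ξ := by linarith
  -- After this time the variance `e^{2Au} T` left by a thermostat event is at most `T/ξ²`, so its
  -- transform at `ξ` is bounded below. The clock exceeds `u₀` with probability at least
  -- `ξ^{-(p+1)}`.
  set u₀ := Real.log ξ / (-A) with hu₀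
  have hlog : 0 ≤ Real.log ξ := Real.log_nonneg hξ
  have hu₀0 : 0 ≤ u₀ := div_nonneg hlog (by linarith)
  have hAu : A * u₀ = -Real.log ξ := by
    rw [hu₀, div_neg, mul_neg, mul_div_cancel₀ _ hA0.ne]
  have hexp : 1 / ξ ^ (p + 1) ≤ Real.exp (-k * u₀) := by
    have h1 : (1 : ℝ) / ξ ^ (p + 1) = Real.exp (-(((p : ℝ) + 1) * Real.log ξ)) := by
      rw [Real.exp_neg, one_div]
      congr 1
      rw [show ((p : ℝ) + 1) = ((p + 1 : ℕ) : ℝ) by push_cast; rfl, mul_comm, Real.exp_mul,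
        Real.exp_log hξ0, Real.rpow_natCast]
    rw [h1]
    apply Real.exp_le_exp.2
    nlinarith
  rw [← ENNReal.ofReal_le_ofReal_iff (mixtureFourier_nonneg ξ), ofReal_mixtureFourier hM0,
    hM.fixed _ (by fun_prop), varianceStep]
  refine le_trans ?_ le_add_self
  rw [lintegral_expLaw]
  calc ENNReal.ofReal (mu / k * Real.exp (-(2 * Real.pi ^ 2 * T)) / ξ ^ (p + 1))
      = ENNReal.ofReal (mu / k) * (ENNReal.ofReal (1 / ξ ^ (p + 1)) *
          ENNReal.ofReal (Real.exp (-(2 * Real.pi ^ 2 * T)))) := by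
        rw [← ENNReal.ofReal_mul (by positivity), ← ENNReal.ofReal_mul (by positivity)]
        congr 1
        ring
    _ ≤ ENNReal.ofReal (mu / k) * (ENNReal.ofReal (Real.exp (-k * u₀)) *
          ENNReal.ofReal (Real.exp (-(2 * Real.pi ^ 2 * T)))) := by
        gcongr
    _ = ENNReal.ofReal (mu / k) * ∫⁻ u in Set.Ioi u₀, ENNReal.ofReal (k * Real.exp (-k * u)) *
          ENNReal.ofReal (Real.exp (-(2 * Real.pi ^ 2 * T))) := by
        rw [lintegral_mul_const _ (by fun_prop), lintegral_Ioi_exp hk0]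
    _ ≤ ENNReal.ofReal (mu / k) * ∫⁻ u in Set.Ioi u₀, ENNReal.ofReal (k * Real.exp (-k * u)) *
          ENNReal.ofReal (Real.exp (-(2 * Real.pi ^ 2 * ξ ^ 2 *
            (Real.exp (2 * A * u) * T)))) := by
        refine mul_le_mul_right (setLIntegral_mono' measurableSet_Ioi fun u hu => ?_) _
        refine mul_le_mul_right (ENNReal.ofReal_le_ofReal (Real.exp_le_exp.2 (neg_le_neg ?_))) _
        have hu' : A * u ≤ -Real.log ξ := by
          rw [← hAu]
          exact mul_le_mul_of_nonpos_left (Set.mem_Ioi.1 hu).le hA0.le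
        have h2 : ξ ^ 2 * Real.exp (2 * A * u) ≤ 1 := by
          have h3 : ξ ^ 2 = Real.exp (2 * Real.log ξ) := by
            rw [two_mul, Real.exp_add, Real.exp_log hξ0, sq]
          rw [h3, ← Real.exp_add]
          exact Real.exp_le_one_iff.2 (by linarith)
        calc 2 * Real.pi ^ 2 * ξ ^ 2 * (Real.exp (2 * A * u) * T)
            = 2 * Real.pi ^ 2 * (ξ ^ 2 * Real.exp (2 * A * u)) * T := by ring
          _ ≤ 2 * Real.pi ^ 2 * 1 * T := by gcongr
          _ = _ := by ring
    _ ≤ _ := by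
        gcongr

/-- The two sides differ by the positive factor `(p + 1) μ / 2`. -/
lemma regularityCondition_iff {lam mu E T p : ℝ} (hlam : 0 ≤ lam) (hmu : 0 < mu) (hE : 0 < E)
    (hp : 0 ≤ p) :
    RegularityCondition lam mu E T p ↔ 0 < 2 * lam + mu + (p + 1) * drift mu E T := by
  have h : 2 * lam + mu + (p + 1) * drift mu E T =
      (p + 1) * mu / 2 * (1 + 2 / (p + 1) * (mu / (2 * lam + mu))⁻¹ - T / E) := by
    have hpos : 0 < 2 * lam + mu := by linarith
    have : 0 < p + 1 := by linarith
    rw [drift]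
    field_simp
    ring
  rw [RegularityCondition, or_iff_right hmu.ne', h, mul_pos_iff_of_pos_left (by positivity),
    sub_pos]

/-- The variance law of the equilibrium with its moments. -/
theorem exists_isVarianceLaw_moments {lam mu E T : ℝ} (hlam : 0 ≤ lam) (hmu : 0 ≤ mu) (hE : 0 < E)
    (hT : 0 < T) (hpos : 0 < 2 * lam + mu) :
    ∃ M, IsVarianceLaw lam mu E T M ∧ (∀ᵐ s ∂M, 0 < s) ∧
      (∀ r : ℝ, 2 < r → (∫⁻ s, ENNReal.ofReal s ^ (r / 2) ∂M ≠ ⊤ ↔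
        r * drift mu E T < 2 * lam * momentConst r + mu)) ∧
      (∀ p : ℝ, 0 ≤ p → (∫⁻ s, ENNReal.ofReal s ^ (-((p + 1) / 2)) ∂M ≠ ⊤ ↔
        RegularityCondition lam mu E T p)) ∧
      (∀ p : ℕ, ∫⁻ s, ENNReal.ofReal s ^ (-(((p : ℝ) + 1) / 2)) ∂M = ⊤ →
        ∃ c > 0, ∀ ξ : ℝ, 1 ≤ ξ → c / ξ ^ (p + 1) ≤ mixtureFourier M ξ) ∧
      (T ≤ E → ∃ s₀ > 0, ∀ᵐ s ∂M, s₀ ≤ s) := by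
  rcases hmu.eq_or_lt with rfl | hmu
  · have hlam' : 0 < lam := by linarith
    have hfin : ∀ q : ℝ, ∫⁻ s, ENNReal.ofReal s ^ q ∂(Measure.dirac E) ≠ ⊤ := fun q => by
      rw [lintegral_dirac, ENNReal.ofReal_rpow_of_pos hE]
      exact ENNReal.ofReal_ne_top
    have hae : ∀ {P : ℝ → Prop}, P E → ∀ᵐ s ∂(Measure.dirac E), P s := fun {P} h => by
      rw [ae_dirac_eq]
      exact h
    refine ⟨Measure.dirac E, isVarianceLaw_dirac hlam' hE, hae hE,
      fun r hr => iff_of_true (hfin _) ?_, fun p _ => iff_of_true (hfin _) (Or.inl rfl),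
      fun p h => absurd h (hfin _), fun _ => ⟨E, hE, hae le_rfl⟩⟩
    have := momentConst_pos hr
    rw [drift, zero_mul, mul_zero, add_zero]
    positivity
  · obtain ⟨M, m, hM, happ⟩ := exists_isVarianceLaw hlam hmu hE hT
    have hM0 := hM.pos hlam hmu hE hT
    have hneg : ∀ p : ℝ, 0 ≤ p → (∫⁻ s, ENNReal.ofReal s ^ (-((p + 1) / 2)) ∂M ≠ ⊤ ↔
        0 < 2 * lam + mu + (p + 1) * drift mu E T) := fun p hp => by
      rw [hM.lintegral_rpow_neg_ne_top_iff hlam hmu hE hT (by positivity),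
        show 2 * drift mu E T * ((p + 1) / 2) = (p + 1) * drift mu E T by ring]
    refine ⟨M, hM, hM0, fun r hr => ?_,
      fun p hp => (hneg p hp).trans (regularityCondition_iff hlam hmu hE hp).symm,
      fun p h => ?_, fun h => ⟨T, hT, hM.le_of_le hlam hmu hE hT h⟩⟩
    · have hq : 1 < r / 2 := by linarith
      have hr2 : 2 * (r / 2) = r := by ring
      constructor
      · intro h
        simpa only [hr2] using hM.lt_of_lintegral_rpow_ne_top hlam hmu hT hq h
      · intro h
        refine IsVarianceLaw.lintegral_rpow_ne_top_of_lt happ hlam hmu hE hT hq ?_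
        simpa only [hr2] using h
    · refine hM.exists_le_mixtureFourier hM0 hlam hmu hT (not_lt.1 fun h0 => ?_)
      exact (hneg p p.cast_nonneg).2 h0 h

end ThermostatedKac

theorem theorem1 (lam mu E T : ℝ) (hlam : 0 ≤ lam) (hmu : 0 ≤ mu) (hE : 0 < E) (hT : 0 < T)
    (hpos : 0 < 2 * lam + mu) :
    ∃ finf : ProbabilityMeasure ℝ,
      energy finf = ENNReal.ofReal E ∧
      -- convergence to equilibrium
      (∀ f : ℝ → ProbabilityMeasure ℝ, IsWeakSolution lam mu E T f →
        HasAdmissibleEnergy mu E (f 0) →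
        Tendsto f atTop (𝓝 finf) ∧
        ∀ t : ℝ, 0 ≤ t →
          W2 (f t) finf ≤
            W2 (f 0) finf * ENNReal.ofReal (Real.exp (-(mu * T / (2 * E)) * t))) ∧
      -- unique stationary weak solution
      IsStationary lam mu E T finf ∧
      (∀ ν : ProbabilityMeasure ℝ, IsStationary lam mu E T ν →
        HasAdmissibleEnergy mu E ν → ν = finf) ∧
      -- the equilibrium density
      ∃ h : ℝ → ℝ,
        Measurable h ∧ (∀ v, 0 ≤ h v) ∧
        (finf : Measure ℝ) = volume.withDensity (fun v => ENNReal.ofReal (h v)) ∧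
        -- symmetry and monotonicity
        Function.Even h ∧ AntitoneOn h (Set.Ioi 0) ∧
        -- moments
        (∀ r : ℝ, 2 < r →
          (Integrable (fun v => h v * |v| ^ r) ↔
            r * drift mu E T < 2 * lam * momentConst r + mu)) ∧
        -- smoothness away from the origin and the stationary equation
        ContDiffOn ℝ (∞ : ℕ∞ω) h {0}ᶜ ∧
        (∀ v : ℝ, v ≠ 0 →
          Integrable (fun x : ℝ × ℝ => collisionIntegrand h h v x.1 x.2)
            (volume.prod (volume.restrict (Set.Ioc 0 (2 * Real.pi)))) ∧
          drift mu E T * deriv (fun u => u * h u) v =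
            2 * lam * (B2density h h v - h v) + mu * (thermostatDensity T v - h v)) ∧
        -- behaviour at the origin
        (∀ p : ℕ, ContDiff ℝ p h ↔ RegularityCondition lam mu E T p) ∧
        (∀ p : ℝ, 0 < p →
          (Integrable (fun ξ : ℝ => ‖𝓕 (fun v : ℝ => (h v : ℂ)) ξ‖ * |ξ| ^ p) ↔
            RegularityCondition lam mu E T p)) ∧
        (mu ≠ 0 → 1 + 2 * (mu / (2 * lam + mu))⁻¹ ≤ T / E → Tendsto h (𝓝[≠] 0) atTop) ∧
        (T ≤ E → AnalyticOnNhd ℝ h Set.univ) := by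
  obtain ⟨M, hM, hM0, hmom, hneg, hlow, hmin⟩ :=
    exists_isVarianceLaw_moments hlam hmu hE hT hpos
  have := hM.prob
  have hen : energy (gaussianMixture M) = ENNReal.ofReal E :=
    (energy_gaussianMixture hM.nonneg).trans hM.mean
  have hadm : HasAdmissibleEnergy mu E ⟨gaussianMixture M, inferInstance⟩ :=
    ⟨hen.trans_lt ENNReal.ofReal_lt_top, fun _ => hen⟩
  have hst : IsStationary lam mu E T ⟨gaussianMixture M, inferInstance⟩ :=
    hM.isStationary hlam hmu hpos hT _ rfl
  refine ⟨⟨gaussianMixture M, inferInstance⟩, hen, fun f hf hf0 =>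
    ⟨hf.tendsto hlam hmu hpos hE hT hf0 hst hadm, fun t ht => hf.W2_le hlam hmu hE hst ht⟩, hst,
    -- A stationary solution is a constant curve that converges to the equilibrium.
    fun ν hν hν0 => tendsto_nhds_unique tendsto_const_nhds
      (hν.tendsto hlam hmu hpos hE hT hν0 hst hadm),
    mixtureDensity M, measurable_mixtureDensity, mixtureDensity_nonneg,
    gaussianMixture_eq_withDensity hM0, even_mixtureDensity, antitoneOn_mixtureDensity,
    fun r hr => (integrable_mixtureDensity_mul_iff hM0 (by linarith)).trans (hmom r hr),
    fun v hv => (analyticAt_mixtureDensity_of_ne_zero hM0 hv).contDiffAt.contDiffWithinAt,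
    fun v hv => ⟨integrable_collisionIntegrand hM0 hv, ?_⟩, fun p => ?_, fun p hp => ?_,
    fun hmu0 h => tendsto_mixtureDensity_atTop (by_contra fun h0 => ?_) hM0, fun h v _ => ?_⟩
  · rw [hM.drift_mul_deriv hlam hmu hpos hM0 hv, B2density_mixtureDensity hM0 hv, gainDensity,
      heat_eq_gaussianPDFReal hT.le, thermostatDensity]
    ring
  · rw [← hneg p p.cast_nonneg]
    exact ⟨lintegral_rpow_neg_ne_top_of_contDiff hM0 hlow p, contDiff_mixtureDensity hM0⟩
  · rw [← hneg p hp.le, ← integrable_mixtureFourier_mul_iff hM0 hp.le]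
    simp only [fourier_mixtureDensity hM0, Complex.norm_real, Real.norm_eq_abs,
      abs_of_nonneg (mixtureFourier_nonneg _)]
  -- A finite moment of order `-1/2` would mean the condition with `p = 0`, contradicting the
  -- assumed inequality; `μ ≠ 0` excludes its conventional validity.
  · have h1 : RegularityCondition lam mu E T 0 := (hneg 0 le_rfl).1 (by simpa using h0)
    rcases h1 with h1 | h1
    · exact hmu0 h1
    · norm_num at h1 h
      linarith
  · obtain ⟨s₀, hs₀, hs⟩ := hmin h
    exact analyticAt_mixtureDensity_of_le hs₀ hs v
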